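/- Let $\lambda_0,\mu,r>0$ and let $B$ be an almost surely positive random variable. Consider the univariate Markovian $DH/M/\infty$ queue (delayed Hawkes infinite-server queue): $N$ and $D$ are non-explosive simple point processes on $(0,\infty)$ (arrivals and departures, with no common jumps), $Q=N-D\ge 0$ is the number of customers present, and $$\Lambda(t)=\lambda_0+\sum_{i:\,t_i'<t}B_i\,e^{-r(t-t_i')},$$ where $t_1'<t_2'<\cdots$ are the departure times and $B_i$ is the mark drawn at $t_i'$. With respect to a filtration to which all of these are adapted, arrivals have stochastic intensity $\Lambda(t)$, departures have stochastic intensity $\mu Q(t)$, and each mark is distributed as $B$ and independent of the strict past of its departure. The system starts empty: $Q(0)=0$, $\Lambda(0)=\lambda_0$. Write $\bar Q^{q}=Q(Q-1)\cdots(Q-q+1)$ and $\bar Q^0=1$. Let $n\ge 1$ be an integer with $\mathbb E[B^n]<\infty$, put $b_1=\mathbb E[B]$ and $$Z^{(n+1)}(t)=\big(\mathbb E[\bar Q^{n-k}(t)\Lambda^k(t)]\big)_{k=0,\dots,n}\in\mathbb R^{n+1}.$$ Let $A^{(n+1)}$ be the tridiagonal $(n+1)\times(n+1)$ matrix whose row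 $k$ ($k=0,\dots,n$) has diagonal entry $-(kr+(n-k)\mu)$, superdiagonal entry $n-k$ and subdiagonal entry $k\mu b_1$. Let $C^{(n+1)}(t)$ be the vector with entries, for $k=0,\dots,n$, $$c_k(t)=\mathbf 1\{k\ge1\}\,kr\lambda_0\,\mathbb E[\bar Q^{n-k}(t)\Lambda^{k-1}(t)]+\mathbf 1\{k\ge2\}\,\mu\sum_{j=0}^{k-2}\binom kj\mathbb E[B^{k-j}]\,\mathbb E[\bar Q^{n-k+1}(t)\Lambda^{j}(t)],$$ which involves only joint moments of order at most $n-1$. Then the following hold. 1. All joint moments $\mathbb E[\bar Q^{q}(t)\Lambda^{g}(t)]$ with $q+g\le n$, $t\ge0$, are finite. On $[0,\infty)$ the vector $Z^{(n+1)}$ is the unique solution of $$\frac{\mathrm d}{\mathrm dt}Z^{(n+1)}(t)=A^{(n+1)}Z^{(n+1)}(t)+C^{(n+1)}(t),\qquad Z^{(n+1)}(0)=\lambda_0^n\,\boldsymbol e_{n+1},$$ where $\boldsymbol e_{n+1}$ is the last standard unit vector of $\mathbb R^{n+1}$, and for all $t\ge0$ $$Z^{(n+1)}(t)=e^{A^{(n+1)}t}Z^{(n+1)}(0)+\int_0^te^{A^{(n+1)}(t-s)}C^{(n+1)}(s)\,\mathrm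 ds .$$ 2. The eigenvalues of $A^{(n+1)}$ are exactly the $n+1$ pairwise distinct numbers $$\lambda_k^{(n+1)}=-\frac n2(\mu+r)+\frac{n-2k}{2}\sqrt{(\mu-r)^2+4\mu b_1},\qquad k=0,1,\dots,n,$$ and for all $t\in\mathbb R$ $$e^{A^{(n+1)}t}=\sum_{k=0}^ne^{\lambda_k^{(n+1)}t}\prod_{\substack{0\le j\le n\\ j\ne k}}\frac{A^{(n+1)}-\lambda_j^{(n+1)}I_{n+1}}{\lambda_k^{(n+1)}-\lambda_j^{(n+1)}} .$$ 3. $Z^{(n+1)}(t)$ converges in $\mathbb R^{n+1}$ as $t\to\infty$ if and only if $b_1/r<1$. -/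

import Mathlib

open MeasureTheory Filter
open scoped NNReal ENNReal Topology

namespace DelayedHawkes

/-- `τ 0 < τ 1 < ⋯` is the sequence of event times of a simple, non-explosive point process on
`(0, ∞)`; the value `∞` means that the event never takes place. -/
structure IsEventSequence (τ : ℕ → ℝ≥0∞) : Prop where
  pos : ∀ i, 0 < τ i
  mono : Monotone τ
  lt_succ : ∀ i, τ i ≠ ∞ → τ i < τ (i + 1)
  nonexplosive : Tendsto τ atTop (𝓝 ∞)

/-- The number of events up to and including time `t`. -/
noncomputable def count (τ : ℕ → ℝ≥0∞) (t : ℝ) : ℕ :=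
  {i : ℕ | τ i ≤ ENNReal.ofReal t}.ncard

section Dynamics

variable {Ω : Type*} [MeasurableSpace Ω]

/-- The point process with event times `τ i` has stochastic intensity `Λ` with respect to the
probability `P` and the filtration `ℱ`: for every nonnegative predictable process `C`,
`E ∑ᵢ C(τ i) = E ∫₀^∞ C(t) Λ(t) dt`. -/
def HasIntensity (P : Measure Ω) (ℱ : Filtration ℝ≥0 ‹MeasurableSpace Ω›)
    (τ : ℕ → Ω → ℝ≥0∞) (Λ : ℝ → Ω → ℝ≥0∞) : Prop :=
  ∀ C : ℝ≥0 × Ω → ℝ≥0∞, Measurable[ℱ.predictable] C →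
    ∫⁻ ω, ∑' i, (if τ i ω = ∞ then 0 else C ((τ i ω).toNNReal, ω)) ∂P
      = ∫⁻ ω, (∫⁻ t in Set.Ioi (0 : ℝ), C (t.toNNReal, ω) * Λ t ω) ∂P

/-- The marked point process with event times `τ i` and marks `B i` has the local characteristics
`(Λ, ν)`: its events have stochastic intensity `Λ`, and the mark of each event has law `ν` and is
independent of the strict past. That is, for every nonnegative predictable `C` depending also on a
mark, `E ∑ᵢ C(τ i, B i) = E ∫₀^∞ ∫ C(t, b) ν(db) Λ(t) dt`. -/
def HasMarkedIntensity (P : Measure Ω) (ℱ : Filtration ℝ≥0 ‹MeasurableSpace Ω›)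
    (τ : ℕ → Ω → ℝ≥0∞) (B : ℕ → Ω → ℝ) (Λ : ℝ → Ω → ℝ≥0∞) (ν : Measure ℝ) : Prop :=
  ∀ C : (ℝ≥0 × Ω) × ℝ → ℝ≥0∞,
    Measurable[ℱ.predictable.prod Real.measurableSpace] C →
    ∫⁻ ω, ∑' i, (if τ i ω = ∞ then 0 else C (((τ i ω).toNNReal, ω), B i ω)) ∂P
      = ∫⁻ ω, (∫⁻ t in Set.Ioi (0 : ℝ), (∫⁻ b, C ((t.toNNReal, ω), b) ∂ν) * Λ t ω) ∂P

/-- The number of customers present at time `t`, for arrival times `T` and departure times `S`,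
starting from an empty system. -/
noncomputable def queue (T S : ℕ → Ω → ℝ≥0∞) (t : ℝ) (ω : Ω) : ℕ :=
  count (fun i => T i ω) t - count (fun i => S i ω) t

/-- The intensity process `Λ(t) = λ₀ + ∑_{S i < t} B i e^{-r (t - S i)}`. -/
noncomputable def intensity (lam0 r : ℝ) (S : ℕ → Ω → ℝ≥0∞) (B : ℕ → Ω → ℝ) (t : ℝ) (ω : Ω) : ℝ :=
  lam0 + ∑' i, if S i ω < ENNReal.ofReal t then
    B i ω * Real.exp (-r * (t - (S i ω).toReal)) else 0

/-- The univariate Markovian delayed Hawkes infinite-server queue with baseline intensity `lam0`,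
service rate `μ`, excitation kernel `e^{-rt}` and mark law `ν`. The arrival times are `T i`, the
departure times (in increasing order) are `S i`, and `B i` is the mark drawn at the departure time
`S i`. The system starts empty with intensity `lam0`; arrivals have intensity `Λ(t)`, each of the
`Q(t)` customers present departs at rate `μ`, and a departure makes `Λ` jump by an independent
mark of law `ν`. -/
structure IsMarkovianQueue (P : Measure Ω) (ℱ : Filtration ℝ≥0 ‹MeasurableSpace Ω›)
    (lam0 μ r : ℝ) (ν : Measure ℝ) (T S : ℕ → Ω → ℝ≥0∞) (B : ℕ → Ω → ℝ) : Prop where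
  arrivals : ∀ ω, IsEventSequence fun i => T i ω
  departures : ∀ ω, IsEventSequence fun i => S i ω
  /-- No customer departs before having arrived. -/
  departures_le_arrivals : ∀ ω t, count (fun i => S i ω) t ≤ count (fun i => T i ω) t
  /-- The queue jumps by `+1` at every arrival and by `-1` at every departure. -/
  no_common_jump : ∀ ω i j, T i ω = S j ω → T i ω = ∞
  adapted_arrivals : ∀ i (t : ℝ≥0), MeasurableSet[ℱ t] {ω | T i ω ≤ t}
  adapted_departures : ∀ i (t : ℝ≥0) (G : Set ℝ), MeasurableSet G →
    MeasurableSet[ℱ t] {ω | S i ω ≤ t ∧ B i ω ∈ G}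
  arrival_intensity :
    HasIntensity P ℱ T fun t ω => ENNReal.ofReal (intensity lam0 r S B t ω)
  departure_intensity :
    HasMarkedIntensity P ℱ S B (fun t ω => ENNReal.ofReal (μ * queue T S t ω)) ν

/-- The random variable `Q(Q-1)⋯(Q-q+1) Λ^g` at time `t`, with `Q` the queue and `Λ` the
intensity. -/
noncomputable def momentVar (lam0 r : ℝ) (T S : ℕ → Ω → ℝ≥0∞) (B : ℕ → Ω → ℝ)
    (q g : ℕ) (t : ℝ) (ω : Ω) : ℝ :=
  ((queue T S t ω).descFactorial q : ℝ) * intensity lam0 r S B t ω ^ g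

/-- The joint moment `E[Q(Q-1)⋯(Q-q+1) Λ^g]` at time `t`. -/
noncomputable def moment (P : Measure Ω) (lam0 r : ℝ) (T S : ℕ → Ω → ℝ≥0∞) (B : ℕ → Ω → ℝ)
    (q g : ℕ) (t : ℝ) : ℝ :=
  ∫ ω, momentVar lam0 r T S B q g t ω ∂P

/-- The vector of joint moments of order `n`, of dimension `n + 1`. -/
noncomputable def Z (P : Measure Ω) (lam0 r : ℝ) (T S : ℕ → Ω → ℝ≥0∞) (B : ℕ → Ω → ℝ)
    (n : ℕ) (t : ℝ) : Fin (n + 1) → ℝ :=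
  fun k => moment P lam0 r T S B (n - k) k t

/-- The forcing vector, built from joint moments of order at most `n - 1`. -/
noncomputable def forcing (P : Measure Ω) (lam0 μ r : ℝ) (ν : Measure ℝ)
    (T S : ℕ → Ω → ℝ≥0∞) (B : ℕ → Ω → ℝ) (n : ℕ) (t : ℝ) : Fin (n + 1) → ℝ :=
  fun k =>
    (if 1 ≤ (k : ℕ) then k * r * lam0 * moment P lam0 r T S B (n - k) (k - 1) t else 0) +
    (if 2 ≤ (k : ℕ) then
      μ * ∑ j ∈ Finset.range (k - 1), ((k : ℕ).choose j : ℝ) * (∫ x, x ^ (k - j : ℕ) ∂ν) *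
        moment P lam0 r T S B (n - k + 1) j t
    else 0)

end Dynamics

/-- The tridiagonal `(n + 1) × (n + 1)` matrix with diagonal `-(k r + (n - k) μ)`, superdiagonal
`n - k` and subdiagonal `k μ b₁`, for rows `k = 0, …, n`. -/
def matA (μ r b₁ : ℝ) (n : ℕ) : Matrix (Fin (n + 1)) (Fin (n + 1)) ℝ :=
  Matrix.of fun k l =>
    if (l : ℕ) = k then -((k : ℝ) * r + ((n : ℝ) - k) * μ)
    else if (l : ℕ) = k + 1 then (n : ℝ) - k
    else if (l : ℕ) + 1 = k then (k : ℝ) * μ * b₁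
    else 0

/-- The numbers `-n(μ+r)/2 + (n-2k)/2 · √((μ-r)² + 4 μ b₁)`, `k = 0, …, n`. -/
noncomputable def eigA (μ r b₁ : ℝ) (n : ℕ) (k : Fin (n + 1)) : ℝ :=
  -((n : ℝ) / 2) * (μ + r) + ((n : ℝ) - 2 * (k : ℝ)) / 2 * √((μ - r) ^ 2 + 4 * μ * b₁)

end DelayedHawkes

/-! Write (Q)_a for the falling factorial. Along a path, Λ decays exponentially towards its baseline
and otherwise (Q, Λ) only jumps, so (Q)_a Λ^g equals its initial value plus a drift integral plus
sums over arrivals and departures (`momentVarL_path`). Taken at left limits, the summands are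
predictable, up to the mark drawn at the event, so the definition of intensity turns the expected
sums into time integrals. An arrival (rate Λ) contributes a (Q)_{a-1} Λ^{g+1}. A departure (rate μQ)
removes aμ (Q)_a Λ^g and, once (Λ+B)^g - Λ^g is expanded, adds multiples of (Q)_{a+1} Λ^j with j <
g. The total degree never rises, so the moments of order at most n form a closed linear system.

Finiteness is not known beforehand. The identity is therefore first used as an inequality in [0,∞],
weighted by a predictable cutoff that makes every moment bounded. Grönwall gives a bound free of the
cutoff level, and monotone convergence removes the cutoff (`weightedMoment_one_le`). The identity
then becomes a real integral equation (`moment_eq_integral`), which yields first continuity and then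
differentiability of the moments (`hasDerivWithinAt_moment`).

The matrix is the n-th symmetric power of the first-order system x' = -μx + y, y' = μb₁x - ry: it
describes how the monomials x^{n-l} y^l evolve. With λ₊, λ₋ the two roots for n = 1, its eigenvalues
are (n-k)λ₊ + kλ₋ and its eigenvectors are read off products of linear forms (`eigPoly_identity`).
As b₁ > 0 the eigenvalues are distinct, and diagonalization gives the exponential, the interpolation
formula, variation of constants and uniqueness.

If b₁ < r all eigenvalues are negative for n ≥ 1, and induction on n makes the forcing converge,
hence also Z (`tendsto_Z_of_lt`). If b₁ ≥ r, then E Λ + r E Q grows at least linearly, while the two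
extreme entries of Z control these first moments (`lt_of_tendsto_Z`). -/

namespace DelayedHawkes

/-! ### Spectral decomposition of the tridiagonal matrix. -/

section LinearAlgebra

/-- Indexing `w` by ℕ avoids boundary cases: the out-of-range entry at `k = n` and the truncated `k
- 1` at `k = 0` both carry coefficient zero. -/
lemma matA_mulVec (μ r b₁ : ℝ) (n : ℕ) (w : ℕ → ℝ) (k : Fin (n + 1)) :
    (matA μ r b₁ n).mulVec (fun l => w l) k =
      -((k : ℝ) * r + ((n : ℝ) - k) * μ) * w k + ((n : ℝ) - k) * w (k + 1)
        + (k : ℝ) * μ * b₁ * w (k - 1) := by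
  have key : ∀ l : ℕ, (if l = (k : ℕ) then -((k : ℝ) * r + ((n : ℝ) - k) * μ)
      else if l = (k : ℕ) + 1 then (n : ℝ) - k
      else if l + 1 = (k : ℕ) then (k : ℝ) * μ * b₁ else 0) * w l
      = (if l = (k : ℕ) then -((k : ℝ) * r + ((n : ℝ) - k) * μ) * w l else 0)
        + (if l = (k : ℕ) + 1 then ((n : ℝ) - k) * w l else 0)
        + (if l + 1 = (k : ℕ) then (k : ℝ) * μ * b₁ * w l else 0) := by
    intro l
    split_ifs <;> first | omega | simp
  simp only [Matrix.mulVec, dotProduct, matA, Matrix.of_apply]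
  rw [Fin.sum_univ_eq_sum_range (fun l => (if l = (k : ℕ) then -((k : ℝ) * r + ((n : ℝ) - k) * μ)
      else if l = (k : ℕ) + 1 then (n : ℝ) - k
      else if l + 1 = (k : ℕ) then (k : ℝ) * μ * b₁ else 0) * w l) (n + 1)]
  simp_rw [key, Finset.sum_add_distrib]
  have hk := k.2
  congr 1
  · congr 1
    · rw [Finset.sum_ite_eq' (Finset.range (n + 1)), if_pos (Finset.mem_range.2 hk)]
    · rw [Finset.sum_ite_eq' (Finset.range (n + 1))]
      split_ifs with h
      · rfl
      · have : (k : ℕ) = n := by simp at h; omega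
        simp [this]
  · rcases Nat.eq_zero_or_pos (k : ℕ) with h0 | h0
    · simp [h0]
    · have : ∀ l : ℕ, (l + 1 = (k : ℕ)) ↔ l = (k : ℕ) - 1 := fun l => by omega
      simp_rw [this]
      rw [Finset.sum_ite_eq' (Finset.range (n + 1)), if_pos (Finset.mem_range.2 (by omega))]

open Polynomial in
/-- The polynomial `(1 + X)^a (p + q X)^l`, whose coefficients are entries of eigenvectors. -/
noncomputable def eigPoly (p q : ℝ) (a l : ℕ) : ℝ[X] :=
  (1 + X) ^ a * (C p + C q * X) ^ l

open Polynomial in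
-- The hypotheses say that (1, p) and (1, q) are eigenvectors of the 2×2 first-order system, with
-- eigenvalues `lp` and `lm`. By the product rule the identity splits into `a` times the first row
-- of that system and `l` times the second. Since X d/dX multiplies the k-th coefficient by k, each
-- coefficient gives an eigenvector.
lemma eigPoly_identity (μ r b₁ lp lm p q : ℝ) (hp : p = μ + lp) (hq : q = μ + lm)
    (h1 : μ * b₁ - r * p = lp * p) (h2 : μ * b₁ - r * q = lm * q) (a l : ℕ) :
    C (-((l : ℝ) * r + a * μ)) * eigPoly p q a l + C (a : ℝ) * eigPoly p q (a - 1) (l + 1)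
      + C ((l : ℝ) * μ * b₁) * eigPoly p q (a + 1) (l - 1)
    = C (((a : ℝ) + l) * lp) * eigPoly p q a l
      + C (lm - lp) * (X * derivative (eigPoly p q a l)) := by
  -- `E1` and `E2` are the two rows of the 2×2 system: the constant coefficient is the relation for
  -- (1, p), the coefficient of X the one for (1, q).
  have E1 : -(C μ + C lp) * (1 + X) + (C p + C q * X) - (C lm - C lp) * X = (0 : ℝ[X]) := by
    rw [hp, hq]; simp only [C_add]; ring
  have E2 : C μ * C b₁ * (1 + X) - (C r + C lp) * (C p + C q * X) - (C lm - C lp) * C q * X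
      = (0 : ℝ[X]) := by
    have e1 : (C μ * C b₁ - C r * C p : ℝ[X]) = C lp * C p := by
      simp only [← C_mul, ← C_sub, h1]
    have e2 : (C μ * C b₁ - C r * C q : ℝ[X]) = C lm * C q := by
      simp only [← C_mul, ← C_sub, h2]
    linear_combination e1 + X * e2
  simp only [eigPoly, derivative_mul, derivative_pow, derivative_add, derivative_one, derivative_X,
    derivative_C, C_neg, C_add, C_mul, C_sub, map_natCast]
  rcases a with _ | a <;> rcases l with _ | l
  · simp
  · simp only [Nat.cast_zero, Nat.add_sub_cancel]
    linear_combination (C p + C q * X) ^ l * ((l + 1 : ℕ) : ℝ[X]) * E2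
  · simp only [Nat.cast_zero, Nat.add_sub_cancel]
    linear_combination (1 + X) ^ a * ((a + 1 : ℕ) : ℝ[X]) * E1
  · simp only [Nat.add_sub_cancel]
    linear_combination (C p + C q * X) ^ l * (1 + X) ^ (a + 1) * ((l + 1 : ℕ) : ℝ[X]) * E2
      + (C p + C q * X) ^ (l + 1) * (1 + X) ^ a * ((a + 1 : ℕ) : ℝ[X]) * E1

lemma eigA_injective (μ r b₁ : ℝ) (hμ : 0 < μ) (hb : 0 < b₁) (n : ℕ) :
    Function.Injective (eigA μ r b₁ n) := by
  have hs : 0 < √((μ - r) ^ 2 + 4 * μ * b₁) := Real.sqrt_pos.2 (by positivity)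
  intro k l h
  simp only [eigA, add_right_inj] at h
  have := mul_right_cancel₀ hs.ne' h
  have h' : (k : ℝ) = (l : ℝ) := by linarith
  exact Fin.ext (by exact_mod_cast h')

/-- The matrix whose columns are eigenvectors of `matA`. -/
noncomputable def eigMat (μ r b₁ : ℝ) (n : ℕ) : Matrix (Fin (n + 1)) (Fin (n + 1)) ℝ :=
  Matrix.of fun l k =>
    (eigPoly ((μ - r + √((μ - r) ^ 2 + 4 * μ * b₁)) / 2)
      ((μ - r - √((μ - r) ^ 2 + 4 * μ * b₁)) / 2) (n - l) l).coeff k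

lemma matA_mul_eigMat (μ r b₁ : ℝ) (hμ : 0 < μ) (hb : 0 < b₁) (n : ℕ) :
    matA μ r b₁ n * eigMat μ r b₁ n = eigMat μ r b₁ n * Matrix.diagonal (eigA μ r b₁ n) := by
  set s := √((μ - r) ^ 2 + 4 * μ * b₁) with hs
  have hss : s * s = (μ - r) ^ 2 + 4 * μ * b₁ := Real.mul_self_sqrt (by positivity)
  ext l k
  rw [Matrix.mul_diagonal]
  have h1 := matA_mulVec μ r b₁ n (fun l => (eigPoly ((μ - r + s) / 2)
      ((μ - r - s) / 2) (n - l) l).coeff k) l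
  have h2 : (matA μ r b₁ n * eigMat μ r b₁ n) l k = (matA μ r b₁ n).mulVec
      (fun l => (eigPoly ((μ - r + s) / 2) ((μ - r - s) / 2) (n - l) l).coeff k) l := by
    simp [Matrix.mul_apply, Matrix.mulVec, dotProduct, eigMat, hs]
  rw [h2, h1]
  have h3 := congrArg (fun P => Polynomial.coeff P k)
    (eigPoly_identity μ r b₁ ((-(μ + r) + s) / 2) ((-(μ + r) - s) / 2)
      ((μ - r + s) / 2) ((μ - r - s) / 2) (by ring) (by ring) (by linarith) (by linarith) (n - l) l)
  have hl := Nat.lt_succ_iff.1 l.2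
  simp only [Polynomial.coeff_add, Polynomial.coeff_C_mul] at h3
  have e1 : n - (l : ℕ) - 1 = n - ((l : ℕ) + 1) := by omega
  have e3 : (Polynomial.X * Polynomial.derivative
      (eigPoly ((μ - r + s) / 2) ((μ - r - s) / 2) (n - l) l)).coeff k
      = (k : ℝ) * (eigPoly ((μ - r + s) / 2) ((μ - r - s) / 2) (n - l) l).coeff k := by
    rcases hk : (k : ℕ) with _ | j
    · simp
    · rw [Polynomial.coeff_X_mul, Polynomial.coeff_derivative]; push_cast; ring
  rw [e1, e3, Nat.cast_sub hl] at h3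
  -- The exponents n - l + 1 and n - (l - 1) differ only at l = 0, where the factor l vanishes.
  have e2 : (l : ℝ) * μ * b₁ * (eigPoly ((μ - r + s) / 2) ((μ - r - s) / 2) (n - l + 1) (l - 1)).coeff k
     = (l : ℝ) * μ * b₁ * (eigPoly ((μ - r + s) / 2) ((μ - r - s) / 2) (n - (l - 1)) (l - 1)).coeff k := by
    rcases Nat.eq_zero_or_pos (l : ℕ) with h0 | h0
    · simp [h0]
    · rw [show n - (l : ℕ) + 1 = n - ((l : ℕ) - 1) by omega]
  rw [e2] at h3
  rw [h3]
  simp only [eigMat, eigA, Matrix.of_apply, ← hs]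
  ring

/-- The columns are eigenvectors for distinct eigenvalues, hence independent. They are nonzero
because row 0 consists of the coefficients of (1+X)^n, which are binomial coefficients. -/
lemma isUnit_eigMat (μ r b₁ : ℝ) (hμ : 0 < μ) (hb : 0 < b₁) (n : ℕ) :
    IsUnit (eigMat μ r b₁ n) := by
  rw [← Matrix.linearIndependent_cols_iff_isUnit]
  refine Module.End.eigenvectors_linearIndependent' (Matrix.toLin' (matA μ r b₁ n))
    (eigA μ r b₁ n) (eigA_injective μ r b₁ hμ hb n) _ fun k => ?_
  rw [Module.End.hasEigenvector_iff, Module.End.mem_eigenspace_iff]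
  constructor
  · have := congrArg (fun M => M.col k) (matA_mul_eigMat μ r b₁ hμ hb n)
    ext l
    have h := congrFun this l
    simp only [Matrix.col_apply, Matrix.mul_diagonal] at h
    simp only [Matrix.toLin'_apply, Pi.smul_apply, smul_eq_mul, Matrix.col_apply]
    rw [mul_comm, ← h]
    rfl
  · intro h
    have := congrFun h 0
    simp only [Matrix.col_apply, eigMat, Matrix.of_apply, eigPoly, Fin.val_zero, pow_zero, mul_one,
      Nat.sub_zero, Pi.zero_apply, Polynomial.coeff_one_add_X_pow] at this
    exact (Nat.choose_pos (Nat.lt_succ_iff.1 k.2)).ne' (by exact_mod_cast this)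

end LinearAlgebra

/-! ### Exponential, spectrum and interpolation for a diagonalized matrix. -/

section Diagonalized

variable {m : ℕ} {A V : Matrix (Fin m) (Fin m) ℝ} {lam : Fin m → ℝ}

lemma exp_smul_mul_eq (hV : IsUnit V) (hA : A * V = V * Matrix.diagonal lam) (t : ℝ) :
    NormedSpace.exp (t • A) = V * Matrix.diagonal (fun k => Real.exp (lam k * t)) * V⁻¹ := by
  have hdet : IsUnit V.det := (Matrix.isUnit_iff_isUnit_det _).1 hV
  have h1 : t • A = V * Matrix.diagonal (t • lam) * V⁻¹ := by
    rw [Matrix.diagonal_smul, Matrix.mul_smul, ← hA, Matrix.smul_mul, Matrix.mul_assoc,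
      Matrix.mul_nonsing_inv _ hdet, Matrix.mul_one]
  rw [h1, Matrix.exp_conj _ _ hV, Matrix.exp_diagonal]
  congr 3
  ext k
  rw [Pi.coe_exp, ← Real.exp_eq_exp_ℝ]
  simp [mul_comm]

lemma hasEigenvalue_iff_of_diagonalized (hV : IsUnit V) (hA : A * V = V * Matrix.diagonal lam)
    (x : ℝ) : Module.End.HasEigenvalue (Matrix.toLin' A) x ↔ ∃ k, x = lam k := by
  have hdet : IsUnit V.det := (Matrix.isUnit_iff_isUnit_det _).1 hV
  constructor
  · intro h
    obtain ⟨w, hw⟩ := h.exists_hasEigenvector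
    have hw1 : A.mulVec w = x • w := by simpa using hw.apply_eq_smul
    set u := V⁻¹.mulVec w with hu
    have hwu : w = V.mulVec u := by
      rw [hu, Matrix.mulVec_mulVec, Matrix.mul_nonsing_inv _ hdet, Matrix.one_mulVec]
    have hu0 : u ≠ 0 := fun h0 => hw.2 (by rw [hwu, h0, Matrix.mulVec_zero])
    obtain ⟨k, hk⟩ := Function.ne_iff.1 hu0
    refine ⟨k, ?_⟩
    have h2 : (Matrix.diagonal lam).mulVec u = x • u := by
      have : V.mulVec ((Matrix.diagonal lam).mulVec u) = V.mulVec (x • u) := by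
        rw [Matrix.mulVec_mulVec, ← hA, ← Matrix.mulVec_mulVec, ← hwu, hw1, Matrix.mulVec_smul,
          ← hwu]
      exact Matrix.mulVec_injective_of_isUnit hV this
    have h3 := congrFun h2 k
    simp only [Matrix.mulVec_diagonal, Pi.smul_apply, smul_eq_mul] at h3
    exact (mul_right_cancel₀ hk h3).symm
  · rintro ⟨k, rfl⟩
    refine Module.End.hasEigenvalue_of_hasEigenvector (x := V.col k) ?_
    rw [Module.End.hasEigenvector_iff, Module.End.mem_eigenspace_iff]
    constructor
    · have := congrArg (fun M => M.col k) hA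
      ext l
      have h := congrFun this l
      simp only [Matrix.col_apply, Matrix.mul_diagonal] at h
      simp only [Matrix.toLin'_apply, Pi.smul_apply, smul_eq_mul, Matrix.col_apply]
      rw [mul_comm, ← h]
      rfl
    · exact (Matrix.linearIndependent_cols_iff_isUnit.2 hV).ne_zero k

/-- Pushing each factor through `V` replaces `A` by the diagonal matrix, so an ordered matrix
product becomes scalar products entry by entry. -/
lemma list_prod_mul_eq (hA : A * V = V * Matrix.diagonal lam) (c : Fin m → ℝ)
    (L : List (Fin m)) :
    (L.map fun j => c j • (A - lam j • (1 : Matrix (Fin m) (Fin m) ℝ))).prod * V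
      = V * Matrix.diagonal fun i => (L.map fun j => c j * (lam i - lam j)).prod := by
  induction L with
  | nil => simp
  | cons j L ih =>
    rw [List.map_cons, List.prod_cons, Matrix.mul_assoc, ih, ← Matrix.mul_assoc]
    have h1 : c j • (A - lam j • (1 : Matrix (Fin m) (Fin m) ℝ)) * V
        = V * Matrix.diagonal fun i => c j * (lam i - lam j) := by
      rw [Matrix.smul_mul, Matrix.sub_mul, hA, Matrix.smul_mul, Matrix.one_mul]
      ext a b
      simp only [Matrix.smul_apply, Matrix.sub_apply, Matrix.mul_diagonal, smul_eq_mul]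
      ring
    rw [h1, Matrix.mul_assoc, Matrix.diagonal_mul_diagonal]
    simp

lemma exp_smul_eq_interpolation (hV : IsUnit V) (hA : A * V = V * Matrix.diagonal lam)
    (hlam : Function.Injective lam) (t : ℝ) :
    NormedSpace.exp (t • A) = ∑ k, Real.exp (lam k * t) •
        (((List.finRange m).filter (fun j => j ≠ k)).map
          (fun j => (lam k - lam j)⁻¹ • (A - lam j • (1 : Matrix (Fin m) (Fin m) ℝ)))).prod := by
  have hdet : IsUnit V.det := (Matrix.isUnit_iff_isUnit_det _).1 hV
  -- The scalar Lagrange basis: for i ≠ k the factor j = i vanishes, for i = k every factor is 1.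
  have key : ∀ i k : Fin m, (((List.finRange m).filter (fun j => j ≠ k)).map
      fun j => (lam k - lam j)⁻¹ * (lam i - lam j)).prod = if i = k then 1 else 0 := by
    intro i k
    split_ifs with h
    · subst h
      refine List.prod_eq_one fun x hx => ?_
      obtain ⟨j, hj, rfl⟩ := List.mem_map.1 hx
      have hji : j ≠ i := by simpa using (List.mem_filter.1 hj).2
      exact inv_mul_cancel₀ (sub_ne_zero.2 fun h => hji (hlam h).symm)
    · refine List.prod_eq_zero (List.mem_map.2 ⟨i, ?_, by simp⟩)
      simp [h]
  have h1 : NormedSpace.exp (t • A) * V = (∑ k, Real.exp (lam k * t) •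
        (((List.finRange m).filter (fun j => j ≠ k)).map
          (fun j => (lam k - lam j)⁻¹ •
            (A - lam j • (1 : Matrix (Fin m) (Fin m) ℝ)))).prod) * V := by
    rw [exp_smul_mul_eq hV hA, Matrix.mul_assoc, Matrix.nonsing_inv_mul _ hdet, Matrix.mul_one,
      Finset.sum_mul]
    simp_rw [Matrix.smul_mul, list_prod_mul_eq hA, key]
    ext a b
    simp [Matrix.sum_apply, Matrix.mul_diagonal, mul_comm]
  have h2 := congrArg (fun M => M * V⁻¹) h1
  simpa only [Matrix.mul_assoc, Matrix.mul_nonsing_inv _ hdet, Matrix.mul_one] using h2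

end Diagonalized

/-! ### Linear systems with a diagonalizable matrix. -/

section LinearODE

variable {m : ℕ} {A V : Matrix (Fin m) (Fin m) ℝ} {lam : Fin m → ℝ}

lemma exp_smul_mulVec (hV : IsUnit V) (hA : A * V = V * Matrix.diagonal lam) (t : ℝ)
    (x : Fin m → ℝ) : (NormedSpace.exp (t • A)).mulVec x =
      V.mulVec fun k => Real.exp (lam k * t) * (V⁻¹.mulVec x) k := by
  rw [exp_smul_mul_eq hV hA, ← Matrix.mulVec_mulVec, ← Matrix.mulVec_mulVec]
  congr 1
  ext k
  rw [Matrix.mulVec_diagonal]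

lemma inv_mulVec_mulVec (hV : IsUnit V) (hA : A * V = V * Matrix.diagonal lam) (x : Fin m → ℝ)
    (k : Fin m) : (V⁻¹.mulVec (A.mulVec x)) k = lam k * (V⁻¹.mulVec x) k := by
  have hdet : IsUnit V.det := (Matrix.isUnit_iff_isUnit_det _).1 hV
  have : V⁻¹ * A = Matrix.diagonal lam * V⁻¹ := by
    calc V⁻¹ * A = V⁻¹ * (A * V) * V⁻¹ := by
          rw [Matrix.mul_assoc, Matrix.mul_assoc, Matrix.mul_nonsing_inv _ hdet, Matrix.mul_one]
      _ = _ := by rw [hA, ← Matrix.mul_assoc, Matrix.nonsing_inv_mul _ hdet, Matrix.one_mul]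
  rw [Matrix.mulVec_mulVec, this, ← Matrix.mulVec_mulVec, Matrix.mulVec_diagonal]

lemma HasDerivWithinAt.matrix_mulVec {f : ℝ → Fin m → ℝ} {f' : Fin m → ℝ} {s : Set ℝ} {t : ℝ}
    (M : Matrix (Fin m) (Fin m) ℝ) (h : HasDerivWithinAt f f' s t) :
    HasDerivWithinAt (fun u => M.mulVec (f u)) (M.mulVec f') s t := by
  rw [hasDerivWithinAt_pi] at h ⊢
  intro i
  simp only [Matrix.mulVec, dotProduct]
  exact HasDerivWithinAt.fun_sum fun j _ => (h j).const_mul (M i j)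

lemma ContinuousOn.matrix_mulVec_const {X : Type*} [TopologicalSpace X] {f : X → Fin m → ℝ}
    {s : Set X} (M : Matrix (Fin m) (Fin m) ℝ) (h : ContinuousOn f s) :
    ContinuousOn (fun u => M.mulVec (f u)) s :=
  (Continuous.matrix_mulVec continuous_const continuous_id).comp_continuousOn h

lemma hasDerivWithinAt_inv_mulVec (hV : IsUnit V) (hA : A * V = V * Matrix.diagonal lam)
    {Y C : ℝ → Fin m → ℝ} {s : Set ℝ} {t : ℝ}
    (hY : HasDerivWithinAt Y (A.mulVec (Y t) + C t) s t) (k : Fin m) :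
    HasDerivWithinAt (fun u => (V⁻¹.mulVec (Y u)) k)
      (lam k * (V⁻¹.mulVec (Y t)) k + (V⁻¹.mulVec (C t)) k) s t := by
  have h := hasDerivWithinAt_pi.1 (HasDerivWithinAt.matrix_mulVec V⁻¹ hY) k
  rwa [Matrix.mulVec_add, Pi.add_apply, inv_mulVec_mulVec hV hA] at h

lemma continuousOn_exp_mulVec (hV : IsUnit V) (hA : A * V = V * Matrix.diagonal lam)
    {C : ℝ → Fin m → ℝ} {s : Set ℝ} (hC : ContinuousOn C s) (t : ℝ) :
    ContinuousOn (fun s => (NormedSpace.exp ((t - s) • A)).mulVec (C s)) s := by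
  simp_rw [exp_smul_mulVec hV hA]
  refine ContinuousOn.matrix_mulVec_const V (continuousOn_pi.2 fun k => ContinuousOn.mul ?_ ?_)
  · fun_prop
  · exact (continuous_apply k).comp_continuousOn (ContinuousOn.matrix_mulVec_const V⁻¹ hC)

/-- The function s ↦ exp((t-s)A) Y(s) has right derivative exp((t-s)A) C(s); integrate from 0 to t.
As the result expresses Y through Y(0) and C, it also gives uniqueness. -/
lemma variation_of_constants (hV : IsUnit V) (hA : A * V = V * Matrix.diagonal lam)
    {Y C : ℝ → Fin m → ℝ} (hC : ContinuousOn C (Set.Ici 0))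
    (hY : ∀ t : ℝ, 0 ≤ t → HasDerivWithinAt Y (A.mulVec (Y t) + C t) (Set.Ici 0) t)
    {t : ℝ} (ht : 0 ≤ t) :
    IntervalIntegrable (fun s => (NormedSpace.exp ((t - s) • A)).mulVec (C s)) volume 0 t ∧
      Y t = (NormedSpace.exp (t • A)).mulVec (Y 0) +
        ∫ s in (0 : ℝ)..t, (NormedSpace.exp ((t - s) • A)).mulVec (C s) := by
  have hsub : Set.Icc 0 t ⊆ Set.Ici (0 : ℝ) := fun x hx => hx.1
  have hint : IntervalIntegrable (fun s => (NormedSpace.exp ((t - s) • A)).mulVec (C s))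
      volume 0 t := by
    refine ContinuousOn.intervalIntegrable ?_
    rw [Set.uIcc_of_le ht]
    exact continuousOn_exp_mulVec hV hA (hC.mono hsub) t
  refine ⟨hint, ?_⟩
  have hYc : ContinuousOn Y (Set.Icc 0 t) := fun s hs =>
    ((hY s hs.1).continuousWithinAt).mono hsub
  have h := intervalIntegral.integral_eq_sub_of_hasDeriv_right_of_le
    (f := fun s => (NormedSpace.exp ((t - s) • A)).mulVec (Y s)) ht
    (continuousOn_exp_mulVec hV hA hYc t) (fun s hs => ?_) hint
  · rw [h]; simp
  · simp_rw [exp_smul_mulVec hV hA]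
    have hs' : Set.Ioi s ⊆ Set.Ici (0 : ℝ) := fun x hx => hs.1.le.trans (le_of_lt hx)
    refine HasDerivWithinAt.matrix_mulVec V (hasDerivWithinAt_pi.2 fun k => ?_)
    have h1 : HasDerivWithinAt (fun s => Real.exp (lam k * (t - s)))
        (Real.exp (lam k * (t - s)) * (lam k * (-1))) (Set.Ioi s) s :=
      (((hasDerivAt_id s).const_sub t).const_mul (lam k)).exp.hasDerivWithinAt
    have h2 := h1.mul ((hasDerivWithinAt_inv_mulVec hV hA (hY s hs.1.le) k).mono hs')
    refine h2.congr_deriv ?_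
    ring

lemma tendsto_of_scalar_ode {l cl : ℝ} (hl : l < 0) {y c : ℝ → ℝ}
    (hc : Tendsto c atTop (𝓝 cl))
    (hy : ∀ t : ℝ, 0 ≤ t → HasDerivWithinAt y (l * y t + c t) (Set.Ici 0) t) :
    Tendsto y atTop (𝓝 (-cl / l)) := by
  have hl0 : l ≠ 0 := hl.ne
  rw [Metric.tendsto_atTop]
  intro ε hε
  -- With tolerance (ε/2)(-l), the error e^{-lt}(c - cl) integrates to at most (ε/2)e^{-lb}, which
  -- the final factor e^{lb} reduces to ε/2.
  obtain ⟨t₁, ht₁⟩ := Metric.tendsto_atTop.1 hc (ε / 2 * (-l)) (by nlinarith)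
  set a := max t₁ 0 with ha
  have ha0 : 0 ≤ a := le_max_right _ _
  set f : ℝ → ℝ := fun t => Real.exp (-l * t) * (y t + cl / l) with hf
  have hderiv : ∀ t, 0 ≤ t → HasDerivWithinAt f (Real.exp (-l * t) * (c t - cl)) (Set.Ici 0) t := by
    intro t ht
    have h1 : HasDerivWithinAt (fun s => Real.exp (-l * s))
        (Real.exp (-l * t) * (-l * 1)) (Set.Ici 0) t :=
      (((hasDerivAt_id t)).const_mul (-l)).exp.hasDerivWithinAt
    refine (h1.mul ((hy t ht).add_const (cl / l))).congr_deriv ?_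
    field_simp
    ring
  have hbound : ∀ b, a ≤ b → |f b| ≤ |f a| + ε / 2 * (Real.exp (-l * b) - Real.exp (-l * a)) := by
    intro b hab
    have := image_norm_le_of_norm_deriv_right_le_deriv_boundary (f := f) (a := a) (b := b)
      (f' := fun t => Real.exp (-l * t) * (c t - cl))
      (B := fun t => |f a| + ε / 2 * (Real.exp (-l * t) - Real.exp (-l * a)))
      (B' := fun t => ε / 2 * (Real.exp (-l * t) * (-l * 1)))
      (fun t ht => ((hderiv t (ha0.trans ht.1)).continuousWithinAt).mono
        fun x hx => ha0.trans hx.1)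
      (fun t ht => (hderiv t (ha0.trans ht.1)).mono fun x hx => (ha0.trans ht.1).trans hx)
      (by simp) (fun t => ((((((hasDerivAt_id t)).const_mul (-l)).exp).sub_const _).const_mul
        (ε / 2)).const_add _) (fun t ht => ?_) ⟨hab, le_rfl⟩
    · simpa using this
    · have h1 := ht₁ t ((le_max_left _ _).trans ht.1)
      rw [Real.dist_eq] at h1
      rw [Real.norm_eq_abs, abs_mul, abs_of_pos (Real.exp_pos _)]
      have := Real.exp_pos (-l * t)
      nlinarith
  have hlim : Tendsto (fun b => |f a| * Real.exp (l * b)) atTop (𝓝 (|f a| * 0)) :=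
    (Real.tendsto_exp_atBot.comp (tendsto_id.const_mul_atTop_of_neg hl)).const_mul _
  rw [mul_zero] at hlim
  obtain ⟨t₂, ht₂⟩ := Metric.tendsto_atTop.1 hlim (ε / 2) (by linarith)
  refine ⟨max a t₂, fun b hb => ?_⟩
  have h1 := hbound b ((le_max_left _ _).trans hb)
  have h2 := ht₂ b ((le_max_right _ _).trans hb)
  rw [Real.dist_eq, sub_zero, abs_of_nonneg (by positivity)] at h2
  have h3 : |f b| = Real.exp (-l * b) * |y b + cl / l| := by
    rw [hf, abs_mul, abs_of_pos (Real.exp_pos _)]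
  have h4 : Real.exp (-l * b) * Real.exp (l * b) = 1 := by
    rw [← Real.exp_add]; simp
  have h5 : |y b + cl / l| = Real.exp (l * b) * |f b| := by
    rw [h3, ← mul_assoc, mul_comm (Real.exp _), h4, one_mul]
  rw [Real.dist_eq, show y b - -cl / l = y b + cl / l by ring, h5]
  have h6 := Real.exp_pos (l * b)
  have h7 := Real.exp_pos (-l * a)
  calc Real.exp (l * b) * |f b|
      ≤ Real.exp (l * b) * (|f a| + ε / 2 * (Real.exp (-l * b) - Real.exp (-l * a))) := by gcongr
    _ = |f a| * Real.exp (l * b) + ε / 2 * (Real.exp (-l * b) * Real.exp (l * b))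
        - ε / 2 * (Real.exp (-l * a) * Real.exp (l * b)) := by ring
    _ < ε := by rw [h4]; have := mul_pos h7 h6; nlinarith

lemma tendsto_of_linear_ode (hV : IsUnit V) (hA : A * V = V * Matrix.diagonal lam)
    (hlam : ∀ k, lam k < 0) {Y C : ℝ → Fin m → ℝ} {cl : Fin m → ℝ}
    (hC : Tendsto C atTop (𝓝 cl))
    (hY : ∀ t : ℝ, 0 ≤ t → HasDerivWithinAt Y (A.mulVec (Y t) + C t) (Set.Ici 0) t) :
    ∃ z, Tendsto Y atTop (𝓝 z) := by
  have hdet : IsUnit V.det := (Matrix.isUnit_iff_isUnit_det _).1 hV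
  have hcont : ∀ M : Matrix (Fin m) (Fin m) ℝ, Continuous fun x : Fin m → ℝ => M.mulVec x :=
    fun M => Continuous.matrix_mulVec continuous_const continuous_id
  have h1 : ∀ k, Tendsto (fun t => (V⁻¹.mulVec (Y t)) k) atTop
      (𝓝 (-(V⁻¹.mulVec cl) k / lam k)) := fun k =>
    tendsto_of_scalar_ode (hlam k)
      (((continuous_apply k).comp (hcont V⁻¹)).continuousAt.tendsto.comp hC)
      fun t ht => hasDerivWithinAt_inv_mulVec hV hA (hY t ht) k
  refine ⟨_, (((hcont V).continuousAt.tendsto.comp (tendsto_pi_nhds.2 h1)).congr fun t => ?_)⟩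
  simp only [Function.comp_apply]
  exact (Matrix.mulVec_mulVec (Y t) V V⁻¹).trans
    (by rw [Matrix.mul_nonsing_inv _ hdet, Matrix.one_mulVec])

end LinearODE

/-! ### Counting functions and the pathwise change of variables. -/

section Counting

/-- The number of events strictly before time `t`. -/
noncomputable def countL (τ : ℕ → ℝ≥0∞) (t : ℝ) : ℕ :=
  {i : ℕ | τ i < ENNReal.ofReal t}.ncard

variable {τ : ℕ → ℝ≥0∞}

lemma ncard_of_forall_iff {s : Set ℕ} {N : ℕ} (h : ∀ k, k ∈ s ↔ k < N) : s.ncard = N := by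
  have : s = ((Finset.range N : Finset ℕ) : Set ℕ) := by ext k; simp [h]
  rw [this, Set.ncard_coe_finset, Finset.card_range]

/-- Monotone event times make the set of past indices an initial segment, so cardinalities become
comparisons with a single event time. -/
lemma exists_forall_mem_iff_lt {s : Set ℕ} (hfin : ∃ M, ∀ k ∈ s, k < M)
    (hlow : ∀ i j, i ≤ j → j ∈ s → i ∈ s) : ∃ N, ∀ k, k ∈ s ↔ k < N := by
  classical
  obtain ⟨M, hM⟩ := hfin
  have hex : ∃ N, N ∉ s := ⟨M, fun h => lt_irrefl _ (hM M h)⟩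
  refine ⟨Nat.find hex, fun k => ⟨fun hk => ?_, fun hk => ?_⟩⟩
  · by_contra hlt
    exact Nat.find_spec hex (hlow _ _ (not_lt.1 hlt) hk)
  · by_contra h
    exact Nat.find_min hex hk h

lemma IsEventSequence.exists_lt (h : IsEventSequence τ) {c : ℝ≥0∞} (hc : c ≠ ∞) :
    ∃ M, ∀ k, τ k ≤ c → k < M := by
  obtain ⟨M, hM⟩ := (h.nonexplosive.eventually (lt_mem_nhds hc.lt_top)).exists
  refine ⟨M, fun k hk => ?_⟩
  by_contra hlt
  exact absurd (hM.trans_le (h.mono (not_lt.1 hlt))) (not_lt.2 hk)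

lemma IsEventSequence.lt_countL_iff (h : IsEventSequence τ) (t : ℝ) (k : ℕ) :
    k < countL τ t ↔ τ k < ENNReal.ofReal t := by
  obtain ⟨M, hM⟩ := h.exists_lt (ENNReal.ofReal_ne_top (r := t))
  obtain ⟨N, hN⟩ := exists_forall_mem_iff_lt (s := {i : ℕ | τ i < ENNReal.ofReal t})
    ⟨M, fun k hk => hM k (le_of_lt hk)⟩ fun i j hij hj => (h.mono hij).trans_lt hj
  rw [countL, ncard_of_forall_iff hN, ← hN]; rfl

lemma IsEventSequence.lt_count_iff (h : IsEventSequence τ) (t : ℝ) (k : ℕ) :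
    k < count τ t ↔ τ k ≤ ENNReal.ofReal t := by
  obtain ⟨M, hM⟩ := h.exists_lt (ENNReal.ofReal_ne_top (r := t))
  obtain ⟨N, hN⟩ := exists_forall_mem_iff_lt (s := {i : ℕ | τ i ≤ ENNReal.ofReal t})
    ⟨M, fun k hk => hM k hk⟩ fun i j hij hj => (h.mono hij).trans hj
  rw [count, ncard_of_forall_iff hN, ← hN]; rfl

lemma IsEventSequence.countL_mono (h : IsEventSequence τ) : Monotone (countL τ) := by
  intro s t hst
  by_contra hlt
  have h1 := (h.lt_countL_iff s _).1 (not_le.1 hlt)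
  exact lt_irrefl _ ((h.lt_countL_iff t _).2 (h1.trans_le (ENNReal.ofReal_le_ofReal hst)))

lemma IsEventSequence.countL_eq_iff (h : IsEventSequence τ) (t : ℝ) (N : ℕ) :
    countL τ t = N ↔ (∀ k < N, τ k < ENNReal.ofReal t) ∧ ENNReal.ofReal t ≤ τ N := by
  constructor
  · rintro rfl
    exact ⟨fun k hk => (h.lt_countL_iff t k).1 hk,
      not_lt.1 fun hlt => lt_irrefl _ ((h.lt_countL_iff t _).2 hlt)⟩
  · rintro ⟨h1, h2⟩
    refine le_antisymm (not_lt.1 fun hlt => ?_) (not_lt.1 fun hlt => ?_)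
    · exact absurd ((h.lt_countL_iff t N).1 hlt) (not_lt.2 h2)
    · exact lt_irrefl _ ((h.lt_countL_iff t _).2 (h1 _ hlt))

lemma IsEventSequence.count_eq_iff (h : IsEventSequence τ) (t : ℝ) (N : ℕ) :
    count τ t = N ↔ (∀ k < N, τ k ≤ ENNReal.ofReal t) ∧ ENNReal.ofReal t < τ N := by
  constructor
  · rintro rfl
    exact ⟨fun k hk => (h.lt_count_iff t k).1 hk,
      not_le.1 fun hlt => lt_irrefl _ ((h.lt_count_iff t _).2 hlt)⟩
  · rintro ⟨h1, h2⟩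
    refine le_antisymm (not_lt.1 fun hlt => ?_) (not_lt.1 fun hlt => ?_)
    · exact absurd ((h.lt_count_iff t N).1 hlt) (not_le.2 h2)
    · exact lt_irrefl _ ((h.lt_count_iff t _).2 (h1 _ hlt))

lemma IsEventSequence.countL_of_nonpos (h : IsEventSequence τ) {t : ℝ} (ht : t ≤ 0) :
    countL τ t = 0 := by
  rw [h.countL_eq_iff]
  simp [ENNReal.ofReal_of_nonpos ht]

lemma IsEventSequence.count_of_nonpos (h : IsEventSequence τ) {t : ℝ} (ht : t ≤ 0) :
    count τ t = 0 := by
  rw [h.count_eq_iff]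
  simp [ENNReal.ofReal_of_nonpos ht, h.pos]

lemma IsEventSequence.lt_of_lt (h : IsEventSequence τ) {i j : ℕ} (hij : i < j) (hi : τ i ≠ ∞) :
    τ i < τ j :=
  (h.lt_succ i hi).trans_le (h.mono hij)

/-- At the `i`-th event time, `i` events have taken place before. -/
lemma IsEventSequence.countL_at (h : IsEventSequence τ) {t : ℝ} {i : ℕ}
    (hi : τ i = ENNReal.ofReal t) : countL τ t = i := by
  rw [h.countL_eq_iff, ← hi]
  exact ⟨fun k hk => (h.lt_of_lt hk (((h.mono hk.le).trans_lt (hi ▸ ENNReal.ofReal_lt_top)).ne)),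
    le_rfl⟩

lemma IsEventSequence.count_at (h : IsEventSequence τ) {t : ℝ} {i : ℕ}
    (hi : τ i = ENNReal.ofReal t) : count τ t = i + 1 := by
  rw [h.count_eq_iff, ← hi]
  exact ⟨fun k hk => h.mono (Nat.lt_succ_iff.1 hk), h.lt_succ i (hi ▸ ENNReal.ofReal_ne_top)⟩

lemma IsEventSequence.count_eq_countL (h : IsEventSequence τ) {t : ℝ}
    (ht : ∀ i, τ i ≠ ENNReal.ofReal t) : count τ t = countL τ t := by
  rw [h.count_eq_iff]
  obtain ⟨h1, h2⟩ := (h.countL_eq_iff t _).1 rfl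
  exact ⟨fun k hk => (h1 k hk).le, lt_of_le_of_ne h2 (ht _).symm⟩

lemma IsEventSequence.eventually_left (h : IsEventSequence τ) (t : ℝ) :
    ∀ᶠ v in 𝓝[<] t, countL τ v = countL τ t ∧ count τ v = countL τ t := by
  obtain ⟨h1, h2⟩ := (h.countL_eq_iff t _).1 rfl
  have hev : ∀ᶠ v in 𝓝[<] t, ∀ k < countL τ t, τ k < ENNReal.ofReal v := by
    refine mem_nhdsWithin_of_mem_nhds ?_
    have : ∀ k ∈ Finset.range (countL τ t), ∀ᶠ v in 𝓝 t, τ k < ENNReal.ofReal v := fun k hk =>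
      (ENNReal.continuous_ofReal.tendsto t).eventually (lt_mem_nhds (h1 k (Finset.mem_range.1 hk)))
    filter_upwards [(Finset.eventually_all _).2 this] with v hv k hk
    exact hv k (Finset.mem_range.2 hk)
  filter_upwards [hev, self_mem_nhdsWithin] with v hv hlt
  rcases le_or_gt t 0 with h0 | h0
  · have hv0 : v ≤ 0 := (le_of_lt hlt).trans h0
    rw [h.countL_of_nonpos h0, h.countL_of_nonpos hv0, h.count_of_nonpos hv0]
    exact ⟨rfl, rfl⟩
  · have hlt' : ENNReal.ofReal v < ENNReal.ofReal t := (ENNReal.ofReal_lt_ofReal_iff h0).2 hlt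
    exact ⟨(h.countL_eq_iff _ _).2 ⟨hv, hlt'.le.trans h2⟩,
      (h.count_eq_iff _ _).2 ⟨fun k hk => (hv k hk).le, hlt'.trans_le h2⟩⟩

lemma IsEventSequence.eventually_right (h : IsEventSequence τ) {t : ℝ} (ht : 0 ≤ t) :
    ∀ᶠ v in 𝓝[>] t, countL τ v = count τ t := by
  obtain ⟨h1, h2⟩ := (h.count_eq_iff t _).1 rfl
  have hev : ∀ᶠ v in 𝓝[>] t, ENNReal.ofReal v < τ (count τ t) :=
    mem_nhdsWithin_of_mem_nhds ((ENNReal.continuous_ofReal.tendsto t).eventually (gt_mem_nhds h2))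
  filter_upwards [hev, self_mem_nhdsWithin] with v hv hlt
  have hlt' : ENNReal.ofReal t < ENNReal.ofReal v :=
    (ENNReal.ofReal_lt_ofReal_iff (ht.trans_lt hlt)).2 hlt
  exact (h.countL_eq_iff _ _).2 ⟨fun k hk => (h1 k hk).trans_lt hlt', hv.le⟩

lemma IsEventSequence.ofReal_toReal (h : IsEventSequence τ) {i : ℕ} {t : ℝ}
    (hi : i < countL τ t) : τ i = ENNReal.ofReal (τ i).toReal :=
  (ENNReal.ofReal_toReal ((((h.lt_countL_iff t i).1 hi).trans ENNReal.ofReal_lt_top).ne)).symm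

lemma IsEventSequence.sum_eq_tsum {M : Type*} [AddCommMonoid M] [TopologicalSpace M] [T2Space M]
    (h : IsEventSequence τ) (t : ℝ) (f : ℕ → M) :
    ∑' i, (if τ i < ENNReal.ofReal t then f i else 0) = ∑ i ∈ Finset.range (countL τ t), f i := by
  rw [tsum_eq_sum (s := Finset.range (countL τ t)) fun i hi => ?_]
  · refine Finset.sum_congr rfl fun i hi => ?_
    rw [if_pos ((h.lt_countL_iff t i).1 (Finset.mem_range.1 hi))]
  · rw [if_neg fun h' => hi (Finset.mem_range.2 ((h.lt_countL_iff t i).2 h'))]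

/-- The pathwise change of variables formula for a function of time and of two counting processes
without common events. -/
lemma path_change_of_variables {τ σ : ℕ → ℝ≥0∞} (hτ : IsEventSequence τ) (hσ : IsEventSequence σ)
    (hne : ∀ i j, τ i = σ j → τ i = ∞) (G G' : ℝ → ℕ → ℕ → ℝ)
    (hG : ∀ a b u, HasDerivAt (fun u => G u a b) (G' u a b) u) {t : ℝ} (ht : 0 ≤ t)
    (hint : IntervalIntegrable (fun u => G' u (countL τ u) (countL σ u)) volume 0 t) :
    G t (countL τ t) (countL σ t) = G 0 0 0
      + (∫ u in (0 : ℝ)..t, G' u (countL τ u) (countL σ u))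
      + ∑ i ∈ Finset.range (countL τ t),
          (G (τ i).toReal (i + 1) (countL σ (τ i).toReal)
            - G (τ i).toReal i (countL σ (τ i).toReal))
      + ∑ i ∈ Finset.range (countL σ t),
          (G (σ i).toReal (countL τ (σ i).toReal) (i + 1)
            - G (σ i).toReal (countL τ (σ i).toReal) i) := by
  set jτ : ℕ → ℝ := fun i => G (τ i).toReal (i + 1) (countL σ (τ i).toReal)
            - G (τ i).toReal i (countL σ (τ i).toReal) with hjτ
  set jσ : ℕ → ℝ := fun i => G (σ i).toReal (countL τ (σ i).toReal) (i + 1)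
            - G (σ i).toReal (countL τ (σ i).toReal) i with hjσ
  -- Subtracting the accumulated jumps leaves a continuous path that is differentiable off the
  -- countable set of event times.
  set H : ℝ → ℕ → ℕ → ℝ := fun u a b =>
    G u a b - ∑ i ∈ Finset.range a, jτ i - ∑ i ∈ Finset.range b, jσ i with hH
  have hHd : ∀ a b u, HasDerivAt (fun u => H u a b) (G' u a b) u := fun a b u =>
    ((hG a b u).sub_const _).sub_const _
  -- Without common events at most one counter moves at time `u`, and the matching summand cancels
  -- its jump.
  have hjump : ∀ u, 0 ≤ u → H u (count τ u) (count σ u) = H u (countL τ u) (countL σ u) := by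
    intro u hu
    by_cases h1 : ∃ i, τ i = ENNReal.ofReal u
    · obtain ⟨i, hi⟩ := h1
      have h2 : ∀ j, σ j ≠ ENNReal.ofReal u := fun j hj =>
        ENNReal.ofReal_ne_top (hi.symm.trans (hne i j (hi.trans hj.symm)))
      rw [hτ.count_at hi, hτ.countL_at hi, hσ.count_eq_countL h2]
      have hui : (τ i).toReal = u := by rw [hi, ENNReal.toReal_ofReal hu]
      simp only [hH, Finset.sum_range_succ, hjτ, hui]
      ring
    · push Not at h1
      rw [hτ.count_eq_countL h1]
      by_cases h2 : ∃ i, σ i = ENNReal.ofReal u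
      · obtain ⟨i, hi⟩ := h2
        rw [hσ.count_at hi, hσ.countL_at hi]
        have hui : (σ i).toReal = u := by rw [hi, ENNReal.toReal_ofReal hu]
        simp only [hH, Finset.sum_range_succ, hjσ, hui]
        ring
      · push Not at h2
        rw [hσ.count_eq_countL h2]
  set k : ℝ → ℝ := fun u => H u (countL τ u) (countL σ u) with hk
  have hcont : ContinuousOn k (Set.Icc 0 t) := by
    intro u hu
    refine ContinuousAt.continuousWithinAt ?_
    rw [continuousAt_iff_continuous_left'_right']
    constructor
    · refine ((hHd (countL τ u) (countL σ u) u).continuousAt.continuousWithinAt).congr_of_eventuallyEq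
        ?_ rfl
      filter_upwards [hτ.eventually_left u, hσ.eventually_left u] with v hv1 hv2
      rw [hk]; simp only [hv1.1, hv2.1]
    · refine ((hHd (count τ u) (count σ u) u).continuousAt.continuousWithinAt).congr_of_eventuallyEq
        ?_ (hjump u hu.1).symm
      filter_upwards [hτ.eventually_right hu.1, hσ.eventually_right hu.1] with v hv1 hv2
      rw [hk]; simp only [hv1, hv2]
  set E : Set ℝ := Set.range (fun i => (τ i).toReal) ∪ Set.range (fun i => (σ i).toReal) with hE
  have hEc : E.Countable := (Set.countable_range _).union (Set.countable_range _)
  have hder : ∀ u ∈ Set.Ioo 0 t \ E, HasDerivAt k (G' u (countL τ u) (countL σ u)) u := by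
    rintro u ⟨hu, huE⟩
    have h1 : ∀ i, τ i ≠ ENNReal.ofReal u := fun i hi =>
      huE (Or.inl ⟨i, by simp [hi, ENNReal.toReal_ofReal hu.1.le]⟩)
    have h2 : ∀ i, σ i ≠ ENNReal.ofReal u := fun i hi =>
      huE (Or.inr ⟨i, by simp [hi, ENNReal.toReal_ofReal hu.1.le]⟩)
    refine (hHd (countL τ u) (countL σ u) u).congr_of_eventuallyEq ?_
    have h3 : ∀ᶠ v in 𝓝[≠] u, k v = H v (countL τ u) (countL σ u) := by
      rw [← Set.Iio_union_Ioi, nhdsWithin_union, eventually_sup]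
      constructor
      · filter_upwards [hτ.eventually_left u, hσ.eventually_left u] with v hv1 hv2
        rw [hk]; simp only [hv1.1, hv2.1]
      · filter_upwards [hτ.eventually_right hu.1.le, hσ.eventually_right hu.1.le] with v hv1 hv2
        rw [hk]; simp only [hv1, hv2, hτ.count_eq_countL h1, hσ.count_eq_countL h2]
    rw [eventually_nhdsWithin_iff] at h3
    filter_upwards [h3] with v hv
    by_cases hvu : v = u
    · rw [hvu]
    · exact hv hvu
  have hfin := integral_eq_of_hasDerivAt_off_countable_of_le k _ ht hEc hcont hder hint
  rw [hfin]
  simp only [hk, hH, hτ.countL_of_nonpos le_rfl, hσ.countL_of_nonpos le_rfl, Finset.range_zero,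
    Finset.sum_empty]
  ring

end Counting

/-! ### Path expansion of falling factorials times powers of the intensity. -/

section Path

/-- Up to time `t` the counters take finitely many values, each on a measurable set of times, so the
integrand is a finite sum of continuous functions times indicators. -/
lemma intervalIntegrable_path {τ σ : ℕ → ℝ≥0∞} (hτ : IsEventSequence τ) (hσ : IsEventSequence σ)
    (F : ℝ → ℕ → ℕ → ℝ) (hF : ∀ a b, Continuous fun u => F u a b) {t : ℝ} (ht : 0 ≤ t) :
    IntervalIntegrable (fun u => F u (countL τ u) (countL σ u)) volume 0 t := by
  rw [intervalIntegrable_iff_integrableOn_Ioc_of_le ht]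
  have h1 : IntegrableOn (fun u => ∑ a ∈ Finset.range (countL τ t + 1),
      ∑ b ∈ Finset.range (countL σ t + 1),
        Set.indicator (countL τ ⁻¹' {a} ∩ countL σ ⁻¹' {b}) (fun u => F u a b) u)
      (Set.Ioc 0 t) := by
    refine integrable_finsetSum _ fun a _ => integrable_finsetSum _ fun b _ => ?_
    refine Integrable.indicator ?_ ((hτ.countL_mono.measurable (measurableSet_singleton a)).inter
      (hσ.countL_mono.measurable (measurableSet_singleton b)))
    exact ((hF a b).integrableOn_Icc).mono_set Set.Ioc_subset_Icc_self
  refine h1.congr_fun (fun u hu => ?_) measurableSet_Ioc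
  have ha := Finset.mem_range.2 (Nat.lt_succ_iff.2 (hτ.countL_mono hu.2))
  have hb := Finset.mem_range.2 (Nat.lt_succ_iff.2 (hσ.countL_mono hu.2))
  simp only
  rw [Finset.sum_eq_single_of_mem _ ha, Finset.sum_eq_single_of_mem _ hb]
  · simp
  · intro b _ hne
    exact Set.indicator_of_notMem (fun h => hne h.2.symm) _
  · intro a _ hne
    exact Finset.sum_eq_zero fun b _ => Set.indicator_of_notMem (fun h => hne h.1.symm) _

lemma cast_descFactorial_succ_left (p a : ℕ) :
    ((p + 1).descFactorial a : ℝ) = p.descFactorial a + a * p.descFactorial (a - 1) := by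
  rcases a with _ | a
  · simp
  · rw [Nat.succ_descFactorial_succ, Nat.descFactorial_succ, Nat.add_sub_cancel]
    rcases le_or_gt a p with h | h
    · rw [Nat.cast_mul, Nat.cast_mul, Nat.cast_sub h]; push_cast; ring
    · rw [Nat.descFactorial_eq_zero_iff_lt.2 h]; simp

/-- This absorbs the departure rate: the factor Q times a falling factorial of the queue after the
departure is a falling factorial of the queue before it. -/
lemma mul_descFactorial_pred (p a : ℕ) :
    p * (p - 1).descFactorial a = p.descFactorial (a + 1) := by
  rcases p with _ | p
  · simp
  · rw [Nat.succ_descFactorial_succ, Nat.add_sub_cancel]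

variable {Ω : Type*} {lam0 r : ℝ} {T S : ℕ → Ω → ℝ≥0∞} {B : ℕ → Ω → ℝ} {ω : Ω}

/-- The number of customers present just before time `t`. -/
noncomputable def queueL (T S : ℕ → Ω → ℝ≥0∞) (t : ℝ) (ω : Ω) : ℕ :=
  countL (fun i => T i ω) t - countL (fun i => S i ω) t

/-- The random variable `Q(Q-1)⋯(Q-q+1) Λ^g` just before time `t`. -/
noncomputable def momentVarL (lam0 r : ℝ) (T S : ℕ → Ω → ℝ≥0∞) (B : ℕ → Ω → ℝ)
    (q g : ℕ) (t : ℝ) (ω : Ω) : ℝ :=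
  ((queueL T S t ω).descFactorial q : ℝ) * intensity lam0 r S B t ω ^ g

lemma intensity_eq_sum (hS : IsEventSequence fun i => S i ω) (t : ℝ) :
    intensity lam0 r S B t ω = lam0 + ∑ i ∈ Finset.range (countL (fun i => S i ω) t),
      B i ω * Real.exp (-r * (t - (S i ω).toReal)) := by
  rw [intensity, ← hS.sum_eq_tsum]

/-- With e^{-rt} factored out, the path depends on events only through the departure count, as the
change of variables formula requires. -/
lemma intensity_eq_exp_mul (hS : IsEventSequence fun i => S i ω) (t : ℝ) :
    intensity lam0 r S B t ω = lam0 + Real.exp (-r * t) *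
      ∑ i ∈ Finset.range (countL (fun i => S i ω) t), B i ω * Real.exp (r * (S i ω).toReal) := by
  rw [intensity_eq_sum hS, Finset.mul_sum]
  congr 1
  refine Finset.sum_congr rfl fun i _ => ?_
  rw [mul_left_comm, ← Real.exp_add]
  congr 2
  ring

lemma intensity_ge (hS : IsEventSequence fun i => S i ω) (hB : ∀ i, S i ω ≠ ∞ → 0 < B i ω)
    (t : ℝ) : lam0 ≤ intensity lam0 r S B t ω := by
  rw [intensity_eq_sum hS, le_add_iff_nonneg_right]
  refine Finset.sum_nonneg fun i hi => mul_nonneg (hB i ?_).le (Real.exp_pos _).le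
  exact (((hS.lt_countL_iff t i).1 (Finset.mem_range.1 hi)).trans ENNReal.ofReal_lt_top).ne

lemma intensity_le (hr : 0 < r) (hS : IsEventSequence fun i => S i ω)
    (hB : ∀ i, S i ω ≠ ∞ → 0 < B i ω) (t : ℝ) :
    intensity lam0 r S B t ω ≤ lam0 + ∑ i ∈ Finset.range (countL (fun i => S i ω) t), B i ω := by
  rw [intensity_eq_sum hS, add_le_add_iff_left]
  refine Finset.sum_le_sum fun i hi => ?_
  have h1 := (hS.lt_countL_iff t i).1 (Finset.mem_range.1 hi)
  have h2 : (S i ω).toReal ≤ t := by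
    have h3 : 0 < ENNReal.ofReal t := (zero_le).trans_lt h1
    exact ENNReal.toReal_le_of_le_ofReal (ENNReal.ofReal_pos.1 h3).le h1.le
  refine mul_le_of_le_one_right (hB i (h1.trans ENNReal.ofReal_lt_top).ne).le ?_
  rw [Real.exp_le_one_iff]
  nlinarith

/-- The change of variables formula for `Q(Q-1)⋯(Q-a+1) Λ^g`, all of whose terms are
nonnegative. -/
lemma momentVarL_path (hT : IsEventSequence fun i => T i ω) (hS : IsEventSequence fun i => S i ω)
    (hle : ∀ t, count (fun i => S i ω) t ≤ count (fun i => T i ω) t)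
    (hne : ∀ i j, T i ω = S j ω → T i ω = ∞) (a g : ℕ) {t : ℝ} (ht : 0 ≤ t) :
    IntervalIntegrable (fun u => r * g * (((queueL T S u ω).descFactorial a : ℝ) *
        intensity lam0 r S B u ω ^ (g - 1) * (intensity lam0 r S B u ω - lam0))) volume 0 t ∧
    momentVarL lam0 r T S B a g t ω
      + (∫ u in (0 : ℝ)..t, r * g * (((queueL T S u ω).descFactorial a : ℝ) *
        intensity lam0 r S B u ω ^ (g - 1) * (intensity lam0 r S B u ω - lam0)))
      + ∑ i ∈ Finset.range (countL (fun i => S i ω) t),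
          a * (((queueL T S (S i ω).toReal ω - 1).descFactorial (a - 1) : ℝ) *
            intensity lam0 r S B (S i ω).toReal ω ^ g)
    = ((0 : ℕ).descFactorial a : ℝ) * lam0 ^ g
      + ∑ i ∈ Finset.range (countL (fun i => T i ω) t),
          a * momentVarL lam0 r T S B (a - 1) g (T i ω).toReal ω
      + ∑ i ∈ Finset.range (countL (fun i => S i ω) t),
          ((queueL T S (S i ω).toReal ω - 1).descFactorial a : ℝ) *
            ((intensity lam0 r S B (S i ω).toReal ω + B i ω) ^ g
              - intensity lam0 r S B (S i ω).toReal ω ^ g) := by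
  set M : ℕ → ℝ := fun d => ∑ i ∈ Finset.range d, B i ω * Real.exp (r * (S i ω).toReal) with hM
  set L : ℝ → ℕ → ℝ := fun u d => lam0 + Real.exp (-r * u) * M d with hL
  have hLam : ∀ u, intensity lam0 r S B u ω = L u (countL (fun i => S i ω) u) := fun u =>
    intensity_eq_exp_mul hS u
  set G : ℝ → ℕ → ℕ → ℝ := fun u n d => ((n - d).descFactorial a : ℝ) * L u d ^ g with hG
  set G' : ℝ → ℕ → ℕ → ℝ := fun u n d =>
    r * g * (((n - d).descFactorial a : ℝ) * L u d ^ (g - 1) * (L u d - lam0)) with hG'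
  have hderiv : ∀ n d u, HasDerivAt (fun u => G u n d) (-G' u n d) u := by
    intro n d u
    have h1 : HasDerivAt (fun u => L u d) (Real.exp (-r * u) * (-r * 1) * M d) u :=
      (((hasDerivAt_id u).const_mul (-r)).exp.mul_const (M d)).const_add lam0
    refine ((h1.pow g).const_mul ((n - d).descFactorial a : ℝ)).congr_deriv ?_
    simp only [hG', hL]
    ring
  have hcont : ∀ n d, Continuous fun u => G' u n d := by
    intro n d
    simp only [hG', hL]
    fun_prop
  have hint := intervalIntegrable_path hT hS G' hcont ht
  have hpath := path_change_of_variables hT hS hne G (fun u n d => -G' u n d) hderiv ht hint.neg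
  simp only [queueL, momentVarL, hLam]
  refine ⟨hint, ?_⟩
  have hjT : ∀ i ∈ Finset.range (countL (fun i => T i ω) t),
      G (T i ω).toReal (i + 1) (countL (fun i => S i ω) (T i ω).toReal)
        - G (T i ω).toReal i (countL (fun i => S i ω) (T i ω).toReal)
      = a * (((countL (fun i => T i ω) (T i ω).toReal
          - countL (fun i => S i ω) (T i ω).toReal).descFactorial (a - 1) : ℝ) *
            L (T i ω).toReal (countL (fun i => S i ω) (T i ω).toReal) ^ g) := by
    intro i hi
    have hTi : (fun i => T i ω) i = ENNReal.ofReal (T i ω).toReal :=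
      hT.ofReal_toReal (Finset.mem_range.1 hi)
    set u := (T i ω).toReal
    have hS' : ∀ j, (fun i => S i ω) j ≠ ENNReal.ofReal u := fun j hj =>
      ENNReal.ofReal_ne_top (hTi.symm.trans (hne i j (hTi.trans hj.symm)))
    obtain ⟨h1, h2⟩ := (hT.countL_eq_iff u i).1 (hT.countL_at hTi)
    -- The natural-number difference must not truncate here; the bound comes from the queue
    -- constraint just before `u`, where both counts already equal their left limits.
    have hDi : countL (fun i => S i ω) u ≤ i := by
      have hev := (hS.eventually_left u).and (hT.eventually_left u)
      obtain ⟨v, ⟨hv1, hv2⟩⟩ := hev.exists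
      rw [← hv1.2]
      calc _ ≤ _ := hle v
        _ = i := hv2.2.trans (hT.countL_at hTi)
    rw [hT.countL_at hTi]
    simp only [hG]
    rw [Nat.succ_sub hDi, cast_descFactorial_succ_left]
    ring
  -- With p customers left after the departure, (p)_a(Λ+B)^g - (p+1)_aΛ^g splits into a gain from
  -- the mark and a loss a(p)_{a-1}Λ^g.
  have hjS : ∀ i ∈ Finset.range (countL (fun i => S i ω) t),
      G (S i ω).toReal (countL (fun i => T i ω) (S i ω).toReal) (i + 1)
        - G (S i ω).toReal (countL (fun i => T i ω) (S i ω).toReal) i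
      = ((countL (fun i => T i ω) (S i ω).toReal
          - countL (fun i => S i ω) (S i ω).toReal - 1).descFactorial a : ℝ) *
            ((L (S i ω).toReal (countL (fun i => S i ω) (S i ω).toReal) + B i ω) ^ g
              - L (S i ω).toReal (countL (fun i => S i ω) (S i ω).toReal) ^ g)
        - a * (((countL (fun i => T i ω) (S i ω).toReal
          - countL (fun i => S i ω) (S i ω).toReal - 1).descFactorial (a - 1) : ℝ) *
            L (S i ω).toReal (countL (fun i => S i ω) (S i ω).toReal) ^ g) := by
    intro i hi
    have hSi : (fun i => S i ω) i = ENNReal.ofReal (S i ω).toReal :=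
      hS.ofReal_toReal (Finset.mem_range.1 hi)
    set u := (S i ω).toReal with hu
    have hT' : ∀ j, (fun i => T i ω) j ≠ ENNReal.ofReal u := fun j hj =>
      ENNReal.ofReal_ne_top (hj.symm.trans (hne j i (hj.trans hSi.symm)))
    have hD : i + 1 ≤ countL (fun i => T i ω) u := by
      rw [← hT.count_eq_countL hT', ← hS.count_at hSi]
      exact hle u
    rw [hS.countL_at hSi]
    obtain ⟨p, hp⟩ := Nat.exists_eq_add_of_le hD
    have hLs : L u (i + 1) = L u i + B i ω := by
      simp only [hL, hM, Finset.sum_range_succ, ← hu]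
      have : Real.exp (-r * u) * Real.exp (r * u) = 1 := by rw [← Real.exp_add]; simp
      linear_combination (B i ω) * this
    simp only [hG, hLs, hp]
    rw [show i + 1 + p - (i + 1) = p by omega, show i + 1 + p - i = p + 1 by omega,
      Nat.add_sub_cancel, cast_descFactorial_succ_left]
    ring
  rw [Finset.sum_congr rfl hjT, Finset.sum_congr rfl hjS, Finset.sum_sub_distrib,
    intervalIntegral.integral_neg] at hpath
  have h0 : G 0 0 0 = ((0 : ℕ).descFactorial a : ℝ) * lam0 ^ g := by simp [hG, hL, hM]
  rw [h0] at hpath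
  have hGt : G t (countL (fun i => T i ω) t) (countL (fun i => S i ω) t)
      = ((countL (fun i => T i ω) t - countL (fun i => S i ω) t).descFactorial a : ℝ)
        * L t (countL (fun i => S i ω) t) ^ g := rfl
  rw [hGt] at hpath
  rw [hpath]
  ring

end Path

/-! ### Measurability of left limits, and the cutoff. -/

section Measurability

lemma measurable_nat_of_lt {X : Type*} [MeasurableSpace X] {f : X → ℕ}
    (h : ∀ k, MeasurableSet {x | k < f x}) : Measurable f :=
  measurable_of_Ioi h

variable {X Ω : Type*} [MeasurableSpace X] {time : X → ℝ≥0} {sc : X → Ω}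
  {lam0 r : ℝ} {T S : ℕ → Ω → ℝ≥0∞} {B : ℕ → Ω → ℝ}

lemma measurable_countL_comp (hT : ∀ ω, IsEventSequence fun i => T i ω)
    (h : ∀ i, MeasurableSet {x | T i (sc x) < time x}) :
    Measurable fun x => countL (fun i => T i (sc x)) (time x) := by
  refine measurable_nat_of_lt fun k => ?_
  simpa only [(hT _).lt_countL_iff, ENNReal.ofReal_coe_nnreal] using h k

lemma tendsto_sum_of_eventSequence {τ : ℕ → ℝ≥0∞} (h : IsEventSequence τ) (t : ℝ) (f : ℕ → ℝ) :
    Tendsto (fun n => ∑ i ∈ Finset.range n, if τ i < ENNReal.ofReal t then f i else 0) atTop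
      (𝓝 (∑ i ∈ Finset.range (countL τ t), f i)) := by
  refine tendsto_const_nhds.congr' ?_
  filter_upwards [eventually_ge_atTop (countL τ t)] with n hn
  rw [← Finset.sum_subset (Finset.range_mono hn)]
  · exact Finset.sum_congr rfl fun i hi => by
      rw [if_pos ((h.lt_countL_iff t i).1 (Finset.mem_range.1 hi))]
  · intro i _ hi
    rw [if_neg fun h' => hi (Finset.mem_range.2 ((h.lt_countL_iff t i).2 h'))]

/-- Only marks of past departures are known to be measurable, so each mark is masked by the event
that its departure has already occurred. -/
lemma measurable_mark_comp
    (h : ∀ i (c : ℝ≥0∞) (G : Set ℝ), MeasurableSet G →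
      MeasurableSet {x | S i (sc x) < time x ∧ S i (sc x) ≤ c ∧ B i (sc x) ∈ G}) (i : ℕ) :
    Measurable fun x => if S i (sc x) < ENNReal.ofReal (time x) then B i (sc x) else 0 := by
  intro G hG
  have h1 := h i ∞ G hG
  have h2 := (h i ∞ Set.univ MeasurableSet.univ).compl
  simp only [ENNReal.ofReal_coe_nnreal, le_top, Set.mem_univ, and_true] at h1 h2 ⊢
  by_cases h0 : (0 : ℝ) ∈ G
  · convert h1.union h2 using 1
    ext x
    by_cases hx : S i (sc x) < time x <;> simp [hx, h0]
  · convert h1 using 1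
    ext x
    by_cases hx : S i (sc x) < time x <;> simp [hx, h0]

lemma measurable_event_comp
    (h : ∀ i (c : ℝ≥0∞) (G : Set ℝ), MeasurableSet G →
      MeasurableSet {x | S i (sc x) < time x ∧ S i (sc x) ≤ c ∧ B i (sc x) ∈ G}) (i : ℕ) :
    Measurable fun x => if S i (sc x) < ENNReal.ofReal (time x) then S i (sc x) else 0 := by
  refine measurable_of_Iic fun c => ?_
  have h1 := h i c Set.univ MeasurableSet.univ
  have h2 := (h i ∞ Set.univ MeasurableSet.univ).compl
  simp only [ENNReal.ofReal_coe_nnreal, le_top, Set.mem_univ, and_true] at h1 h2 ⊢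
  convert h1.union h2 using 1
  ext x
  by_cases hx : S i (sc x) < time x <;> simp [hx]

lemma measurable_intensity_comp (hS : ∀ ω, IsEventSequence fun i => S i ω)
    (htime : Measurable time)
    (h : ∀ i (c : ℝ≥0∞) (G : Set ℝ), MeasurableSet G →
      MeasurableSet {x | S i (sc x) < time x ∧ S i (sc x) ≤ c ∧ B i (sc x) ∈ G}) :
    Measurable fun x => intensity lam0 r S B (time x) (sc x) := by
  simp_rw [intensity_eq_sum (hS _)]
  refine Measurable.const_add (measurable_of_tendsto_metrizable (f := fun n x =>
    ∑ i ∈ Finset.range n, if S i (sc x) < ENNReal.ofReal (time x) then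
      B i (sc x) * Real.exp (-r * (time x - (S i (sc x)).toReal)) else 0) (fun n => ?_)
    (tendsto_pi_nhds.2 fun x => tendsto_sum_of_eventSequence (hS (sc x)) _ _)) _
  refine Finset.measurable_sum _ fun i _ => ?_
  have h1 := measurable_mark_comp h i
  have h2 := (measurable_event_comp h i).ennreal_toReal
  have h3 : Measurable fun x => Real.exp (-r * ((time x : ℝ) -
      (if S i (sc x) < ENNReal.ofReal (time x) then S i (sc x) else 0).toReal)) := by
    fun_prop
  convert h1.mul h3 using 1
  ext x
  simp only [Pi.mul_apply]
  split_ifs <;> simp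

/-- The number of arrivals plus the sum of the marks strictly before time `t`. -/
noncomputable def totalL (T S : ℕ → Ω → ℝ≥0∞) (B : ℕ → Ω → ℝ) (t : ℝ) (ω : Ω) : ℝ :=
  countL (fun i => T i ω) t + ∑ i ∈ Finset.range (countL (fun i => S i ω) t), B i ω

lemma measurable_totalL_comp (hT : ∀ ω, IsEventSequence fun i => T i ω)
    (hS : ∀ ω, IsEventSequence fun i => S i ω)
    (hT' : ∀ i, MeasurableSet {x | T i (sc x) < time x})
    (h : ∀ i (c : ℝ≥0∞) (G : Set ℝ), MeasurableSet G →
      MeasurableSet {x | S i (sc x) < time x ∧ S i (sc x) ≤ c ∧ B i (sc x) ∈ G}) :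
    Measurable fun x => totalL T S B (time x) (sc x) := by
  unfold totalL
  refine Measurable.add ?_ (measurable_of_tendsto_metrizable (f := fun n x =>
    ∑ i ∈ Finset.range n, if S i (sc x) < ENNReal.ofReal (time x) then B i (sc x) else 0)
    (fun n => Finset.measurable_sum _ fun i _ => measurable_mark_comp h i)
    (tendsto_pi_nhds.2 fun x => tendsto_sum_of_eventSequence (hS (sc x)) _ _))
  exact (measurable_of_countable _).comp (measurable_countL_comp hT hT')

/-- Monotonicity makes the cutoff decreasing in time: if it equals 1 at t, it equals 1 at every
earlier event. -/
lemma totalL_mono {ω : Ω} (hT : IsEventSequence fun i => T i ω)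
    (hS : IsEventSequence fun i => S i ω) (hB : ∀ i, S i ω ≠ ∞ → 0 < B i ω) {s t : ℝ}
    (hst : s ≤ t) : totalL T S B s ω ≤ totalL T S B t ω := by
  refine add_le_add (by exact_mod_cast hT.countL_mono hst)
    (Finset.sum_le_sum_of_subset_of_nonneg (Finset.range_mono (hS.countL_mono hst)) ?_)
  intro i hi _
  exact (hB i (((hS.lt_countL_iff t i).1 (Finset.mem_range.1 hi)).trans
    ENNReal.ofReal_lt_top).ne).le

/-- The indicator that the number of arrivals plus the sum of the marks is at most `K`. -/
noncomputable def cutoff (T S : ℕ → Ω → ℝ≥0∞) (B : ℕ → Ω → ℝ) (K : ℕ) (p : ℝ≥0 × Ω) : ℝ≥0∞ :=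
  {p : ℝ≥0 × Ω | totalL T S B p.1 p.2 ≤ K}.indicator (fun _ => 1) p

lemma cutoff_of_le {K : ℕ} {s : ℝ≥0} {ω : Ω} (h : totalL T S B s ω ≤ K) :
    cutoff T S B K (s, ω) = 1 := by
  simp [cutoff, h]

lemma cutoff_of_not_le {K : ℕ} {s : ℝ≥0} {ω : Ω} (h : ¬ totalL T S B s ω ≤ K) :
    cutoff T S B K (s, ω) = 0 := by
  simp [cutoff, h]

lemma momentVarL_nonneg {ω : Ω} (hlam0 : 0 ≤ lam0) (hS : IsEventSequence fun i => S i ω)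
    (hB : ∀ i, S i ω ≠ ∞ → 0 < B i ω) (q g : ℕ) (t : ℝ) :
    0 ≤ momentVarL lam0 r T S B q g t ω :=
  mul_nonneg (Nat.cast_nonneg _) (pow_nonneg (hlam0.trans (intensity_ge hS hB t)) _)

lemma momentVarL_le_of_totalL_le {ω : Ω} (hlam0 : 0 ≤ lam0) (hr : 0 < r)
    (hS : IsEventSequence fun i => S i ω)
    (hB : ∀ i, S i ω ≠ ∞ → 0 < B i ω) (q g : ℕ) {t K : ℝ} (hK : totalL T S B t ω ≤ K) :
    momentVarL lam0 r T S B q g t ω ≤ K ^ q * (lam0 + K) ^ g := by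
  have hnn : 0 ≤ ∑ i ∈ Finset.range (countL (fun i => S i ω) t), B i ω :=
    Finset.sum_nonneg fun i hi => (hB i (((hS.lt_countL_iff t i).1
      (Finset.mem_range.1 hi)).trans ENNReal.ofReal_lt_top).ne).le
  have h1 : ((countL (fun i => T i ω) t : ℕ) : ℝ) ≤ K := by unfold totalL at hK; linarith
  have h2 : ∑ i ∈ Finset.range (countL (fun i => S i ω) t), B i ω ≤ K := by
    have : (0 : ℝ) ≤ (countL (fun i => T i ω) t : ℕ) := Nat.cast_nonneg _
    unfold totalL at hK; linarith
  have h3 : ((queueL T S t ω).descFactorial q : ℝ) ≤ K ^ q := by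
    calc ((queueL T S t ω).descFactorial q : ℝ) ≤ (queueL T S t ω : ℝ) ^ q := by
          exact_mod_cast Nat.descFactorial_le_pow _ _
      _ ≤ K ^ q := by
          refine pow_le_pow_left₀ (Nat.cast_nonneg _) (le_trans ?_ h1) q
          exact_mod_cast Nat.sub_le _ _
  have h4 : intensity lam0 r S B t ω ^ g ≤ (lam0 + K) ^ g :=
    pow_le_pow_left₀ (hlam0.trans (intensity_ge hS hB t))
      ((intensity_le hr hS hB t).trans (by linarith)) g
  exact mul_le_mul h3 h4 (pow_nonneg (hlam0.trans (intensity_ge hS hB t)) _)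
    ((Nat.cast_nonneg _).trans h3)

end Measurability

/-! ### Predictability of the processes, and positivity of the marks. -/

section Predictable

variable {Ω : Type*} [mΩ : MeasurableSpace Ω] {P : Measure Ω} {ℱ : Filtration ℝ≥0 mΩ}
  {lam0 μ r : ℝ} {ν : Measure ℝ} {T S : ℕ → Ω → ℝ≥0∞} {B : ℕ → Ω → ℝ}

lemma predictable_le_prod : ℱ.predictable ≤ (inferInstance : MeasurableSpace (ℝ≥0 × Ω)) :=
  measurableSpace_le_predictable_of_measurableSet
    (fun A hA => (measurableSet_singleton _).prod (ℱ.le _ A hA))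
    (fun _ A hA => measurableSet_Ioi.prod (ℱ.le _ A hA))

lemma measurable_time : Measurable[ℱ.predictable] (fun p : ℝ≥0 × Ω => p.1) := by
  refine measurable_of_Ioi fun x => ?_
  have := measurableSet_predictable_Ioi_prod (𝓕 := ℱ) (i := x) (s := Set.univ)
    (@MeasurableSet.univ _ (ℱ x))
  convert this using 1
  ext p; simp

/-- A rational q between τ and the current time writes the set as a countable union of predictable
rectangles (q, ∞) × {τ ≤ q, A q}. -/
lemma measurableSet_predictable_lt {τ : Ω → ℝ≥0∞} {A : ℝ≥0 → Set Ω}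
    (hA : ∀ q, MeasurableSet[ℱ q] {ω | τ ω ≤ q ∧ ω ∈ A q})
    (hmono : ∀ ω q q' : _, τ ω ≤ (q : ℝ≥0) → (ω ∈ A q ↔ ω ∈ A q')) :
    MeasurableSet[ℱ.predictable] {p : ℝ≥0 × Ω | τ p.2 < p.1 ∧ p.2 ∈ A p.1} := by
  have : {p : ℝ≥0 × Ω | τ p.2 < p.1 ∧ p.2 ∈ A p.1}
      = ⋃ q : ℚ, Set.Ioi (Real.toNNReal q) ×ˢ
        {ω | τ ω ≤ Real.toNNReal q ∧ ω ∈ A (Real.toNNReal q)} := by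
    ext p
    simp only [Set.mem_ofPred_eq, Set.mem_iUnion, Set.mem_prod, Set.mem_Ioi]
    constructor
    · rintro ⟨h1, h2⟩
      obtain ⟨q, -, hq1, hq2⟩ := ENNReal.lt_iff_exists_rat_btwn.1 h1
      exact ⟨q, ENNReal.coe_lt_coe.1 hq2, hq1.le, (hmono _ _ _ hq1.le).2 h2⟩
    · rintro ⟨q, hq1, hq2, hq3⟩
      exact ⟨hq2.trans_lt (ENNReal.coe_lt_coe.2 hq1), (hmono _ _ _ hq2).1 hq3⟩
  rw [this]
  exact @MeasurableSet.iUnion _ _ ℱ.predictable _ _ fun q =>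
    measurableSet_predictable_Ioi_prod (hA _)

namespace IsMarkovianQueue

lemma measurableSet_arrival (hX : IsMarkovianQueue P ℱ lam0 μ r ν T S B) (i : ℕ) :
    MeasurableSet[ℱ.predictable] {p : ℝ≥0 × Ω | T i p.2 < p.1} := by
  have := measurableSet_predictable_lt (ℱ := ℱ) (τ := T i) (A := fun _ => Set.univ)
    (fun q => by simpa using hX.adapted_arrivals i q) (fun _ _ _ _ => Iff.rfl)
  simpa using this

lemma measurableSet_departure (hX : IsMarkovianQueue P ℱ lam0 μ r ν T S B) (i : ℕ) (c : ℝ≥0∞) (G : Set ℝ) (hG : MeasurableSet G) :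
    MeasurableSet[ℱ.predictable]
      {p : ℝ≥0 × Ω | S i p.2 < p.1 ∧ S i p.2 ≤ c ∧ B i p.2 ∈ G} := by
  refine measurableSet_predictable_lt (ℱ := ℱ) (τ := S i)
    (A := fun _ => {ω | S i ω ≤ c ∧ B i ω ∈ G}) (fun q => ?_) (fun _ _ _ _ => Iff.rfl)
  induction c with
  | top => simpa using hX.adapted_departures i q G hG
  | coe c =>
    have h1 := ℱ.mono (min_le_left q c) _ (hX.adapted_departures i (min q c) G hG)
    convert h1 using 1
    ext ω
    simp [and_assoc]

lemma measurable_countL_arrivals (hX : IsMarkovianQueue P ℱ lam0 μ r ν T S B) :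
    Measurable[ℱ.predictable] fun p : ℝ≥0 × Ω => countL (fun i => T i p.2) p.1 :=
  @measurable_countL_comp _ _ ℱ.predictable _ _ _ hX.arrivals hX.measurableSet_arrival

lemma measurable_countL_departures (hX : IsMarkovianQueue P ℱ lam0 μ r ν T S B) :
    Measurable[ℱ.predictable] fun p : ℝ≥0 × Ω => countL (fun i => S i p.2) p.1 :=
  @measurable_countL_comp _ _ ℱ.predictable _ _ _ hX.departures fun i => by
    simpa using hX.measurableSet_departure i ∞ Set.univ MeasurableSet.univ

lemma measurable_queueL (hX : IsMarkovianQueue P ℱ lam0 μ r ν T S B) :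
    Measurable[ℱ.predictable] fun p : ℝ≥0 × Ω => queueL T S p.1 p.2 :=
  hX.measurable_countL_arrivals.sub hX.measurable_countL_departures

lemma measurable_intensity (hX : IsMarkovianQueue P ℱ lam0 μ r ν T S B) :
    Measurable[ℱ.predictable] fun p : ℝ≥0 × Ω => intensity lam0 r S B p.1 p.2 :=
  @measurable_intensity_comp _ _ ℱ.predictable _ _ _ _ _ _ hX.departures measurable_time
    hX.measurableSet_departure

lemma measurable_totalL (hX : IsMarkovianQueue P ℱ lam0 μ r ν T S B) :
    Measurable[ℱ.predictable] fun p : ℝ≥0 × Ω => totalL T S B p.1 p.2 :=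
  @measurable_totalL_comp _ _ ℱ.predictable _ _ _ _ _ hX.arrivals hX.departures
    hX.measurableSet_arrival hX.measurableSet_departure

lemma measurable_of_queueL_intensity (hX : IsMarkovianQueue P ℱ lam0 μ r ν T S B) {Y : Type*} [MeasurableSpace Y] (F : ℕ → ℝ → Y)
    (hF : ∀ q, Measurable (F q)) :
    Measurable[ℱ.predictable] fun p : ℝ≥0 × Ω =>
      F (queueL T S p.1 p.2) (intensity lam0 r S B p.1 p.2) :=
  (measurable_from_prod_countable_right (f := fun z : ℕ × ℝ => F z.1 z.2) hF).comp
    (hX.measurable_queueL.prodMk hX.measurable_intensity)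

lemma measurable_arrival (hX : IsMarkovianQueue P ℱ lam0 μ r ν T S B) (i : ℕ) : Measurable (T i) := by
  refine measurable_of_Iic fun c => ?_
  induction c with
  | top => simp
  | coe c => exact ℱ.le c _ (hX.adapted_arrivals i c)

lemma measurable_departure (hX : IsMarkovianQueue P ℱ lam0 μ r ν T S B) (i : ℕ) : Measurable (S i) := by
  refine measurable_of_Iic fun c => ?_
  induction c with
  | top => simp
  | coe c =>
    have h := hX.adapted_departures i c Set.univ MeasurableSet.univ
    simp only [Set.mem_univ, and_true] at h
    exact ℱ.le c _ h

/-- Test the marked intensity with the indicator of b ≤ 0: its compensator vanishes, so almost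
surely no finite departure carries such a mark. -/
lemma ae_mark_pos (hX : IsMarkovianQueue P ℱ lam0 μ r ν T S B) (hν : ∀ᵐ x ∂ν, 0 < x) : ∀ᵐ ω ∂P, ∀ i, S i ω ≠ ∞ → 0 < B i ω := by
  have hC : Measurable[ℱ.predictable.prod Real.measurableSpace]
      (fun z : (ℝ≥0 × Ω) × ℝ => (Set.Iic (0 : ℝ)).indicator (fun _ => (1 : ℝ≥0∞)) z.2) :=
    (measurable_const.indicator measurableSet_Iic).comp
      (@measurable_snd _ _ ℱ.predictable Real.measurableSpace)
  have h := hX.departure_intensity _ hC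
  have h0 : ∫⁻ b, (Set.Iic (0 : ℝ)).indicator (fun _ => (1 : ℝ≥0∞)) b ∂ν = 0 := by
    rw [lintegral_indicator measurableSet_Iic, setLIntegral_one]
    rw [ae_iff] at hν
    convert hν using 2
    ext x; simp
  simp only [h0, zero_mul, lintegral_zero] at h
  have hset : ∀ i, MeasurableSet {ω | S i ω ≠ ∞ ∧ B i ω ≤ 0} := by
    intro i
    have : {ω | S i ω ≠ ∞ ∧ B i ω ≤ 0} = ⋃ n : ℕ, {ω | S i ω ≤ (n : ℝ≥0) ∧ B i ω ∈ Set.Iic 0} := by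
      ext ω
      simp only [Set.mem_ofPred_eq, Set.mem_iUnion, Set.mem_Iic, exists_and_right]
      refine and_congr_left fun _ => ⟨fun h => ?_, ?_⟩
      · obtain ⟨n, hn⟩ := ENNReal.exists_nat_gt h
        exact ⟨n, by simpa using hn.le⟩
      · rintro ⟨n, hn⟩
        exact (hn.trans_lt ENNReal.coe_lt_top).ne
    rw [this]
    exact MeasurableSet.iUnion fun n => ℱ.le _ _ (hX.adapted_departures i n _ measurableSet_Iic)
  have hterm : ∀ i ω, (if S i ω = ∞ then 0 else
      (Set.Iic (0 : ℝ)).indicator (fun _ => (1 : ℝ≥0∞)) (B i ω))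
      = {ω | S i ω ≠ ∞ ∧ B i ω ≤ 0}.indicator (fun _ => (1 : ℝ≥0∞)) ω := by
    intro i ω
    by_cases h1 : S i ω = ∞ <;> by_cases h2 : B i ω ≤ 0 <;> simp [h1, h2]
  simp only [hterm] at h
  rw [lintegral_eq_zero_iff (Measurable.tsum fun i =>
    measurable_const.indicator (hset i))] at h
  filter_upwards [h] with ω hω i hi
  by_contra hb
  have := ENNReal.tsum_eq_zero.1 hω i
  rw [Set.indicator_of_mem (show ω ∈ {ω | S i ω ≠ ∞ ∧ B i ω ≤ 0} from ⟨hi, not_lt.1 hb⟩)] at this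
  exact one_ne_zero this

end IsMarkovianQueue

end Predictable

/-! ### Expected sums over events as time integrals. -/

section Expectations

/-- The two versions differ only at the countably many event times, so the departure intensity may
be replaced by its predictable version under a time integral. -/
lemma ae_queue_eq_queueL {Ω : Type*} {T S : ℕ → Ω → ℝ≥0∞} {ω : Ω} (hT : IsEventSequence fun i => T i ω)
    (hS : IsEventSequence fun i => S i ω) :
    ∀ᵐ s ∂(volume.restrict (Set.Ioi (0 : ℝ))), queue T S s ω = queueL T S s ω := by
  have hc : (Set.range (fun i => (T i ω).toReal) ∪ Set.range (fun i => (S i ω).toReal)).Countable :=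
    (Set.countable_range _).union (Set.countable_range _)
  have h1 : ∀ᵐ s ∂(volume.restrict (Set.Ioi (0 : ℝ))),
      s ∉ Set.range (fun i => (T i ω).toReal) ∪ Set.range (fun i => (S i ω).toReal) :=
    ae_restrict_of_ae (hc.ae_notMem _)
  filter_upwards [h1, ae_restrict_mem measurableSet_Ioi] with s hs hs0
  have h2 : ∀ i, (fun i => T i ω) i ≠ ENNReal.ofReal s := fun i hi =>
    hs (Or.inl ⟨i, by simp only at hi; simp [hi, ENNReal.toReal_ofReal (le_of_lt hs0)]⟩)
  have h3 : ∀ i, (fun i => S i ω) i ≠ ENNReal.ofReal s := fun i hi =>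
    hs (Or.inr ⟨i, by simp only at hi; simp [hi, ENNReal.toReal_ofReal (le_of_lt hs0)]⟩)
  rw [queue, queueL, hT.count_eq_countL h2, hS.count_eq_countL h3]

variable {Ω : Type*} [mΩ : MeasurableSpace Ω] {P : Measure Ω} {ℱ : Filtration ℝ≥0 mΩ}
  {lam0 μ r : ℝ} {ν : Measure ℝ} {T S : ℕ → Ω → ℝ≥0∞} {B : ℕ → Ω → ℝ}

lemma lintegral_lintegral_Ioo_swap [SFinite P] {g : ℝ≥0 × Ω → ℝ≥0∞} (hg : Measurable g) (t : ℝ) :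
    ∫⁻ ω, (∫⁻ s in Set.Ioo (0 : ℝ) t, g (s.toNNReal, ω)) ∂P
      = ∫⁻ s in Set.Ioo (0 : ℝ) t, (∫⁻ ω, g (s.toNNReal, ω) ∂P) := by
  refine lintegral_lintegral_swap (Measurable.aemeasurable ?_)
  exact hg.comp ((measurable_real_toNNReal.comp measurable_snd).prodMk measurable_fst)

lemma setLIntegral_Ioi_ite (h : ℝ → ℝ≥0∞) (t : ℝ) :
    ∫⁻ s in Set.Ioi (0 : ℝ), (if s < t then h s else 0) = ∫⁻ s in Set.Ioo (0 : ℝ) t, h s := by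
  have h1 : (fun s => if s < t then h s else 0) = (Set.Iio t).indicator h := by
    ext s; simp [Set.indicator_apply]
  rw [h1, setLIntegral_indicator measurableSet_Iio, Set.inter_comm, Set.Ioi_inter_Iio]

lemma ite_event_eq (x : ℝ≥0∞) (t : ℝ) (y : ℝ≥0∞) :
    (if x = ∞ then 0 else if ((x.toNNReal : ℝ≥0) : ℝ) < t then y else 0)
      = if x < ENNReal.ofReal t then y else 0 := by
  induction x with
  | top => simp
  | coe x =>
    have : (x : ℝ≥0∞) < ENNReal.ofReal t ↔ (x : ℝ) < t := by
      rw [ENNReal.ofReal, ENNReal.coe_lt_coe, Real.lt_toNNReal_iff_coe_lt]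
    by_cases h : (x : ℝ) < t <;> simp [this, h]

/-- The law of the marks integrates to a binomial sum. -/
lemma integral_add_pow_sub_pow {g : ℕ} (hint : ∀ k ≤ g, Integrable (fun b : ℝ => b ^ k) ν)
    (x : ℝ) : Integrable (fun b : ℝ => (x + b) ^ g - x ^ g) ν ∧
      ∫ b, ((x + b) ^ g - x ^ g) ∂ν
        = ∑ j ∈ Finset.range g, (g.choose j : ℝ) * (∫ b, b ^ (g - j) ∂ν) * x ^ j := by
  have h1 : (fun b : ℝ => (x + b) ^ g - x ^ g)
      = fun b => ∑ j ∈ Finset.range g, ((g.choose j : ℝ) * x ^ j) * b ^ (g - j) := by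
    ext b
    rw [add_pow, Finset.sum_range_succ]
    simp only [Nat.sub_self, pow_zero, Nat.choose_self, Nat.cast_one, mul_one, add_sub_cancel_right]
    exact Finset.sum_congr rfl fun j _ => by ring
  have h2 : ∀ j ∈ Finset.range g,
      Integrable (fun b : ℝ => ((g.choose j : ℝ) * x ^ j) * b ^ (g - j)) ν := fun j _ =>
    (hint (g - j) (Nat.sub_le _ _)).const_mul _
  rw [h1]
  refine ⟨integrable_finsetSum _ h2, ?_⟩
  rw [integral_finsetSum _ h2]
  refine Finset.sum_congr rfl fun j _ => ?_
  rw [integral_const_mul]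
  ring

namespace IsMarkovianQueue

/-- Test the intensity with `f` times the indicator of times before `t`, then apply Tonelli. -/
lemma lintegral_arrivals [IsProbabilityMeasure P] (hX : IsMarkovianQueue P ℱ lam0 μ r ν T S B)
    {f : ℝ≥0 × Ω → ℝ≥0∞} (hf : Measurable[ℱ.predictable] f) (t : ℝ) :
    ∫⁻ ω, ∑ i ∈ Finset.range (countL (fun i => T i ω) t), f ((T i ω).toNNReal, ω) ∂P
      = ∫⁻ s in Set.Ioo (0 : ℝ) t,
        (∫⁻ ω, f (s.toNNReal, ω) * ENNReal.ofReal (intensity lam0 r S B s ω) ∂P) := by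
  have hset : MeasurableSet[ℱ.predictable] {p : ℝ≥0 × Ω | (p.1 : ℝ) < t} :=
    measurableSet_lt (measurable_subtype_coe.comp measurable_time) measurable_const
  have hC : Measurable[ℱ.predictable] (fun p : ℝ≥0 × Ω => if (p.1 : ℝ) < t then f p else 0) :=
    Measurable.ite hset hf measurable_const
  have h := hX.arrival_intensity _ hC
  have hL : ∀ ω, (∑' i, if T i ω = ∞ then 0 else
      if (((T i ω).toNNReal, ω).1 : ℝ) < t then f ((T i ω).toNNReal, ω) else 0)
      = ∑ i ∈ Finset.range (countL (fun i => T i ω) t), f ((T i ω).toNNReal, ω) := by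
    intro ω
    simp only [ite_event_eq]
    exact (hX.arrivals ω).sum_eq_tsum t _
  simp only [hL] at h
  rw [h]
  have hg : Measurable fun p : ℝ≥0 × Ω =>
      f p * ENNReal.ofReal (intensity lam0 r S B p.1 p.2) :=
    ((hf.mul hX.measurable_intensity.ennreal_ofReal)).mono predictable_le_prod le_rfl
  have hR : ∀ ω, ∫⁻ s in Set.Ioi (0 : ℝ), (if (((s.toNNReal, ω) : ℝ≥0 × Ω).1 : ℝ) < t then
        f (s.toNNReal, ω) else 0) * ENNReal.ofReal (intensity lam0 r S B s ω)
      = ∫⁻ s in Set.Ioo (0 : ℝ) t,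
        f (s.toNNReal, ω) * ENNReal.ofReal (intensity lam0 r S B (s.toNNReal : ℝ) ω) := by
    intro ω
    rw [← setLIntegral_Ioi_ite]
    refine setLIntegral_congr_fun measurableSet_Ioi fun s hs => ?_
    simp only [Real.coe_toNNReal s (le_of_lt hs)]
    split_ifs <;> simp
  simp only [hR]
  rw [lintegral_lintegral_Ioo_swap hg]
  refine setLIntegral_congr_fun measurableSet_Ioo fun s hs => ?_
  simp only [Real.coe_toNNReal s hs.1.le]

lemma lintegral_departures [IsProbabilityMeasure P] [SFinite ν]
    (hX : IsMarkovianQueue P ℱ lam0 μ r ν T S B)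
    {f : (ℝ≥0 × Ω) × ℝ → ℝ≥0∞} (hf : Measurable[ℱ.predictable.prod Real.measurableSpace] f)
    (t : ℝ) :
    ∫⁻ ω, ∑ i ∈ Finset.range (countL (fun i => S i ω) t), f (((S i ω).toNNReal, ω), B i ω) ∂P
      = ∫⁻ s in Set.Ioo (0 : ℝ) t,
        (∫⁻ ω, (∫⁻ b, f ((s.toNNReal, ω), b) ∂ν) * ENNReal.ofReal (μ * queueL T S s ω) ∂P) := by
  have hset : MeasurableSet[ℱ.predictable.prod Real.measurableSpace]
      {z : (ℝ≥0 × Ω) × ℝ | (z.1.1 : ℝ) < t} :=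
    measurableSet_lt ((measurable_subtype_coe.comp measurable_time).comp
      (@measurable_fst _ _ ℱ.predictable Real.measurableSpace)) measurable_const
  have hC : Measurable[ℱ.predictable.prod Real.measurableSpace]
      (fun z : (ℝ≥0 × Ω) × ℝ => if (z.1.1 : ℝ) < t then f z else 0) :=
    Measurable.ite hset hf measurable_const
  have h := hX.departure_intensity _ hC
  have hL : ∀ ω, (∑' i, if S i ω = ∞ then 0 else
      if (((((S i ω).toNNReal, ω), B i ω) : (ℝ≥0 × Ω) × ℝ).1.1 : ℝ) < t then
        f (((S i ω).toNNReal, ω), B i ω) else 0)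
      = ∑ i ∈ Finset.range (countL (fun i => S i ω) t), f (((S i ω).toNNReal, ω), B i ω) := by
    intro ω
    simp only [ite_event_eq]
    exact (hX.departures ω).sum_eq_tsum t _
  simp only [hL] at h
  rw [h]
  have hf' : Measurable f :=
    hf.mono (sup_le_sup (MeasurableSpace.comap_mono predictable_le_prod) le_rfl) le_rfl
  have hQ : Measurable[ℱ.predictable] fun p : ℝ≥0 × Ω => μ * (queueL T S p.1 p.2 : ℝ) :=
    ((measurable_of_countable (fun n : ℕ => (n : ℝ))).comp hX.measurable_queueL).const_mul μ
  have hg : Measurable fun p : ℝ≥0 × Ω =>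
      (∫⁻ b, f (p, b) ∂ν) * ENNReal.ofReal (μ * queueL T S p.1 p.2) :=
    hf'.lintegral_prod_right'.mul
      (hQ.ennreal_ofReal.mono predictable_le_prod le_rfl)
  have hR : ∀ ω, ∫⁻ s in Set.Ioi (0 : ℝ), (∫⁻ b, (if (((((s.toNNReal, ω) : ℝ≥0 × Ω), b) :
        (ℝ≥0 × Ω) × ℝ).1.1 : ℝ) < t then f ((s.toNNReal, ω), b) else 0) ∂ν)
          * ENNReal.ofReal (μ * queue T S s ω)
      = ∫⁻ s in Set.Ioo (0 : ℝ) t, (∫⁻ b, f ((s.toNNReal, ω), b) ∂ν)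
          * ENNReal.ofReal (μ * queueL T S (s.toNNReal : ℝ) ω) := by
    intro ω
    rw [← setLIntegral_Ioi_ite]
    refine lintegral_congr_ae ?_
    filter_upwards [ae_queue_eq_queueL (hX.arrivals ω) (hX.departures ω),
      ae_restrict_mem measurableSet_Ioi] with s hs1 hs
    rw [hs1]
    simp only [Real.coe_toNNReal s (le_of_lt hs)]
    split_ifs <;> simp
  simp only [hR]
  rw [lintegral_lintegral_Ioo_swap hg]
  refine setLIntegral_congr_fun measurableSet_Ioo fun s hs => ?_
  simp only [Real.coe_toNNReal s hs.1.le]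

end IsMarkovianQueue

end Expectations

/-! ### Expectations of the jump terms, and the truncated inequality. -/

section MomentIdentity

variable {Ω : Type*} [mΩ : MeasurableSpace Ω] {P : Measure Ω} {ℱ : Filtration ℝ≥0 mΩ}
  {lam0 μ r : ℝ} {ν : Measure ℝ} {T S : ℕ → Ω → ℝ≥0∞} {B : ℕ → Ω → ℝ}

/-- The joint moment just before time `t`, as an extended nonnegative real, of the process weighted
by `χ`. -/
noncomputable def weightedMoment (P : Measure Ω) (lam0 r : ℝ) (T S : ℕ → Ω → ℝ≥0∞)
    (B : ℕ → Ω → ℝ) (χ : ℝ≥0 × Ω → ℝ≥0∞) (q g : ℕ) (t : ℝ) : ℝ≥0∞ :=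
  ∫⁻ ω, χ (t.toNNReal, ω) * ENNReal.ofReal (momentVarL lam0 r T S B q g t ω) ∂P

namespace IsMarkovianQueue

lemma measurable_momentVarL (hX : IsMarkovianQueue P ℱ lam0 μ r ν T S B) (q g : ℕ) :
    Measurable[ℱ.predictable] fun p : ℝ≥0 × Ω => momentVarL lam0 r T S B q g p.1 p.2 :=
  hX.measurable_of_queueL_intensity (fun Q x => (Q.descFactorial q : ℝ) * x ^ g)
    fun _ => by fun_prop

lemma measurable_sum_arrivals (hX : IsMarkovianQueue P ℱ lam0 μ r ν T S B)
    {f : ℝ≥0 × Ω → ℝ≥0∞} (hf : Measurable[ℱ.predictable] f) (t : ℝ) :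
    Measurable fun ω =>
      ∑ i ∈ Finset.range (countL (fun i => T i ω) t), f ((T i ω).toNNReal, ω) := by
  simp_rw [← (hX.arrivals _).sum_eq_tsum t]
  refine Measurable.tsum fun i => Measurable.ite
    (measurableSet_lt (hX.measurable_arrival i) measurable_const) ?_ measurable_const
  exact (hf.mono predictable_le_prod le_rfl).comp
    ((hX.measurable_arrival i).ennreal_toNNReal.prodMk measurable_id)

lemma measurable_arrivals_term (hX : IsMarkovianQueue P ℱ lam0 μ r ν T S B)
    {χ : ℝ≥0 × Ω → ℝ≥0∞} (hχ : Measurable[ℱ.predictable] χ) (a g : ℕ) (t : ℝ) :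
    Measurable fun ω => ∑ i ∈ Finset.range (countL (fun i => T i ω) t),
      χ ((T i ω).toNNReal, ω) *
        ENNReal.ofReal (a * momentVarL lam0 r T S B (a - 1) g (T i ω).toReal ω) :=
  hX.measurable_sum_arrivals
    (hχ.mul ((hX.measurable_momentVarL (a - 1) g).const_mul (a : ℝ)).ennreal_ofReal) t

lemma arrivals_term [IsProbabilityMeasure P] (hX : IsMarkovianQueue P ℱ lam0 μ r ν T S B)
    (hlam0 : 0 ≤ lam0) (hgood : ∀ᵐ ω ∂P, ∀ i, S i ω ≠ ∞ → 0 < B i ω)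
    {χ : ℝ≥0 × Ω → ℝ≥0∞} (hχ : Measurable[ℱ.predictable] χ) (a g : ℕ) (t : ℝ) :
    ∫⁻ ω, ∑ i ∈ Finset.range (countL (fun i => T i ω) t), χ ((T i ω).toNNReal, ω) *
        ENNReal.ofReal (a * momentVarL lam0 r T S B (a - 1) g (T i ω).toReal ω) ∂P
      = ∫⁻ s in Set.Ioo (0 : ℝ) t,
        ENNReal.ofReal a * weightedMoment P lam0 r T S B χ (a - 1) (g + 1) s := by
  have hf : Measurable[ℱ.predictable] fun p : ℝ≥0 × Ω =>
      χ p * ENNReal.ofReal (a * momentVarL lam0 r T S B (a - 1) g p.1 p.2) :=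
    hχ.mul ((hX.measurable_momentVarL (a - 1) g).const_mul _).ennreal_ofReal
  refine (hX.lintegral_arrivals hf t).trans (setLIntegral_congr_fun measurableSet_Ioo fun s hs => ?_)
  simp only [Real.coe_toNNReal s hs.1.le]
  rw [weightedMoment, ← lintegral_const_mul' _ _ ENNReal.ofReal_ne_top]
  refine lintegral_congr_ae ?_
  filter_upwards [hgood] with ω hω
  have hΛ := intensity_ge (lam0 := lam0) (r := r) (hX.departures ω) hω s
  rw [ENNReal.ofReal_mul (Nat.cast_nonneg a), mul_assoc, mul_assoc,
    ← ENNReal.ofReal_mul (momentVarL_nonneg hlam0 (hX.departures ω) hω _ _ _), ← mul_left_comm]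
  congr 3
  rw [momentVarL, momentVarL, pow_succ]
  ring

lemma departures_loss_term [IsProbabilityMeasure P] [IsProbabilityMeasure ν]
    (hX : IsMarkovianQueue P ℱ lam0 μ r ν T S B) (hμ : 0 < μ)
    (hlam0 : 0 ≤ lam0) (hgood : ∀ᵐ ω ∂P, ∀ i, S i ω ≠ ∞ → 0 < B i ω) (a g : ℕ) (t : ℝ) :
    ∫⁻ ω, ∑ i ∈ Finset.range (countL (fun i => S i ω) t),
        ENNReal.ofReal (a * (((queueL T S (S i ω).toReal ω - 1).descFactorial (a - 1) : ℝ) *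
            intensity lam0 r S B (S i ω).toReal ω ^ g)) ∂P
      = ∫⁻ s in Set.Ioo (0 : ℝ) t,
        ENNReal.ofReal (a * μ) * weightedMoment P lam0 r T S B (fun _ => 1) a g s := by
  have hf : Measurable[ℱ.predictable.prod Real.measurableSpace] fun z : (ℝ≥0 × Ω) × ℝ =>
      ENNReal.ofReal (a * (((queueL T S z.1.1 z.1.2 - 1).descFactorial (a - 1) : ℝ) *
            intensity lam0 r S B z.1.1 z.1.2 ^ g)) :=
    (hX.measurable_of_queueL_intensity (fun Q x => ENNReal.ofReal
      (a * (((Q - 1).descFactorial (a - 1) : ℝ) * x ^ g))) fun _ => by fun_prop).comp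
      (@measurable_fst _ _ ℱ.predictable Real.measurableSpace)
  refine (hX.lintegral_departures hf t).trans
    (setLIntegral_congr_fun measurableSet_Ioo fun s hs => ?_)
  simp only [Real.coe_toNNReal s hs.1.le, lintegral_const, measure_univ, mul_one]
  rw [weightedMoment, ← lintegral_const_mul' _ _ ENNReal.ofReal_ne_top]
  refine lintegral_congr_ae ?_
  filter_upwards [hgood] with ω hω
  have hΛ := hlam0.trans (intensity_ge (lam0 := lam0) (r := r) (hX.departures ω) hω s)
  rw [one_mul, ← ENNReal.ofReal_mul (by positivity), ← ENNReal.ofReal_mul (by positivity)]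
  congr 1
  rcases a with _ | a
  · simp
  · rw [momentVarL, ← mul_descFactorial_pred, Nat.add_sub_cancel]
    push_cast
    ring

/-- Averaging over the mark expands (Λ+B)^g - Λ^g into powers Λ^j with j < g, and the rate μQ raises
the falling factorial by one: the order a + 1 + j is at most a + g, which is what closes the system.
-/
lemma departures_gain_term [IsProbabilityMeasure P] [IsProbabilityMeasure ν]
    (hX : IsMarkovianQueue P ℱ lam0 μ r ν T S B) (hμ : 0 < μ)
    (hlam0 : 0 ≤ lam0) (hgood : ∀ᵐ ω ∂P, ∀ i, S i ω ≠ ∞ → 0 < B i ω)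
    (hν : ∀ᵐ x ∂ν, 0 < x) {χ : ℝ≥0 × Ω → ℝ≥0∞} (hχ : Measurable[ℱ.predictable] χ) (a : ℕ) {g : ℕ}
    (hint : ∀ k ≤ g, Integrable (fun b : ℝ => b ^ k) ν) (t : ℝ) :
    ∫⁻ ω, ∑ i ∈ Finset.range (countL (fun i => S i ω) t), χ ((S i ω).toNNReal, ω) *
        ENNReal.ofReal (((queueL T S (S i ω).toReal ω - 1).descFactorial a : ℝ) *
            ((intensity lam0 r S B (S i ω).toReal ω + B i ω) ^ g
              - intensity lam0 r S B (S i ω).toReal ω ^ g)) ∂P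
      = ∫⁻ s in Set.Ioo (0 : ℝ) t, ∑ j ∈ Finset.range g,
        ENNReal.ofReal (μ * ((g.choose j : ℝ) * ∫ b, b ^ (g - j) ∂ν)) *
          weightedMoment P lam0 r T S B χ (a + 1) j s := by
  have hf : Measurable[ℱ.predictable.prod Real.measurableSpace] fun z : (ℝ≥0 × Ω) × ℝ =>
      χ z.1 * ENNReal.ofReal (((queueL T S z.1.1 z.1.2 - 1).descFactorial a : ℝ) *
            ((intensity lam0 r S B z.1.1 z.1.2 + z.2) ^ g
              - intensity lam0 r S B z.1.1 z.1.2 ^ g)) := by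
    have h1 := @measurable_fst _ _ ℱ.predictable Real.measurableSpace
    have h2 := @measurable_snd _ _ ℱ.predictable Real.measurableSpace
    have h3 := (hX.measurable_of_queueL_intensity (fun Q _ => ((Q - 1).descFactorial a : ℝ))
      fun _ => measurable_const).comp h1
    have h4 := hX.measurable_intensity.comp h1
    exact (hχ.comp h1).mul (h3.mul (((h4.add h2).pow_const g).sub (h4.pow_const g))).ennreal_ofReal
  refine (hX.lintegral_departures hf t).trans
    (setLIntegral_congr_fun measurableSet_Ioo fun s hs => ?_)
  simp only [Real.coe_toNNReal s hs.1.le]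
  have hmeas : ∀ j, Measurable fun ω =>
      χ (s.toNNReal, ω) * ENNReal.ofReal (momentVarL lam0 r T S B (a + 1) j s ω) := by
    intro j
    have := (hχ.mul (hX.measurable_momentVarL (a + 1) j).ennreal_ofReal).mono
      predictable_le_prod le_rfl
    have := this.comp (measurable_prodMk_left (x := s.toNNReal))
    simpa only [Function.comp_def, Pi.mul_apply, Real.coe_toNNReal s hs.1.le] using this
  simp only [weightedMoment]
  simp_rw [← lintegral_const_mul' _ _ ENNReal.ofReal_ne_top]
  rw [← lintegral_finsetSum' _ fun j _ => ((hmeas j).const_mul _).aemeasurable]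
  refine lintegral_congr_ae ?_
  filter_upwards [hgood] with ω hω
  have hΛ := hlam0.trans (intensity_ge (lam0 := lam0) (r := r) (hX.departures ω) hω s)
  set x := intensity lam0 r S B s ω with hx
  set Q := queueL T S s ω with hQ
  obtain ⟨hi, he⟩ := integral_add_pow_sub_pow hint x
  have hnn : 0 ≤ᵐ[ν] fun b => ((Q - 1).descFactorial a : ℝ) * ((x + b) ^ g - x ^ g) := by
    filter_upwards [hν] with b hb
    exact mul_nonneg (Nat.cast_nonneg _)
      (sub_nonneg.2 (pow_le_pow_left₀ hΛ (le_add_of_nonneg_right hb.le) g))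
  have hβ : ∀ k, 0 ≤ ∫ b, b ^ k ∂ν := fun k =>
    integral_nonneg_of_ae (by filter_upwards [hν] with b hb using pow_nonneg hb.le k)
  have hm : Measurable fun b : ℝ => ENNReal.ofReal
      (((Q - 1).descFactorial a : ℝ) * ((x + b) ^ g - x ^ g)) := by fun_prop
  rw [lintegral_const_mul _ hm, ← ofReal_integral_eq_lintegral_ofReal (hi.const_mul _) hnn,
    integral_const_mul, he, mul_assoc]
  have hsum : 0 ≤ ∑ j ∈ Finset.range g, (g.choose j : ℝ) * (∫ b, b ^ (g - j) ∂ν) * x ^ j :=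
    Finset.sum_nonneg fun j _ => mul_nonneg (mul_nonneg (Nat.cast_nonneg _) (hβ _))
      (pow_nonneg hΛ j)
  rw [← ENNReal.ofReal_mul (mul_nonneg (Nat.cast_nonneg _) hsum)]
  simp_rw [mul_left_comm _ (χ (s.toNNReal, ω))]
  rw [← Finset.mul_sum]
  congr 1
  have hc : ∀ j, 0 ≤ μ * ((g.choose j : ℝ) * ∫ b, b ^ (g - j) ∂ν) := fun j =>
    mul_nonneg hμ.le (mul_nonneg (Nat.cast_nonneg _) (hβ _))
  simp_rw [← ENNReal.ofReal_mul (hc _)]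
  rw [← ENNReal.ofReal_sum_of_nonneg fun j _ => mul_nonneg (hc j)
    (momentVarL_nonneg hlam0 (hX.departures ω) hω _ _ _)]
  congr 1
  simp only [momentVarL, ← hx, ← hQ, ← mul_descFactorial_pred]
  rw [Finset.mul_sum, Finset.sum_mul]
  refine Finset.sum_congr rfl fun j _ => ?_
  push_cast
  ring

lemma measurable_cutoff (hX : IsMarkovianQueue P ℱ lam0 μ r ν T S B) (K : ℕ) :
    Measurable[ℱ.predictable] (cutoff T S B K) :=
  Measurable.indicator measurable_const
    (measurableSet_le hX.measurable_totalL measurable_const)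

/-- The pathwise inequality behind the moment bound. -/
lemma cutoff_mul_momentVarL_le (hX : IsMarkovianQueue P ℱ lam0 μ r ν T S B) (hr : 0 < r)
    (hlam0 : 0 ≤ lam0) {ω : Ω} (hω : ∀ i, S i ω ≠ ∞ → 0 < B i ω) (K a g : ℕ) {t : ℝ} (ht : 0 ≤ t) :
    cutoff T S B K (t.toNNReal, ω) * ENNReal.ofReal (momentVarL lam0 r T S B a g t ω)
      ≤ ENNReal.ofReal (((0 : ℕ).descFactorial a : ℝ) * lam0 ^ g)
        + (∑ i ∈ Finset.range (countL (fun i => T i ω) t), cutoff T S B K ((T i ω).toNNReal, ω) *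
          ENNReal.ofReal (a * momentVarL lam0 r T S B (a - 1) g (T i ω).toReal ω)
        + ∑ i ∈ Finset.range (countL (fun i => S i ω) t), cutoff T S B K ((S i ω).toNNReal, ω) *
          ENNReal.ofReal (((queueL T S (S i ω).toReal ω - 1).descFactorial a : ℝ) *
            ((intensity lam0 r S B (S i ω).toReal ω + B i ω) ^ g
              - intensity lam0 r S B (S i ω).toReal ω ^ g))) := by
  -- Either the left side vanishes, or every cutoff factor on the right equals 1 and the path
  -- formula applies.
  by_cases hK : totalL T S B t ω ≤ K
  swap
  · have : cutoff T S B K (t.toNNReal, ω) = 0 :=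
      cutoff_of_not_le (by simpa only [Real.coe_toNNReal t ht] using hK)
    simp [this]
  have hone : ∀ s : ℝ≥0, (s : ℝ) ≤ t → cutoff T S B K (s, ω) = 1 := fun s hs =>
    cutoff_of_le ((totalL_mono (hX.arrivals ω) (hX.departures ω) hω hs).trans hK)
  have hT1 : ∀ i ∈ Finset.range (countL (fun i => T i ω) t),
      cutoff T S B K ((T i ω).toNNReal, ω) *
        ENNReal.ofReal (a * momentVarL lam0 r T S B (a - 1) g (T i ω).toReal ω)
      = ENNReal.ofReal (a * momentVarL lam0 r T S B (a - 1) g (T i ω).toReal ω) := fun i hi => by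
    rw [hone _ (ENNReal.toReal_le_of_le_ofReal ht
      (((hX.arrivals ω).lt_countL_iff t i).1 (Finset.mem_range.1 hi)).le), one_mul]
  have hS1 : ∀ i ∈ Finset.range (countL (fun i => S i ω) t),
      cutoff T S B K ((S i ω).toNNReal, ω) *
        ENNReal.ofReal (((queueL T S (S i ω).toReal ω - 1).descFactorial a : ℝ) *
            ((intensity lam0 r S B (S i ω).toReal ω + B i ω) ^ g
              - intensity lam0 r S B (S i ω).toReal ω ^ g))
      = ENNReal.ofReal (((queueL T S (S i ω).toReal ω - 1).descFactorial a : ℝ) *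
            ((intensity lam0 r S B (S i ω).toReal ω + B i ω) ^ g
              - intensity lam0 r S B (S i ω).toReal ω ^ g)) := fun i hi => by
    rw [hone _ (ENNReal.toReal_le_of_le_ofReal ht
      (((hX.departures ω).lt_countL_iff t i).1 (Finset.mem_range.1 hi)).le), one_mul]
  rw [hone _ (Real.coe_toNNReal t ht).le, one_mul,
    Finset.sum_congr rfl hT1, Finset.sum_congr rfl hS1]
  have hΛ : ∀ s, 0 ≤ intensity lam0 r S B s ω := fun s =>
    hlam0.trans (intensity_ge (hX.departures ω) hω s)
  have hTn : ∀ i ∈ Finset.range (countL (fun i => T i ω) t),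
      0 ≤ a * momentVarL lam0 r T S B (a - 1) g (T i ω).toReal ω := fun i _ =>
    mul_nonneg (Nat.cast_nonneg _) (momentVarL_nonneg hlam0 (hX.departures ω) hω _ _ _)
  have hSn : ∀ i ∈ Finset.range (countL (fun i => S i ω) t),
      0 ≤ ((queueL T S (S i ω).toReal ω - 1).descFactorial a : ℝ) *
            ((intensity lam0 r S B (S i ω).toReal ω + B i ω) ^ g
              - intensity lam0 r S B (S i ω).toReal ω ^ g) := fun i hi =>
    mul_nonneg (Nat.cast_nonneg _) (sub_nonneg.2 (pow_le_pow_left₀ (hΛ _)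
      (le_add_of_nonneg_right (hω i ((((hX.departures ω).lt_countL_iff t i).1
        (Finset.mem_range.1 hi)).trans ENNReal.ofReal_lt_top).ne).le) g))
  rw [← ENNReal.ofReal_sum_of_nonneg hTn, ← ENNReal.ofReal_sum_of_nonneg hSn,
    ← ENNReal.ofReal_add (Finset.sum_nonneg hTn) (Finset.sum_nonneg hSn),
    ← ENNReal.ofReal_add (by positivity)
      (add_nonneg (Finset.sum_nonneg hTn) (Finset.sum_nonneg hSn))]
  refine ENNReal.ofReal_le_ofReal ?_
  have hpath := (momentVarL_path (lam0 := lam0) (r := r) (B := B) (hX.arrivals ω) (hX.departures ω)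
    (hX.departures_le_arrivals ω) (hX.no_common_jump ω) a g ht).2
  -- Decay (`h1`) and departure loss (`h2`) are nonnegative and sit on the left of the path formula,
  -- so an upper bound may drop them.
  have h1 : 0 ≤ ∫ u in (0 : ℝ)..t, r * g * (((queueL T S u ω).descFactorial a : ℝ) *
        intensity lam0 r S B u ω ^ (g - 1) * (intensity lam0 r S B u ω - lam0)) := by
    refine intervalIntegral.integral_nonneg ht fun u _ => ?_
    have := sub_nonneg.2 (intensity_ge (lam0 := lam0) (r := r) (hX.departures ω) hω u)
    have := hΛ u
    positivity
  have h2 : 0 ≤ ∑ i ∈ Finset.range (countL (fun i => S i ω) t),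
          a * (((queueL T S (S i ω).toReal ω - 1).descFactorial (a - 1) : ℝ) *
            intensity lam0 r S B (S i ω).toReal ω ^ g) :=
    Finset.sum_nonneg fun i _ => by have := hΛ (S i ω).toReal; positivity
  linarith

lemma weightedMoment_cutoff_le [IsProbabilityMeasure P] [IsProbabilityMeasure ν]
    (hX : IsMarkovianQueue P ℱ lam0 μ r ν T S B) (hμ : 0 < μ) (hr : 0 < r)
    (hlam0 : 0 ≤ lam0) (hgood : ∀ᵐ ω ∂P, ∀ i, S i ω ≠ ∞ → 0 < B i ω)
    (hν : ∀ᵐ x ∂ν, 0 < x) (K a : ℕ) {g : ℕ}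
    (hint : ∀ k ≤ g, Integrable (fun b : ℝ => b ^ k) ν) {t : ℝ} (ht : 0 ≤ t) :
    weightedMoment P lam0 r T S B (cutoff T S B K) a g t
      ≤ ENNReal.ofReal (((0 : ℕ).descFactorial a : ℝ) * lam0 ^ g)
        + (∫⁻ s in Set.Ioo (0 : ℝ) t,
          ENNReal.ofReal a * weightedMoment P lam0 r T S B (cutoff T S B K) (a - 1) (g + 1) s)
        + ∫⁻ s in Set.Ioo (0 : ℝ) t, ∑ j ∈ Finset.range g,
          ENNReal.ofReal (μ * ((g.choose j : ℝ) * ∫ b, b ^ (g - j) ∂ν)) *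
            weightedMoment P lam0 r T S B (cutoff T S B K) (a + 1) j s := by
  have hχ := hX.measurable_cutoff K
  rw [← hX.arrivals_term hlam0 hgood hχ a g t,
    ← hX.departures_gain_term hμ hlam0 hgood hν hχ a hint t, weightedMoment]
  have hm := hX.measurable_arrivals_term (lam0 := lam0) hχ a g t
  rw [add_assoc, ← lintegral_add_left hm]
  conv_rhs => rw [← one_mul (ENNReal.ofReal (_ * lam0 ^ g)), ← measure_univ (μ := P), mul_comm,
    ← lintegral_const, ← lintegral_add_left measurable_const]
  refine lintegral_mono_ae ?_
  filter_upwards [hgood] with ω hω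
  exact hX.cutoff_mul_momentVarL_le hr hlam0 hω K a g ht

end IsMarkovianQueue

end MomentIdentity

/-! ### Finiteness and exponential bounds for the moments. -/

section Finiteness

lemma lintegral_exp_le {c : ℝ} (hc : 0 < c) {t : ℝ} (ht : 0 ≤ t) :
    ∫⁻ s in Set.Ioo (0 : ℝ) t, ENNReal.ofReal (Real.exp (c * s))
      ≤ ENNReal.ofReal (Real.exp (c * t) / c) := by
  have hcont : Continuous fun s : ℝ => Real.exp (c * s) := by fun_prop
  have hi : IntegrableOn (fun s : ℝ => Real.exp (c * s)) (Set.Ioc 0 t) :=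
    hcont.integrableOn_Icc.mono_set Set.Ioc_subset_Icc_self
  rw [setLIntegral_congr Ioo_ae_eq_Ioc, ← ofReal_integral_eq_lintegral_ofReal hi
    (ae_of_all _ fun s => (Real.exp_pos _).le), ← intervalIntegral.integral_of_le ht]
  refine ENNReal.ofReal_le_ofReal ?_
  rw [intervalIntegral.integral_comp_mul_left (fun x => Real.exp x) hc.ne', integral_exp,
    smul_eq_mul, inv_mul_eq_div]
  have := Real.exp_pos (c * 0)
  gcongr
  linarith

/-- A Grönwall inequality for bounded functions with values in the extended nonnegative reals. -/
lemma ennreal_gronwall {w : ℝ → ℝ≥0∞} {c : ℝ} (hc : 0 < c) {d M : ℝ≥0∞} (hM : M ≠ ∞) {t₀ : ℝ}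
    (hw : ∀ t ∈ Set.Icc 0 t₀, w t ≤ M)
    (h : ∀ t ∈ Set.Icc 0 t₀, w t ≤ d + ∫⁻ s in Set.Ioo (0 : ℝ) t, ENNReal.ofReal c * w s)
    {t : ℝ} (ht : t ∈ Set.Icc 0 t₀) : w t ≤ 2 * d * ENNReal.ofReal (Real.exp (2 * c * t)) := by
  have hexp : ∀ s : ℝ, ENNReal.ofReal (Real.exp (-(2 * c * s))) *
      ENNReal.ofReal (Real.exp (2 * c * s)) = 1 := fun s => by
    rw [← ENNReal.ofReal_mul (Real.exp_pos _).le, ← Real.exp_add]; simp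
  -- In this weighted supremum norm the integral operator has norm at most 1/2, hence W ≤ d + W/2.
  -- The bound `M` serves only to make W finite, so that W/2 can be cancelled.
  set W : ℝ≥0∞ := ⨆ s ∈ Set.Icc 0 t₀, w s * ENNReal.ofReal (Real.exp (-(2 * c * s))) with hW
  have hWM : W ≤ M := by
    refine iSup₂_le fun s hs => ?_
    calc w s * ENNReal.ofReal (Real.exp (-(2 * c * s))) ≤ M * 1 := by
          refine mul_le_mul' (hw s hs) (ENNReal.ofReal_le_one.2 (Real.exp_le_one_iff.2 ?_))
          have := hs.1
          nlinarith
      _ = M := mul_one M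
  have hWtop : W ≠ ∞ := ne_top_of_le_ne_top hM hWM
  have hwW : ∀ s ∈ Set.Icc 0 t₀, w s ≤ W * ENNReal.ofReal (Real.exp (2 * c * s)) := by
    intro s hs
    calc w s = w s * ENNReal.ofReal (Real.exp (-(2 * c * s))) *
          ENNReal.ofReal (Real.exp (2 * c * s)) := by rw [mul_assoc, hexp, mul_one]
      _ ≤ _ := mul_le_mul' (le_iSup₂ (f := fun s (_ : s ∈ Set.Icc 0 t₀) =>
          w s * ENNReal.ofReal (Real.exp (-(2 * c * s)))) s hs) le_rfl
  have hWle : W ≤ d + W / 2 := by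
    refine iSup₂_le fun s hs => ?_
    have h1 : ∫⁻ u in Set.Ioo (0 : ℝ) s, ENNReal.ofReal c * w u
        ≤ W / 2 * ENNReal.ofReal (Real.exp (2 * c * s)) := by
      calc ∫⁻ u in Set.Ioo (0 : ℝ) s, ENNReal.ofReal c * w u
          ≤ ∫⁻ u in Set.Ioo (0 : ℝ) s,
            ENNReal.ofReal c * (W * ENNReal.ofReal (Real.exp (2 * c * u))) := by
            refine setLIntegral_mono' measurableSet_Ioo fun u hu => ?_
            exact mul_le_mul' le_rfl (hwW u ⟨hu.1.le, hu.2.le.trans hs.2⟩)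
        _ = ENNReal.ofReal c * (W *
            ∫⁻ u in Set.Ioo (0 : ℝ) s, ENNReal.ofReal (Real.exp (2 * c * u))) := by
            rw [lintegral_const_mul' _ _ ENNReal.ofReal_ne_top, lintegral_const_mul' _ _ hWtop]
        _ ≤ ENNReal.ofReal c * (W * ENNReal.ofReal (Real.exp (2 * c * s) / (2 * c))) := by
            gcongr
            exact lintegral_exp_le (by positivity) hs.1
        _ = W / 2 * ENNReal.ofReal (Real.exp (2 * c * s)) := by
            rw [mul_left_comm, ← ENNReal.ofReal_mul hc.le,
              show c * (Real.exp (2 * c * s) / (2 * c)) = Real.exp (2 * c * s) / 2 by field_simp,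
              ENNReal.ofReal_div_of_pos two_pos, ENNReal.ofReal_ofNat]
            simp only [div_eq_mul_inv]
            ring
    calc w s * ENNReal.ofReal (Real.exp (-(2 * c * s)))
        ≤ (d + W / 2 * ENNReal.ofReal (Real.exp (2 * c * s))) *
          ENNReal.ofReal (Real.exp (-(2 * c * s))) :=
          mul_le_mul' ((h s hs).trans (add_le_add le_rfl h1)) le_rfl
      _ = d * ENNReal.ofReal (Real.exp (-(2 * c * s))) + W / 2 := by
          rw [add_mul, mul_assoc (W / 2), mul_comm (ENNReal.ofReal (Real.exp (2 * c * s))), hexp,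
            mul_one]
      _ ≤ d * 1 + W / 2 := by
          gcongr
          refine ENNReal.ofReal_le_one.2 (Real.exp_le_one_iff.2 ?_)
          have := hs.1
          nlinarith
      _ = d + W / 2 := by rw [mul_one]
  have hW2 : W ≤ 2 * d := by
    have h2 : W / 2 ≠ ∞ := (ENNReal.div_lt_top hWtop (by norm_num)).ne
    have h3 : W / 2 + W / 2 ≤ d + W / 2 := by rwa [ENNReal.add_halves]
    have h4 : W / 2 ≤ d := (ENNReal.add_le_add_iff_right h2).1 h3
    calc W = W / 2 + W / 2 := (ENNReal.add_halves W).symm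
      _ ≤ d + d := add_le_add h4 h4
      _ = 2 * d := (two_mul d).symm
  exact (hwW t ht).trans (mul_le_mul' hW2 le_rfl)

variable {Ω : Type*} [mΩ : MeasurableSpace Ω] {P : Measure Ω} {ℱ : Filtration ℝ≥0 mΩ}
  {lam0 μ r : ℝ} {ν : Measure ℝ} {T S : ℕ → Ω → ℝ≥0∞} {B : ℕ → Ω → ℝ}

namespace IsMarkovianQueue

lemma measurable_weighted_momentVarL (hX : IsMarkovianQueue P ℱ lam0 μ r ν T S B)
    {χ : ℝ≥0 × Ω → ℝ≥0∞} (hχ : Measurable[ℱ.predictable] χ) (a g : ℕ) {t : ℝ} (ht : 0 ≤ t) :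
    Measurable fun ω =>
      χ (t.toNNReal, ω) * ENNReal.ofReal (momentVarL lam0 r T S B a g t ω) := by
  have := ((hχ.mul (hX.measurable_momentVarL (lam0 := lam0) a g).ennreal_ofReal).mono
    predictable_le_prod le_rfl).comp (measurable_prodMk_left (x := t.toNNReal))
  simpa only [Function.comp_def, Pi.mul_apply, Real.coe_toNNReal t ht] using this

lemma weightedMoment_cutoff_le_const [IsProbabilityMeasure P]
    (hX : IsMarkovianQueue P ℱ lam0 μ r ν T S B) (hr : 0 < r)
    (hlam0 : 0 ≤ lam0) (hgood : ∀ᵐ ω ∂P, ∀ i, S i ω ≠ ∞ → 0 < B i ω) (K : ℕ) {a g n : ℕ}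
    (hag : a + g ≤ n) {t : ℝ} (ht : 0 ≤ t) :
    weightedMoment P lam0 r T S B (cutoff T S B K) a g t
      ≤ ENNReal.ofReal ((lam0 + K + 1) ^ n) := by
  calc weightedMoment P lam0 r T S B (cutoff T S B K) a g t
      ≤ ∫⁻ _, ENNReal.ofReal ((lam0 + K + 1) ^ n) ∂P := by
        refine lintegral_mono_ae ?_
        filter_upwards [hgood] with ω hω
        by_cases hK : totalL T S B t ω ≤ K
        · rw [cutoff_of_le (by simpa only [Real.coe_toNNReal t ht] using hK), one_mul]
          refine ENNReal.ofReal_le_ofReal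
            ((momentVarL_le_of_totalL_le hlam0 hr (hX.departures ω) hω a g hK).trans ?_)
          have hK0 : (0 : ℝ) ≤ K := Nat.cast_nonneg K
          calc (K : ℝ) ^ a * (lam0 + K) ^ g
              ≤ (lam0 + K + 1) ^ a * (lam0 + K + 1) ^ g := by
                exact mul_le_mul (pow_le_pow_left₀ hK0 (by linarith) a)
                  (pow_le_pow_left₀ (by linarith) (by linarith) g) (by positivity) (by positivity)
            _ = (lam0 + K + 1) ^ (a + g) := (pow_add _ _ _).symm
            _ ≤ (lam0 + K + 1) ^ n := pow_le_pow_right₀ (by linarith) hag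
        · rw [cutoff_of_not_le (by simpa only [Real.coe_toNNReal t ht] using hK), zero_mul]
          exact zero_le
    _ = _ := by simp

lemma iSup_weightedMoment_cutoff (hX : IsMarkovianQueue P ℱ lam0 μ r ν T S B) (a g : ℕ)
    {t : ℝ} (ht : 0 ≤ t) :
    ⨆ K : ℕ, weightedMoment P lam0 r T S B (cutoff T S B K) a g t
      = weightedMoment P lam0 r T S B (fun _ => 1) a g t := by
  simp only [weightedMoment]
  have hmono : ∀ p : ℝ≥0 × Ω, Monotone fun K : ℕ => cutoff T S B K p := by
    intro p K L hKL
    refine Set.indicator_le_indicator_of_subset (fun q hq => ?_) (fun _ => zero_le) p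
    exact (show totalL T S B q.1 q.2 ≤ (K : ℝ) from hq).trans (Nat.cast_le.2 hKL)
  rw [← lintegral_iSup
    (fun K => hX.measurable_weighted_momentVarL (hX.measurable_cutoff K) a g ht)
    fun K L hKL ω => mul_le_mul' (hmono _ hKL) le_rfl]
  refine lintegral_congr fun ω => ?_
  rw [← ENNReal.iSup_mul]
  congr 1
  refine le_antisymm (iSup_le fun K => Set.indicator_le_self _ _ _) ?_
  obtain ⟨K, hK⟩ := exists_nat_ge (totalL T S B t ω)
  refine le_iSup_of_le K ?_
  rw [cutoff_of_le (by simpa only [Real.coe_toNNReal t ht] using hK)]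

/-- Grönwall is applied to the supremum of all truncated moments of order at most `n`. The
truncation level enters only the a priori bound, so the constants survive the limit in K. -/
lemma weightedMoment_one_le [IsProbabilityMeasure P] [IsProbabilityMeasure ν]
    (hX : IsMarkovianQueue P ℱ lam0 μ r ν T S B) (hμ : 0 < μ) (hr : 0 < r)
    (hlam0 : 0 ≤ lam0) (hν : ∀ᵐ x ∂ν, 0 < x) {n : ℕ}
    (hint : ∀ k ≤ n, Integrable (fun b : ℝ => b ^ k) ν) :
    ∃ c d : ℝ, 0 ≤ c ∧ 0 ≤ d ∧ ∀ a g, a + g ≤ n → ∀ t, 0 ≤ t →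
      weightedMoment P lam0 r T S B (fun _ => 1) a g t ≤ ENNReal.ofReal (d * Real.exp (c * t)) := by
  have hgood := hX.ae_mark_pos hν
  set κ : ℕ → ℕ → ℝ := fun g j => μ * ((g.choose j : ℝ) * ∫ b, b ^ (g - j) ∂ν) with hκ
  have hκ0 : ∀ g j, 0 ≤ κ g j := fun g j => mul_nonneg hμ.le (mul_nonneg (Nat.cast_nonneg _)
    (integral_nonneg_of_ae (by filter_upwards [hν] with b hb using pow_nonneg hb.le _)))
  -- Here n covers the arrival coefficient a, the double sum covers every departure coefficient, and
  -- 1 gives strict positivity.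
  set c : ℝ := n + 1 + ∑ g ∈ Finset.range (n + 1), ∑ j ∈ Finset.range g, κ g j with hc
  have hsum0 : 0 ≤ ∑ g ∈ Finset.range (n + 1), ∑ j ∈ Finset.range g, κ g j :=
    Finset.sum_nonneg fun g _ => Finset.sum_nonneg fun j _ => hκ0 g j
  have hc0 : 0 < c := by positivity
  set d : ℝ := ∑ g ∈ Finset.range (n + 1), lam0 ^ g with hd
  have hd0 : 0 ≤ d := Finset.sum_nonneg fun g _ => pow_nonneg hlam0 g
  refine ⟨2 * c, 2 * d, by positivity, by positivity, fun a g hag t ht => ?_⟩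
  rw [← hX.iSup_weightedMoment_cutoff a g ht]
  refine iSup_le fun K => ?_
  set w : ℝ → ℝ≥0∞ := fun s => ⨆ p : {p : ℕ × ℕ // p.1 + p.2 ≤ n},
    weightedMoment P lam0 r T S B (cutoff T S B K) p.1.1 p.1.2 s with hw
  have hle : ∀ a g s, a + g ≤ n →
      weightedMoment P lam0 r T S B (cutoff T S B K) a g s ≤ w s := fun a g s h =>
    le_iSup (fun p : {p : ℕ × ℕ // p.1 + p.2 ≤ n} =>
      weightedMoment P lam0 r T S B (cutoff T S B K) p.1.1 p.1.2 s) ⟨(a, g), h⟩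
  have hbound : ∀ s ∈ Set.Icc 0 t, w s ≤ ENNReal.ofReal ((lam0 + K + 1) ^ n) := fun s hs =>
    iSup_le fun p => hX.weightedMoment_cutoff_le_const hr hlam0 hgood K p.2 hs.1
  have hineq : ∀ s ∈ Set.Icc 0 t, w s ≤ ENNReal.ofReal d
      + ∫⁻ u in Set.Ioo (0 : ℝ) s, ENNReal.ofReal c * w u := by
    intro s hs
    refine iSup_le fun ⟨⟨a, g⟩, h⟩ => ?_
    simp only at h ⊢
    have hg : g ∈ Finset.range (n + 1) := Finset.mem_range.2 (by omega)
    refine (hX.weightedMoment_cutoff_le hμ hr hlam0 hgood hν K a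
      (fun k hk => hint k (by omega)) hs.1).trans ?_
    rw [add_assoc]
    refine add_le_add (ENNReal.ofReal_le_ofReal ?_) ?_
    · have h0 : ((0 : ℕ).descFactorial a : ℝ) ≤ 1 := by
        rcases a with _ | a <;> simp
      calc ((0 : ℕ).descFactorial a : ℝ) * lam0 ^ g ≤ 1 * lam0 ^ g := by gcongr
        _ ≤ d := by
          rw [one_mul]
          exact Finset.single_le_sum (f := fun g => lam0 ^ g) (fun g _ => pow_nonneg hlam0 g) hg
    · have h1 : ∫⁻ u in Set.Ioo (0 : ℝ) s, ENNReal.ofReal a *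
          weightedMoment P lam0 r T S B (cutoff T S B K) (a - 1) (g + 1) u
          ≤ ENNReal.ofReal a * ∫⁻ u in Set.Ioo (0 : ℝ) s, w u := by
        rw [lintegral_const_mul' _ _ ENNReal.ofReal_ne_top]
        -- For a = 0 the moment (a - 1, g + 1) may have order n + 1, but its coefficient is zero.
        rcases a with _ | a
        · simp
        · gcongr with u
          exact hle _ _ _ (by omega)
      have h2 : ∫⁻ u in Set.Ioo (0 : ℝ) s, ∑ j ∈ Finset.range g, ENNReal.ofReal (κ g j) *
            weightedMoment P lam0 r T S B (cutoff T S B K) (a + 1) j u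
          ≤ ENNReal.ofReal (∑ j ∈ Finset.range g, κ g j) * ∫⁻ u in Set.Ioo (0 : ℝ) s, w u := by
        rw [← lintegral_const_mul' _ _ ENNReal.ofReal_ne_top]
        refine lintegral_mono fun u => ?_
        rw [ENNReal.ofReal_sum_of_nonneg fun j _ => hκ0 g j, Finset.sum_mul]
        refine Finset.sum_le_sum fun j hj => mul_le_mul' le_rfl (hle _ _ _ ?_)
        have := Finset.mem_range.1 hj
        omega
      refine (add_le_add h1 h2).trans ?_
      rw [lintegral_const_mul' _ _ ENNReal.ofReal_ne_top, ← add_mul,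
        ← ENNReal.ofReal_add (Nat.cast_nonneg a) (Finset.sum_nonneg fun j _ => hκ0 g j)]
      refine mul_le_mul' (ENNReal.ofReal_le_ofReal ?_) le_rfl
      have ha : (a : ℝ) ≤ n := by exact_mod_cast (by omega : a ≤ n)
      have := Finset.single_le_sum (f := fun g => ∑ j ∈ Finset.range g, κ g j)
        (fun g _ => Finset.sum_nonneg fun j _ => hκ0 g j) hg
      linarith
  have := ennreal_gronwall hc0 ENNReal.ofReal_ne_top hbound hineq ⟨ht, le_rfl⟩
  refine (hle a g t hag).trans (this.trans (le_of_eq ?_))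
  rw [ENNReal.ofReal_mul (by positivity), ENNReal.ofReal_mul zero_le_two]
  simp

end IsMarkovianQueue

end Finiteness

/-! ### Absence of fixed jump times, and the exact moment identity. -/

section MomentODE

/-- The primitive of a function that is locally integrable on `[0, ∞)` is continuous there. -/
lemma continuousOn_primitive_Ici {f : ℝ → ℝ}
    (hf : ∀ t, 0 ≤ t → IntervalIntegrable f volume 0 t) :
    ContinuousOn (fun t => ∫ s in (0 : ℝ)..t, f s) (Set.Ici 0) := by
  intro t ht
  have ht' : (0 : ℝ) ≤ t := ht
  have h := intervalIntegral.continuousOn_primitive_interval' (hf (t + 1) (by linarith))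
    Set.left_mem_uIcc
  rw [Set.uIcc_of_le (by linarith)] at h
  refine (h t ⟨ht, by linarith⟩).mono_of_mem_nhdsWithin ?_
  rw [mem_nhdsWithin]
  exact ⟨Set.Iio (t + 1), isOpen_Iio, by simp, fun x hx => ⟨hx.2, (le_of_lt hx.1)⟩⟩

lemma hasDerivWithinAt_primitive_Ici {f : ℝ → ℝ} (hf : ContinuousOn f (Set.Ici 0)) {t : ℝ}
    (ht : 0 ≤ t) : HasDerivWithinAt (fun t => ∫ s in (0 : ℝ)..t, f s) (f t) (Set.Ici 0) t := by
  -- Extending `f` by its value at 0 gives a continuous function on ℝ, so the derivative at the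
  -- endpoint 0 needs no separate case.
  set φ : ℝ → ℝ := fun s => f (max s 0) with hφ
  have hc : Continuous φ :=
    hf.comp_continuous (continuous_id.max continuous_const) fun s =>
      (le_max_right s 0 : (0 : ℝ) ≤ max s 0)
  have h := (intervalIntegral.integral_hasDerivAt_right (hc.intervalIntegrable 0 t)
    (hc.stronglyMeasurableAtFilter _ _) hc.continuousAt).hasDerivWithinAt (s := Set.Ici 0)
  have heq : ∀ u, 0 ≤ u → ∫ s in (0 : ℝ)..u, f s = ∫ s in (0 : ℝ)..u, φ s := fun u hu =>
    intervalIntegral.integral_congr fun s hs => by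
      rw [Set.uIcc_of_le hu] at hs
      simp [hφ, max_eq_left hs.1]
  have h0 : φ t = f t := by simp [hφ, max_eq_left ht]
  rw [h0] at h
  exact h.congr (fun u hu => heq u hu) (heq t ht)

variable {Ω : Type*} [mΩ : MeasurableSpace Ω] {P : Measure Ω} {ℱ : Filtration ℝ≥0 mΩ}
  {lam0 μ r : ℝ} {ν : Measure ℝ} {T S : ℕ → Ω → ℝ≥0∞} {B : ℕ → Ω → ℝ}

namespace IsMarkovianQueue

/-- The compensator has a density in time, so testing with the indicator of the single instant `t`
gives zero. Hence left limits and values agree almost surely at each fixed time. -/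
lemma measure_arrival_eq [IsProbabilityMeasure P] (hX : IsMarkovianQueue P ℱ lam0 μ r ν T S B)
    (i : ℕ) {t : ℝ} (ht : 0 ≤ t) : P {ω | T i ω = ENNReal.ofReal t} = 0 := by
  set f : ℝ≥0 × Ω → ℝ≥0∞ := fun p => ({t.toNNReal} : Set ℝ≥0).indicator (fun _ => 1) p.1
  have hf : Measurable[ℱ.predictable] f :=
    (measurable_const.indicator (measurableSet_singleton _)).comp measurable_time
  have h := hX.lintegral_arrivals hf (t + 1)
  have h0 : ∫⁻ s in Set.Ioo (0 : ℝ) (t + 1),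
      (∫⁻ ω, f (s.toNNReal, ω) * ENNReal.ofReal (intensity lam0 r S B s ω) ∂P) = 0 := by
    rw [← lintegral_zero]
    refine lintegral_congr_ae ?_
    have hne : ∀ᵐ s ∂(volume.restrict (Set.Ioo (0 : ℝ) (t + 1))), s ≠ t :=
      ae_restrict_of_ae (by simp [ae_iff])
    filter_upwards [hne, ae_restrict_mem measurableSet_Ioo] with s hs hs0
    have : s.toNNReal ≠ t.toNNReal := fun h => hs ((Real.toNNReal_eq_toNNReal_iff hs0.1.le ht).1 h)
    simp [f, this]
  rw [h0] at h
  have hmeas : MeasurableSet {ω | T i ω = ENNReal.ofReal t} :=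
    measurableSet_eq_fun (hX.measurable_arrival i) measurable_const
  refine le_antisymm ?_ zero_le
  rw [← h, ← lintegral_indicator_one hmeas]
  refine lintegral_mono fun ω => ?_
  by_cases hω' : T i ω = ENNReal.ofReal t
  swap
  · rw [Set.indicator_of_notMem (by simpa using hω')]
    exact zero_le
  rw [Set.indicator_of_mem (by simpa using hω'), Pi.one_apply]
  have hi : i ∈ Finset.range (countL (fun i => T i ω) (t + 1)) := by
    rw [Finset.mem_range, (hX.arrivals ω).lt_countL_iff, hω']
    exact (ENNReal.ofReal_lt_ofReal_iff (by linarith)).2 (by linarith)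
  refine le_trans ?_ (Finset.single_le_sum (f := fun i => f ((T i ω).toNNReal, ω))
    (fun _ _ => zero_le) hi)
  simp [f, hω', ENNReal.ofReal]

lemma measure_departure_eq [IsProbabilityMeasure P] [SFinite ν]
    (hX : IsMarkovianQueue P ℱ lam0 μ r ν T S B)
    (i : ℕ) {t : ℝ} (ht : 0 ≤ t) : P {ω | S i ω = ENNReal.ofReal t} = 0 := by
  set f : (ℝ≥0 × Ω) × ℝ → ℝ≥0∞ := fun p => ({t.toNNReal} : Set ℝ≥0).indicator (fun _ => 1) p.1.1
  have hf : Measurable[ℱ.predictable.prod Real.measurableSpace] f :=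
    ((measurable_const.indicator (measurableSet_singleton _)).comp measurable_time).comp
      (@measurable_fst _ _ ℱ.predictable Real.measurableSpace)
  have h := hX.lintegral_departures hf (t + 1)
  have h0 : ∫⁻ s in Set.Ioo (0 : ℝ) (t + 1),
      (∫⁻ ω, (∫⁻ b, f ((s.toNNReal, ω), b) ∂ν) * ENNReal.ofReal (μ * queueL T S s ω) ∂P) = 0 := by
    rw [← lintegral_zero]
    refine lintegral_congr_ae ?_
    have hne : ∀ᵐ s ∂(volume.restrict (Set.Ioo (0 : ℝ) (t + 1))), s ≠ t :=
      ae_restrict_of_ae (by simp [ae_iff])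
    filter_upwards [hne, ae_restrict_mem measurableSet_Ioo] with s hs hs0
    have : s.toNNReal ≠ t.toNNReal := fun h => hs ((Real.toNNReal_eq_toNNReal_iff hs0.1.le ht).1 h)
    simp [f, this]
  rw [h0] at h
  have hmeas : MeasurableSet {ω | S i ω = ENNReal.ofReal t} :=
    measurableSet_eq_fun (hX.measurable_departure i) measurable_const
  refine le_antisymm ?_ zero_le
  rw [← h, ← lintegral_indicator_one hmeas]
  refine lintegral_mono fun ω => ?_
  by_cases hω' : S i ω = ENNReal.ofReal t
  swap
  · rw [Set.indicator_of_notMem (by simpa using hω')]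
    exact zero_le
  rw [Set.indicator_of_mem (by simpa using hω'), Pi.one_apply]
  have hi : i ∈ Finset.range (countL (fun i => S i ω) (t + 1)) := by
    rw [Finset.mem_range, (hX.departures ω).lt_countL_iff, hω']
    exact (ENNReal.ofReal_lt_ofReal_iff (by linarith)).2 (by linarith)
  refine le_trans ?_ (Finset.single_le_sum (f := fun i => f (((S i ω).toNNReal, ω), B i ω))
    (fun _ _ => zero_le) hi)
  simp [f, hω', ENNReal.ofReal]

lemma momentVar_ae_eq [IsProbabilityMeasure P] [SFinite ν]
    (hX : IsMarkovianQueue P ℱ lam0 μ r ν T S B) (q g : ℕ) {t : ℝ} (ht : 0 ≤ t) :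
    momentVar lam0 r T S B q g t =ᵐ[P] momentVarL lam0 r T S B q g t := by
  have h1 : ∀ᵐ ω ∂P, ∀ i, T i ω ≠ ENNReal.ofReal t :=
    ae_all_iff.2 fun i => by simpa [ae_iff] using hX.measure_arrival_eq i ht
  have h2 : ∀ᵐ ω ∂P, ∀ i, S i ω ≠ ENNReal.ofReal t :=
    ae_all_iff.2 fun i => by simpa [ae_iff] using hX.measure_departure_eq i ht
  filter_upwards [h1, h2] with ω h1 h2
  rw [momentVar, momentVarL, queue, queueL, (hX.arrivals ω).count_eq_countL h1,
    (hX.departures ω).count_eq_countL h2]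

lemma measurable_momentVarL_apply (hX : IsMarkovianQueue P ℱ lam0 μ r ν T S B)
    (a g : ℕ) {t : ℝ} (ht : 0 ≤ t) : Measurable (momentVarL lam0 r T S B a g t) := by
  have := ((hX.measurable_momentVarL (lam0 := lam0) a g).mono
    predictable_le_prod le_rfl).comp (measurable_prodMk_left (x := t.toNNReal))
  simpa only [Function.comp_def, Real.coe_toNNReal t ht] using this

lemma aemeasurable_weightedMoment [IsProbabilityMeasure P]
    (hX : IsMarkovianQueue P ℱ lam0 μ r ν T S B) (a g : ℕ) (t : ℝ) :
    AEMeasurable (weightedMoment P lam0 r T S B (fun _ => 1) a g)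
      (volume.restrict (Set.Ioo 0 t)) := by
  have h1 : Measurable fun p : ℝ≥0 × Ω =>
      ENNReal.ofReal (momentVarL lam0 r T S B a g p.1 p.2) :=
    (hX.measurable_momentVarL a g).ennreal_ofReal.mono predictable_le_prod le_rfl
  have h2 := (h1.lintegral_prod_right' (ν := P)).comp measurable_real_toNNReal
  refine h2.aemeasurable.congr ?_
  filter_upwards [ae_restrict_mem measurableSet_Ioo] with s hs
  simp [weightedMoment, Real.coe_toNNReal s hs.1.le]

/-- The moment equation in integrated form, between extended nonnegative reals. -/
lemma weightedMoment_identity [IsProbabilityMeasure P] [IsProbabilityMeasure ν]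
    (hX : IsMarkovianQueue P ℱ lam0 μ r ν T S B) (hμ : 0 < μ) (hr : 0 < r)
    (hlam0 : 0 ≤ lam0) (hν : ∀ᵐ x ∂ν, 0 < x) (a : ℕ) {g : ℕ}
    (hint : ∀ k ≤ g, Integrable (fun b : ℝ => b ^ k) ν) {t : ℝ} (ht : 0 ≤ t) :
    weightedMoment P lam0 r T S B (fun _ => 1) a g t
      + ((∫⁻ s in Set.Ioo (0 : ℝ) t,
          ENNReal.ofReal (r * g) * weightedMoment P lam0 r T S B (fun _ => 1) a g s)
        + ∫⁻ s in Set.Ioo (0 : ℝ) t,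
          ENNReal.ofReal (a * μ) * weightedMoment P lam0 r T S B (fun _ => 1) a g s)
      = ENNReal.ofReal (((0 : ℕ).descFactorial a : ℝ) * lam0 ^ g)
        + ((∫⁻ s in Set.Ioo (0 : ℝ) t,
          ENNReal.ofReal a * weightedMoment P lam0 r T S B (fun _ => 1) (a - 1) (g + 1) s)
        + ∫⁻ s in Set.Ioo (0 : ℝ) t, ∑ j ∈ Finset.range g,
          ENNReal.ofReal (μ * ((g.choose j : ℝ) * ∫ b, b ^ (g - j) ∂ν)) *
            weightedMoment P lam0 r T S B (fun _ => 1) (a + 1) j s)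
        + ∫⁻ s in Set.Ioo (0 : ℝ) t,
          ENNReal.ofReal (r * g * lam0) *
            weightedMoment P lam0 r T S B (fun _ => 1) a (g - 1) s := by
  have hgood := hX.ae_mark_pos hν
  have hone : Measurable[ℱ.predictable] (fun _ : ℝ≥0 × Ω => (1 : ℝ≥0∞)) := measurable_const
  set D : ℝ≥0 × Ω → ℝ≥0∞ := fun p => ENNReal.ofReal (r * g * (((queueL T S p.1 p.2).descFactorial a
    : ℝ) * intensity lam0 r S B p.1 p.2 ^ (g - 1) * (intensity lam0 r S B p.1 p.2 - lam0))) with hD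
  have hDm : Measurable D :=
    (hX.measurable_of_queueL_intensity (fun Q x => ENNReal.ofReal (r * g * ((Q.descFactorial a : ℝ)
      * x ^ (g - 1) * (x - lam0)))) fun _ => by fun_prop).mono predictable_le_prod le_rfl
  -- This is gΛ^{g-1}(Λ-λ₀) + gλ₀Λ^{g-1} = gΛ^g, stated additively because [0,∞] has no genuine
  -- subtraction.
  have hdrift : (∫⁻ ω, (∫⁻ s in Set.Ioo (0 : ℝ) t, D (s.toNNReal, ω)) ∂P)
      + (∫⁻ s in Set.Ioo (0 : ℝ) t,
          ENNReal.ofReal (r * g * lam0) *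
            weightedMoment P lam0 r T S B (fun _ => 1) a (g - 1) s)
      = ∫⁻ s in Set.Ioo (0 : ℝ) t,
          ENNReal.ofReal (r * g) * weightedMoment P lam0 r T S B (fun _ => 1) a g s := by
    rw [lintegral_lintegral_Ioo_swap hDm,
      ← lintegral_add_right' _ ((hX.aemeasurable_weightedMoment a (g - 1) t).const_mul _)]
    refine setLIntegral_congr_fun measurableSet_Ioo fun s hs => ?_
    simp only [weightedMoment]
    rw [← lintegral_const_mul' _ _ ENNReal.ofReal_ne_top,
      ← lintegral_const_mul' _ _ ENNReal.ofReal_ne_top, ← lintegral_add_right _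
        ((hX.measurable_weighted_momentVarL hone a (g - 1) hs.1.le).const_mul _)]
    refine lintegral_congr_ae ?_
    filter_upwards [hgood] with ω hω
    have h1 := intensity_ge (lam0 := lam0) (r := r) (hX.departures ω) hω s
    have h2 := hlam0.trans h1
    have h3 := sub_nonneg.2 h1
    simp only [hD, one_mul, Real.coe_toNNReal s hs.1.le]
    rw [← ENNReal.ofReal_mul (by positivity), ← ENNReal.ofReal_mul (by positivity),
      ← ENNReal.ofReal_add (by positivity)
        (mul_nonneg (by positivity) (momentVarL_nonneg hlam0 (hX.departures ω) hω _ _ _))]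
    congr 1
    rcases g with _ | g
    · simp
    · simp only [momentVarL, Nat.add_sub_cancel]
      ring
  rw [← hdrift, ← hX.departures_loss_term hμ hlam0 hgood a g t, ← hX.departures_gain_term hμ hlam0
    hgood hν hone a hint t, ← hX.arrivals_term hlam0 hgood hone a g t, weightedMoment,
    add_right_comm (∫⁻ ω, (∫⁻ s in Set.Ioo (0 : ℝ) t, D (s.toNNReal, ω)) ∂P), ← add_assoc]
  congr 1
  have hm := hX.measurable_arrivals_term (lam0 := lam0) hone a g t
  have hDm' : Measurable fun ω => ∫⁻ s in Set.Ioo (0 : ℝ) t, D (s.toNNReal, ω) :=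
    Measurable.lintegral_prod_right' (f := fun z : Ω × ℝ => D (z.2.toNNReal, z.1))
      (hDm.comp ((measurable_real_toNNReal.comp measurable_snd).prodMk measurable_fst))
  rw [← lintegral_add_left hm, ← lintegral_add_left hDm',
    ← lintegral_add_left (hX.measurable_weighted_momentVarL hone a g ht)]
  conv_rhs => rw [← one_mul (ENNReal.ofReal (_ * lam0 ^ g)), ← measure_univ (μ := P), mul_comm,
    ← lintegral_const, ← lintegral_add_left measurable_const]
  refine lintegral_congr_ae ?_
  filter_upwards [hgood] with ω hω
  simp only [one_mul, measure_univ]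
  have hΛ : ∀ s, 0 ≤ intensity lam0 r S B s ω := fun s =>
    hlam0.trans (intensity_ge (hX.departures ω) hω s)
  obtain ⟨hpi, hpath⟩ := momentVarL_path (lam0 := lam0) (r := r) (B := B) (hX.arrivals ω)
    (hX.departures ω) (hX.departures_le_arrivals ω) (hX.no_common_jump ω) a g ht
  have hdn : ∀ u, 0 ≤ r * g * (((queueL T S u ω).descFactorial a : ℝ) *
        intensity lam0 r S B u ω ^ (g - 1) * (intensity lam0 r S B u ω - lam0)) := fun u => by
    have := sub_nonneg.2 (intensity_ge (lam0 := lam0) (r := r) (hX.departures ω) hω u)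
    have := hΛ u
    positivity
  have hDeq : ∫⁻ s in Set.Ioo (0 : ℝ) t, D (s.toNNReal, ω)
      = ENNReal.ofReal (∫ u in (0 : ℝ)..t, r * g * (((queueL T S u ω).descFactorial a : ℝ) *
        intensity lam0 r S B u ω ^ (g - 1) * (intensity lam0 r S B u ω - lam0))) := by
    rw [intervalIntegral.integral_of_le ht, ofReal_integral_eq_lintegral_ofReal
      ((intervalIntegrable_iff_integrableOn_Ioc_of_le ht).1 hpi) (ae_of_all _ hdn),
      setLIntegral_congr Ioo_ae_eq_Ioc.symm]
    refine setLIntegral_congr_fun measurableSet_Ioo fun s hs => ?_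
    simp only [hD, Real.coe_toNNReal s hs.1.le]
  have hTn : ∀ i ∈ Finset.range (countL (fun i => T i ω) t),
      0 ≤ a * momentVarL lam0 r T S B (a - 1) g (T i ω).toReal ω := fun i _ =>
    mul_nonneg (Nat.cast_nonneg _) (momentVarL_nonneg hlam0 (hX.departures ω) hω _ _ _)
  have hSn : ∀ i ∈ Finset.range (countL (fun i => S i ω) t),
      0 ≤ ((queueL T S (S i ω).toReal ω - 1).descFactorial a : ℝ) *
            ((intensity lam0 r S B (S i ω).toReal ω + B i ω) ^ g
              - intensity lam0 r S B (S i ω).toReal ω ^ g) := fun i hi =>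
    mul_nonneg (Nat.cast_nonneg _) (sub_nonneg.2 (pow_le_pow_left₀ (hΛ _)
      (le_add_of_nonneg_right (hω i ((((hX.departures ω).lt_countL_iff t i).1
        (Finset.mem_range.1 hi)).trans ENNReal.ofReal_lt_top).ne).le) g))
  have hLn : ∀ i ∈ Finset.range (countL (fun i => S i ω) t),
      0 ≤ a * (((queueL T S (S i ω).toReal ω - 1).descFactorial (a - 1) : ℝ) *
            intensity lam0 r S B (S i ω).toReal ω ^ g) := fun i _ => by
    have := hΛ (S i ω).toReal
    positivity
  rw [hDeq, ← ENNReal.ofReal_sum_of_nonneg hTn, ← ENNReal.ofReal_sum_of_nonneg hSn,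
    ← ENNReal.ofReal_sum_of_nonneg hLn,
    ← ENNReal.ofReal_add (Finset.sum_nonneg hTn) (Finset.sum_nonneg hSn),
    ← ENNReal.ofReal_add (by positivity)
      (add_nonneg (Finset.sum_nonneg hTn) (Finset.sum_nonneg hSn)),
    ← ENNReal.ofReal_add (intervalIntegral.integral_nonneg ht fun u _ => hdn u)
      (Finset.sum_nonneg hLn),
    ← ENNReal.ofReal_add (momentVarL_nonneg hlam0 (hX.departures ω) hω _ _ _)
      (add_nonneg (intervalIntegral.integral_nonneg ht fun u _ => hdn u) (Finset.sum_nonneg hLn))]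
  congr 1
  linarith

end IsMarkovianQueue

end MomentODE

/-! ### Real-valued moments: integral equation, continuity, derivative. -/

namespace IsMarkovianQueue

section RealMoments

variable {Ω : Type*} [mΩ : MeasurableSpace Ω] {P : Measure Ω} {ℱ : Filtration ℝ≥0 mΩ}
  {lam0 μ r : ℝ} {ν : Measure ℝ} {T S : ℕ → Ω → ℝ≥0∞} {B : ℕ → Ω → ℝ}
  [IsProbabilityMeasure P] [IsProbabilityMeasure ν]

lemma moment_nonneg (hX : IsMarkovianQueue P ℱ lam0 μ r ν T S B) (hlam0 : 0 ≤ lam0)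
    (hν : ∀ᵐ x ∂ν, 0 < x) (q g : ℕ) {t : ℝ} (ht : 0 ≤ t) : 0 ≤ moment P lam0 r T S B q g t := by
  refine integral_nonneg_of_ae ?_
  filter_upwards [hX.momentVar_ae_eq q g ht, hX.ae_mark_pos hν] with ω h1 h2
  rw [h1]
  exact momentVarL_nonneg hlam0 (hX.departures ω) h2 _ _ _

lemma integrable_momentVar (hX : IsMarkovianQueue P ℱ lam0 μ r ν T S B) (hμ : 0 < μ) (hr : 0 < r)
    (hlam0 : 0 ≤ lam0) (hν : ∀ᵐ x ∂ν, 0 < x) {n : ℕ}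
    (hint : ∀ k ≤ n, Integrable (fun b : ℝ => b ^ k) ν) {q g : ℕ} (hqg : q + g ≤ n) {t : ℝ}
    (ht : 0 ≤ t) : Integrable (momentVar lam0 r T S B q g t) P := by
  refine Integrable.congr ?_ (hX.momentVar_ae_eq q g ht).symm
  refine ⟨(hX.measurable_momentVarL_apply q g ht).aestronglyMeasurable, ?_⟩
  obtain ⟨c, d, -, -, h⟩ := hX.weightedMoment_one_le hμ hr hlam0 hν hint
  have h1 := (h q g hqg t ht).trans_lt ENNReal.ofReal_lt_top
  rw [hasFiniteIntegral_iff_ofReal]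
  · simpa [weightedMoment] using h1
  · filter_upwards [hX.ae_mark_pos hν] with ω hω
    exact momentVarL_nonneg hlam0 (hX.departures ω) hω _ _ _

lemma ofReal_moment (hX : IsMarkovianQueue P ℱ lam0 μ r ν T S B) (hμ : 0 < μ) (hr : 0 < r)
    (hlam0 : 0 ≤ lam0) (hν : ∀ᵐ x ∂ν, 0 < x) {n : ℕ}
    (hint : ∀ k ≤ n, Integrable (fun b : ℝ => b ^ k) ν) {q g : ℕ} (hqg : q + g ≤ n) {t : ℝ}
    (ht : 0 ≤ t) : ENNReal.ofReal (moment P lam0 r T S B q g t)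
      = weightedMoment P lam0 r T S B (fun _ => 1) q g t := by
  rw [moment, ofReal_integral_eq_lintegral_ofReal
    (hX.integrable_momentVar hμ hr hlam0 hν hint hqg ht)]
  · refine lintegral_congr_ae ?_
    filter_upwards [hX.momentVar_ae_eq q g ht] with ω h1
    rw [h1, one_mul]
  · filter_upwards [hX.momentVar_ae_eq q g ht, hX.ae_mark_pos hν] with ω h1 h2
    rw [h1]
    exact momentVarL_nonneg hlam0 (hX.departures ω) h2 _ _ _

lemma intervalIntegrable_moment (hX : IsMarkovianQueue P ℱ lam0 μ r ν T S B) (hμ : 0 < μ)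
    (hr : 0 < r) (hlam0 : 0 ≤ lam0) (hν : ∀ᵐ x ∂ν, 0 < x) {n : ℕ}
    (hint : ∀ k ≤ n, Integrable (fun b : ℝ => b ^ k) ν) {q g : ℕ} (hqg : q + g ≤ n) {t : ℝ}
    (ht : 0 ≤ t) : IntervalIntegrable (moment P lam0 r T S B q g) volume 0 t := by
  rw [intervalIntegrable_iff_integrableOn_Ioo_of_le ht]
  obtain ⟨c, d, hc, hd, h⟩ := hX.weightedMoment_one_le hμ hr hlam0 hν hint
  have hm : AEStronglyMeasurable (moment P lam0 r T S B q g) (volume.restrict (Set.Ioo 0 t)) := by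
    refine ((hX.aemeasurable_weightedMoment (lam0 := lam0) q g t).ennreal_toReal.congr
      ?_).aestronglyMeasurable
    filter_upwards [ae_restrict_mem measurableSet_Ioo] with s hs
    rw [← hX.ofReal_moment hμ hr hlam0 hν hint hqg hs.1.le,
      ENNReal.toReal_ofReal (hX.moment_nonneg hlam0 hν q g hs.1.le)]
  refine Integrable.mono' (g := fun _ => d * Real.exp (c * t))
    (integrableOn_const (by simp)) hm ?_
  filter_upwards [ae_restrict_mem measurableSet_Ioo] with s hs
  rw [Real.norm_of_nonneg (hX.moment_nonneg hlam0 hν q g hs.1.le)]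
  have h1 := h q g hqg s hs.1.le
  rw [← hX.ofReal_moment hμ hr hlam0 hν hint hqg hs.1.le,
    ENNReal.ofReal_le_ofReal_iff (by positivity)] at h1
  refine h1.trans ?_
  have := hs.2.le
  gcongr

lemma setLIntegral_weightedMoment (hX : IsMarkovianQueue P ℱ lam0 μ r ν T S B) (hμ : 0 < μ)
    (hr : 0 < r) (hlam0 : 0 ≤ lam0) (hν : ∀ᵐ x ∂ν, 0 < x) {n : ℕ}
    (hint : ∀ k ≤ n, Integrable (fun b : ℝ => b ^ k) ν) {q g : ℕ} (hqg : q + g ≤ n) {t : ℝ}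
    (ht : 0 ≤ t) {κ : ℝ} (hκ : 0 ≤ κ) :
    ∫⁻ s in Set.Ioo (0 : ℝ) t,
      ENNReal.ofReal κ * weightedMoment P lam0 r T S B (fun _ => 1) q g s
      = ENNReal.ofReal (κ * ∫ s in (0 : ℝ)..t, moment P lam0 r T S B q g s) := by
  rw [lintegral_const_mul' _ _ ENNReal.ofReal_ne_top, ENNReal.ofReal_mul hκ]
  congr 1
  rw [intervalIntegral.integral_of_le ht, integral_Ioc_eq_integral_Ioo,
    ofReal_integral_eq_lintegral_ofReal ((intervalIntegrable_iff_integrableOn_Ioo_of_le ht).1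
      (hX.intervalIntegrable_moment hμ hr hlam0 hν hint hqg ht))]
  · exact setLIntegral_congr_fun measurableSet_Ioo fun s hs =>
      (hX.ofReal_moment hμ hr hlam0 hν hint hqg hs.1.le).symm
  · filter_upwards [ae_restrict_mem measurableSet_Ioo] with s hs
    exact hX.moment_nonneg hlam0 hν q g hs.1.le

/-- The moment equation in integrated form. -/
lemma moment_eq_integral (hX : IsMarkovianQueue P ℱ lam0 μ r ν T S B) (hμ : 0 < μ)
    (hr : 0 < r) (hlam0 : 0 ≤ lam0) (hν : ∀ᵐ x ∂ν, 0 < x) {n : ℕ}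
    (hint : ∀ k ≤ n, Integrable (fun b : ℝ => b ^ k) ν) {a g : ℕ} (hag : a + g ≤ n) {t : ℝ}
    (ht : 0 ≤ t) : moment P lam0 r T S B a g t = ((0 : ℕ).descFactorial a : ℝ) * lam0 ^ g
      + a * (∫ s in (0 : ℝ)..t, moment P lam0 r T S B (a - 1) (g + 1) s)
      + ∑ j ∈ Finset.range g, μ * ((g.choose j : ℝ) * ∫ b, b ^ (g - j) ∂ν) *
          (∫ s in (0 : ℝ)..t, moment P lam0 r T S B (a + 1) j s)
      + r * g * lam0 * (∫ s in (0 : ℝ)..t, moment P lam0 r T S B a (g - 1) s)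
      - (r * g + a * μ) * ∫ s in (0 : ℝ)..t, moment P lam0 r T S B a g s := by
  have hid := hX.weightedMoment_identity hμ hr hlam0 hν a (g := g) (fun k hk => hint k (by omega)) ht
  have hκ : ∀ j, 0 ≤ μ * ((g.choose j : ℝ) * ∫ b, b ^ (g - j) ∂ν) := fun j =>
    mul_nonneg hμ.le (mul_nonneg (Nat.cast_nonneg _)
      (integral_nonneg_of_ae (by filter_upwards [hν] with b hb using pow_nonneg hb.le _)))
  have hJ : ∀ q g, 0 ≤ ∫ s in (0 : ℝ)..t, moment P lam0 r T S B q g s := fun q g =>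
    intervalIntegral.integral_nonneg ht fun s hs => hX.moment_nonneg hlam0 hν q g hs.1
  have h1 : ∫⁻ s in Set.Ioo (0 : ℝ) t,
      ENNReal.ofReal a * weightedMoment P lam0 r T S B (fun _ => 1) (a - 1) (g + 1) s
      = ENNReal.ofReal (a * ∫ s in (0 : ℝ)..t, moment P lam0 r T S B (a - 1) (g + 1) s) := by
    -- For a = 0 the moment (0, g + 1) need not be controlled: both sides carry the factor 0.
    rcases a with _ | a
    · simp
    · exact hX.setLIntegral_weightedMoment hμ hr hlam0 hν hint (by omega) ht (Nat.cast_nonneg _)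
  have h2 : ∫⁻ s in Set.Ioo (0 : ℝ) t, ∑ j ∈ Finset.range g,
      ENNReal.ofReal (μ * ((g.choose j : ℝ) * ∫ b, b ^ (g - j) ∂ν)) *
        weightedMoment P lam0 r T S B (fun _ => 1) (a + 1) j s
      = ENNReal.ofReal (∑ j ∈ Finset.range g, μ * ((g.choose j : ℝ) * ∫ b, b ^ (g - j) ∂ν) *
          (∫ s in (0 : ℝ)..t, moment P lam0 r T S B (a + 1) j s)) := by
    rw [lintegral_finsetSum' _ fun j _ =>
      (hX.aemeasurable_weightedMoment (a + 1) j t).const_mul _,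
      ENNReal.ofReal_sum_of_nonneg fun j _ => mul_nonneg (hκ j) (hJ _ _)]
    refine Finset.sum_congr rfl fun j hj => ?_
    have := Finset.mem_range.1 hj
    exact hX.setLIntegral_weightedMoment hμ hr hlam0 hν hint (by omega) ht (hκ j)
  rw [h1, h2, ← hX.ofReal_moment hμ hr hlam0 hν hint hag ht,
    hX.setLIntegral_weightedMoment hμ hr hlam0 hν hint hag ht (by positivity),
    hX.setLIntegral_weightedMoment hμ hr hlam0 hν hint hag ht (by positivity),
    hX.setLIntegral_weightedMoment hμ hr hlam0 hν hint (by omega) ht (by positivity)] at hid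
  have hm := hX.moment_nonneg hlam0 hν a g ht
  have n1 := mul_nonneg (by positivity : (0 : ℝ) ≤ r * g) (hJ a g)
  have n2 := mul_nonneg (by positivity : (0 : ℝ) ≤ a * μ) (hJ a g)
  have n3 := mul_nonneg (Nat.cast_nonneg a) (hJ (a - 1) (g + 1))
  have n4 := Finset.sum_nonneg fun j (_ : j ∈ Finset.range g) => mul_nonneg (hκ j) (hJ (a + 1) j)
  have n5 := mul_nonneg (by positivity : (0 : ℝ) ≤ r * g * lam0) (hJ a (g - 1))
  have n6 : (0 : ℝ) ≤ ((0 : ℕ).descFactorial a : ℝ) * lam0 ^ g := by positivity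
  rw [← ENNReal.ofReal_add n1 n2, ← ENNReal.ofReal_add hm (add_nonneg n1 n2),
    ← ENNReal.ofReal_add n3 n4, ← ENNReal.ofReal_add n6 (add_nonneg n3 n4),
    ← ENNReal.ofReal_add (add_nonneg n6 (add_nonneg n3 n4)) n5,
    ENNReal.ofReal_eq_ofReal_iff (add_nonneg hm (add_nonneg n1 n2))
      (add_nonneg (add_nonneg n6 (add_nonneg n3 n4)) n5)] at hid
  linarith

/-- Bootstrap: the integral equation writes a moment through primitives of locally integrable
moments, so it is continuous; the same equation can then be differentiated. -/
lemma continuousOn_moment (hX : IsMarkovianQueue P ℱ lam0 μ r ν T S B) (hμ : 0 < μ)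
    (hr : 0 < r) (hlam0 : 0 ≤ lam0) (hν : ∀ᵐ x ∂ν, 0 < x) {n : ℕ}
    (hint : ∀ k ≤ n, Integrable (fun b : ℝ => b ^ k) ν) {a g : ℕ} (hag : a + g ≤ n) :
    ContinuousOn (moment P lam0 r T S B a g) (Set.Ici 0) := by
  have hJ : ∀ q g, q + g ≤ n →
      ContinuousOn (fun t => ∫ s in (0 : ℝ)..t, moment P lam0 r T S B q g s) (Set.Ici 0) :=
    fun q g hqg => continuousOn_primitive_Ici fun t ht =>
      hX.intervalIntegrable_moment hμ hr hlam0 hν hint hqg ht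
  refine ContinuousOn.congr ?_ fun t ht => hX.moment_eq_integral hμ hr hlam0 hν hint hag ht
  refine ((((continuousOn_const.add ?_).add (continuousOn_finsetSum _ fun j hj =>
    continuousOn_const.mul (hJ _ _ ?_))).add (continuousOn_const.mul (hJ _ _ (by omega)))).sub
      (continuousOn_const.mul (hJ _ _ hag)))
  · rcases a with _ | a
    · simpa using continuousOn_const
    · exact continuousOn_const.mul (hJ _ _ (by omega))
  · have := Finset.mem_range.1 hj
    omega

lemma hasDerivWithinAt_moment (hX : IsMarkovianQueue P ℱ lam0 μ r ν T S B) (hμ : 0 < μ)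
    (hr : 0 < r) (hlam0 : 0 ≤ lam0) (hν : ∀ᵐ x ∂ν, 0 < x) {n : ℕ}
    (hint : ∀ k ≤ n, Integrable (fun b : ℝ => b ^ k) ν) {a g : ℕ} (hag : a + g ≤ n) {t : ℝ}
    (ht : 0 ≤ t) : HasDerivWithinAt (moment P lam0 r T S B a g)
      (a * moment P lam0 r T S B (a - 1) (g + 1) t
        + ∑ j ∈ Finset.range g, μ * ((g.choose j : ℝ) * ∫ b, b ^ (g - j) ∂ν) *
          moment P lam0 r T S B (a + 1) j t
        + r * g * lam0 * moment P lam0 r T S B a (g - 1) t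
        - (r * g + a * μ) * moment P lam0 r T S B a g t) (Set.Ici 0) t := by
  have hJ : ∀ q g, q + g ≤ n → HasDerivWithinAt
      (fun t => ∫ s in (0 : ℝ)..t, moment P lam0 r T S B q g s)
      (moment P lam0 r T S B q g t) (Set.Ici 0) t := fun q g hqg =>
    hasDerivWithinAt_primitive_Ici (hX.continuousOn_moment hμ hr hlam0 hν hint hqg) ht
  have h1 : HasDerivWithinAt
      (fun t => a * ∫ s in (0 : ℝ)..t, moment P lam0 r T S B (a - 1) (g + 1) s)
      (a * moment P lam0 r T S B (a - 1) (g + 1) t) (Set.Ici 0) t := by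
    rcases a with _ | a
    · simpa using hasDerivWithinAt_const t (Set.Ici (0 : ℝ)) (0 : ℝ)
    · exact (hJ _ _ (by omega)).const_mul _
  have h2 : HasDerivWithinAt (fun t => ∑ j ∈ Finset.range g,
        μ * ((g.choose j : ℝ) * ∫ b, b ^ (g - j) ∂ν) *
          (∫ s in (0 : ℝ)..t, moment P lam0 r T S B (a + 1) j s))
      (∑ j ∈ Finset.range g, μ * ((g.choose j : ℝ) * ∫ b, b ^ (g - j) ∂ν) *
          moment P lam0 r T S B (a + 1) j t) (Set.Ici 0) t :=
    HasDerivWithinAt.fun_sum fun j hj =>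
      (hJ _ _ (by have := Finset.mem_range.1 hj; omega)).const_mul _
  exact ((((h1.const_add _).add h2).add ((hJ a (g - 1) (by omega)).const_mul _)).sub
    ((hJ a g hag).const_mul _)).congr
      (fun u hu => hX.moment_eq_integral hμ hr hlam0 hν hint hag hu)
      (hX.moment_eq_integral hμ hr hlam0 hν hint hag ht)

end RealMoments

end IsMarkovianQueue

/-! ### The moment vector: its equation and its long-time behaviour. -/

section Main

lemma integrable_pow_of_le {ν : Measure ℝ} [IsProbabilityMeasure ν] {n : ℕ}
    (hB : Integrable (fun x : ℝ => x ^ n) ν) {k : ℕ} (hk : k ≤ n) :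
    Integrable (fun x : ℝ => x ^ k) ν := by
  refine Integrable.mono' (g := fun x => 1 + |x ^ n|) ((integrable_const 1).add hB.abs)
    (by fun_prop) (ae_of_all _ fun x => ?_)
  rw [Real.norm_eq_abs, abs_pow, abs_pow]
  rcases le_total |x| 1 with h | h
  · have h1 := pow_le_one₀ (n := k) (abs_nonneg x) h
    have h2 := pow_nonneg (abs_nonneg x) n
    linarith
  · have h1 := pow_le_pow_right₀ h hk
    linarith

/-- The root is below μ + r because (μ-r)² + 4μb₁ < (μ-r)² + 4μr = (μ+r)², and the case k = 0 bounds
all others. -/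
lemma eigA_neg {μ r b₁ : ℝ} (hμ : 0 < μ) (hr : 0 < r) (h : b₁ < r) {n : ℕ}
    (hn : 1 ≤ n) (k : Fin (n + 1)) : eigA μ r b₁ n k < 0 := by
  have hs : √((μ - r) ^ 2 + 4 * μ * b₁) < μ + r := by
    rw [Real.sqrt_lt' (by positivity)]
    nlinarith
  have hs0 := Real.sqrt_nonneg ((μ - r) ^ 2 + 4 * μ * b₁)
  have hn' : (1 : ℝ) ≤ n := by exact_mod_cast hn
  have hk : (0 : ℝ) ≤ (k : ℝ) := Nat.cast_nonneg _
  unfold eigA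
  set s := √((μ - r) ^ 2 + 4 * μ * b₁)
  have h1 : ((n : ℝ) - 2 * k) / 2 * s ≤ (n : ℝ) / 2 * s := by
    apply mul_le_mul_of_nonneg_right _ hs0
    linarith
  nlinarith

variable {Ω : Type*} [mΩ : MeasurableSpace Ω] {P : Measure Ω} {ℱ : Filtration ℝ≥0 mΩ}
  {lam0 μ r : ℝ} {ν : Measure ℝ} {T S : ℕ → Ω → ℝ≥0∞} {B : ℕ → Ω → ℝ}
  [IsProbabilityMeasure P] [IsProbabilityMeasure ν]

lemma moment_zero_zero (t : ℝ) : moment P lam0 r T S B 0 0 t = 1 := by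
  simp [moment, momentVar]

namespace IsMarkovianQueue

lemma Z_zero (hX : IsMarkovianQueue P ℱ lam0 μ r ν T S B) (hμ : 0 < μ) (hr : 0 < r)
    (hlam0 : 0 ≤ lam0) (hν : ∀ᵐ x ∂ν, 0 < x) {n : ℕ}
    (hint : ∀ k ≤ n, Integrable (fun b : ℝ => b ^ k) ν) :
    Z P lam0 r T S B n 0 = lam0 ^ n • Pi.single (Fin.last n) (1 : ℝ) := by
  ext k
  have hk := Nat.lt_succ_iff.1 k.2
  rw [Z, hX.moment_eq_integral hμ hr hlam0 hν hint (by omega : n - (k : ℕ) + k ≤ n) le_rfl]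
  simp only [intervalIntegral.integral_same, mul_zero, Finset.sum_const_zero, add_zero, sub_zero,
    Pi.smul_apply, smul_eq_mul]
  rcases eq_or_ne k (Fin.last n) with h | h
  · simp [h]
  · have h1 : (k : ℕ) < n := lt_of_le_of_ne hk fun h' => h (Fin.ext h')
    rw [Pi.single_eq_of_ne h, Nat.descFactorial_eq_zero_iff_lt.2 (by omega)]
    simp

lemma hasDerivWithinAt_Z (hX : IsMarkovianQueue P ℱ lam0 μ r ν T S B) (hμ : 0 < μ) (hr : 0 < r)
    (hlam0 : 0 ≤ lam0) (hν : ∀ᵐ x ∂ν, 0 < x) {n : ℕ}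
    (hint : ∀ k ≤ n, Integrable (fun b : ℝ => b ^ k) ν) {t : ℝ} (ht : 0 ≤ t) :
    HasDerivWithinAt (Z P lam0 r T S B n) ((matA μ r (∫ x, x ∂ν) n).mulVec (Z P lam0 r T S B n t)
      + forcing P lam0 μ r ν T S B n t) (Set.Ici 0) t := by
  rw [hasDerivWithinAt_pi]
  intro k
  have hk := Nat.lt_succ_iff.1 k.2
  have h := hX.hasDerivWithinAt_moment hμ hr hlam0 hν hint (by omega : n - (k : ℕ) + k ≤ n) ht
  have hA := matA_mulVec μ r (∫ x, x ∂ν) n (fun l => moment P lam0 r T S B (n - l) l t) k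
  refine h.congr_deriv ?_
  rw [Pi.add_apply]
  change _ = (matA μ r (∫ x, x ∂ν) n).mulVec (fun l => moment P lam0 r T S B (n - l) l t) k + _
  rw [hA, forcing, Nat.cast_sub hk, Nat.sub_sub]
  rcases hk' : (k : ℕ) with _ | j
  · simp
    ring
  · have e1 : n - (j + 1) + 1 = n - j := by omega
    -- The top binomial term has coefficient kμb₁ and a moment of full order n: it is the
    -- subdiagonal of the matrix. The remaining terms form the forcing.
    rw [Finset.sum_range_succ, if_pos (by omega), Nat.add_sub_cancel, e1,
      show j + 1 - j = 1 by omega, Nat.choose_succ_self_right]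
    have e2 : (if 2 ≤ j + 1 then μ * ∑ i ∈ Finset.range j, (((j + 1).choose i : ℕ) : ℝ) *
        (∫ x, x ^ (j + 1 - i) ∂ν) * moment P lam0 r T S B (n - j) i t else 0)
        = ∑ i ∈ Finset.range j, μ * ((((j + 1).choose i : ℕ) : ℝ) *
        (∫ x, x ^ (j + 1 - i) ∂ν)) * moment P lam0 r T S B (n - j) i t := by
      split_ifs with h2
      · rw [Finset.mul_sum]
        exact Finset.sum_congr rfl fun i _ => by ring
      · have : j = 0 := by omega
        simp [this]
    rw [e2]
    simp only [pow_one]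
    push_cast
    ring

lemma continuousOn_forcing (hX : IsMarkovianQueue P ℱ lam0 μ r ν T S B) (hμ : 0 < μ) (hr : 0 < r)
    (hlam0 : 0 ≤ lam0) (hν : ∀ᵐ x ∂ν, 0 < x) {n : ℕ}
    (hint : ∀ k ≤ n, Integrable (fun b : ℝ => b ^ k) ν) :
    ContinuousOn (forcing P lam0 μ r ν T S B n) (Set.Ici 0) := by
  refine continuousOn_pi.2 fun k => ?_
  have hk := Nat.lt_succ_iff.1 k.2
  have hm : ∀ q g, q + g ≤ n → ContinuousOn (moment P lam0 r T S B q g) (Set.Ici 0) :=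
    fun q g h => hX.continuousOn_moment hμ hr hlam0 hν hint h
  unfold forcing
  refine ContinuousOn.add ?_ ?_
  · split_ifs with h1
    · exact continuousOn_const.mul (hm _ _ (by omega))
    · exact continuousOn_const
  · split_ifs with h2
    · refine continuousOn_const.mul (continuousOn_finsetSum _ fun j hj =>
        continuousOn_const.mul (hm _ _ ?_))
      have := Finset.mem_range.1 hj
      omega
    · exact continuousOn_const

lemma tendsto_Z_of_lt (hX : IsMarkovianQueue P ℱ lam0 μ r ν T S B) (hμ : 0 < μ) (hr : 0 < r)
    (hlam0 : 0 ≤ lam0) (hν : ∀ᵐ x ∂ν, 0 < x) (hb₁ : 0 < ∫ x, x ∂ν) (hlt : ∫ x, x ∂ν < r) {n : ℕ}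
    (hint : ∀ k ≤ n, Integrable (fun b : ℝ => b ^ k) ν) :
    ∃ z, Tendsto (Z P lam0 r T S B n) atTop (𝓝 z) := by
  induction n using Nat.strong_induction_on with
  | _ n ih =>
    -- Order 0 is treated directly, since there the only eigenvalue is 0.
    rcases Nat.eq_zero_or_pos n with rfl | hn
    · refine ⟨fun _ => 1, tendsto_pi_nhds.2 fun k => ?_⟩
      have : ∀ t, Z P lam0 r T S B 0 t k = 1 := fun t => by
        have hk : (k : ℕ) = 0 := by omega
        simp only [Z, hk]
        exact moment_zero_zero t
      simp only [this]
      exact tendsto_const_nhds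
    · have hm : ∀ q g, q + g < n → ∃ l, Tendsto (moment P lam0 r T S B q g) atTop (𝓝 l) := by
        intro q g h
        obtain ⟨z, hz⟩ := ih (q + g) h fun k hk => hint k (by omega)
        have := tendsto_pi_nhds.1 hz ⟨g, by omega⟩
        simp only [Z, Nat.add_sub_cancel] at this
        exact ⟨_, this⟩
      have hC : ∀ k, ∃ l, Tendsto (fun t => forcing P lam0 μ r ν T S B n t k) atTop (𝓝 l) := by
        intro k
        have hk := Nat.lt_succ_iff.1 k.2
        have h1 : ∃ l, Tendsto (fun t => if 1 ≤ (k : ℕ) then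
            k * r * lam0 * moment P lam0 r T S B (n - k) (k - 1) t else 0) atTop (𝓝 l) := by
          split_ifs with h
          · obtain ⟨l, hl⟩ := hm (n - k) (k - 1) (by omega)
            exact ⟨_, hl.const_mul _⟩
          · exact ⟨0, tendsto_const_nhds⟩
        have h2 : ∃ l, Tendsto (fun t => if 2 ≤ (k : ℕ) then
            μ * ∑ j ∈ Finset.range (k - 1), ((k : ℕ).choose j : ℝ) * (∫ x, x ^ (k - j : ℕ) ∂ν) *
              moment P lam0 r T S B (n - k + 1) j t else 0) atTop (𝓝 l) := by
          split_ifs with h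
          · have h3 : ∀ j, ∃ l, j ∈ Finset.range ((k : ℕ) - 1) → Tendsto (fun t =>
                ((k : ℕ).choose j : ℝ) * (∫ x, x ^ (k - j : ℕ) ∂ν) *
                  moment P lam0 r T S B (n - k + 1) j t) atTop (𝓝 l) := by
              intro j
              by_cases hj : j ∈ Finset.range ((k : ℕ) - 1)
              · have := Finset.mem_range.1 hj
                obtain ⟨l, hl⟩ := hm (n - k + 1) j (by omega)
                exact ⟨_, fun _ => hl.const_mul _⟩
              · exact ⟨0, fun h => absurd h hj⟩
            choose l hl using h3
            exact ⟨_, (tendsto_finsetSum _ hl).const_mul μ⟩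
          · exact ⟨0, tendsto_const_nhds⟩
        obtain ⟨l1, hl1⟩ := h1
        obtain ⟨l2, hl2⟩ := h2
        exact ⟨_, hl1.add hl2⟩
      choose l hl using hC
      exact tendsto_of_linear_ode (isUnit_eigMat μ r _ hμ hb₁ n) (matA_mul_eigMat μ r _ hμ hb₁ n)
        (eigA_neg hμ hr hlt hn) (tendsto_pi_nhds.2 hl)
        fun t ht => hX.hasDerivWithinAt_Z hμ hr hlam0 hν hint ht

/-- In the non-subcritical case, `E Λ + r E Q` grows at least linearly. -/
lemma le_moment_add_of_le (hX : IsMarkovianQueue P ℱ lam0 μ r ν T S B) (hμ : 0 < μ) (hr : 0 < r)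
    (hlam0 : 0 ≤ lam0) (hν : ∀ᵐ x ∂ν, 0 < x) (hint : ∀ k ≤ 1, Integrable (fun b : ℝ => b ^ k) ν)
    (hle : r ≤ ∫ x, x ∂ν) {t : ℝ} (ht : 0 ≤ t) :
    r * lam0 * t ≤ moment P lam0 r T S B 0 1 t + r * moment P lam0 r T S B 1 0 t := by
  -- The weight r on E Q cancels the decay -rE Λ: the sum has derivative rλ₀ + μ(b₁ - r)E Q, so
  -- subtracting rλ₀t leaves a nondecreasing function when b₁ ≥ r.
  set f : ℝ → ℝ := fun t =>
    moment P lam0 r T S B 0 1 t + r * moment P lam0 r T S B 1 0 t - r * lam0 * t with hf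
  have hder : ∀ s, 0 ≤ s → HasDerivWithinAt f
      (μ * (∫ x, x ∂ν - r) * moment P lam0 r T S B 1 0 s) (Set.Ici 0) s := by
    intro s hs
    have h1 := hX.hasDerivWithinAt_moment hμ hr hlam0 hν hint (by norm_num : 0 + 1 ≤ 1) hs
    have h2 := hX.hasDerivWithinAt_moment hμ hr hlam0 hν hint (by norm_num : 1 + 0 ≤ 1) hs
    refine ((h1.add (h2.const_mul r)).sub
      (((hasDerivAt_id s).const_mul (r * lam0)).hasDerivWithinAt)).congr_deriv ?_
    simp only [Finset.sum_range_one, Finset.range_zero, Finset.sum_empty]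
    simp
    rw [moment_zero_zero]
    ring
  have hmono : MonotoneOn f (Set.Ici 0) := by
    refine monotoneOn_of_hasDerivWithinAt_nonneg (convex_Ici 0)
      (f' := fun s => μ * (∫ x, x ∂ν - r) * moment P lam0 r T S B 1 0 s)
      (fun s hs => (hder s hs).continuousWithinAt) (fun s hs => ?_) (fun s hs => ?_)
    · exact (hder s (interior_subset hs)).mono interior_subset
    · have := hX.moment_nonneg hlam0 hν 1 0 (interior_subset hs : s ∈ Set.Ici (0 : ℝ))
      have h2 := sub_nonneg.2 hle
      positivity
  have h := hmono (Set.mem_Ici.2 le_rfl) (Set.mem_Ici.2 ht) ht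
  have h0 : 0 ≤ f 0 := by
    have h1 := hX.moment_nonneg hlam0 hν 0 1 le_rfl
    have h2 := hX.moment_nonneg hlam0 hν 1 0 le_rfl
    simp only [hf, mul_zero, sub_zero]
    positivity
  have := h0.trans h
  simp only [hf] at this
  linarith

/-- Pointwise, x ≤ 1 + x^n for x ≥ 0 and q ≤ n + (q)_n, so the last and first entries of Z control E
Λ and E Q. -/
lemma moment_one_le (hX : IsMarkovianQueue P ℱ lam0 μ r ν T S B) (hμ : 0 < μ) (hr : 0 < r)
    (hlam0 : 0 ≤ lam0) (hν : ∀ᵐ x ∂ν, 0 < x) {n : ℕ} (hn : 1 ≤ n)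
    (hint : ∀ k ≤ n, Integrable (fun b : ℝ => b ^ k) ν) {t : ℝ} (ht : 0 ≤ t) :
    moment P lam0 r T S B 0 1 t ≤ 1 + moment P lam0 r T S B 0 n t ∧
      moment P lam0 r T S B 1 0 t ≤ n + moment P lam0 r T S B n 0 t := by
  have hI : ∀ q g, q + g ≤ n → Integrable (momentVar lam0 r T S B q g t) P := fun q g h =>
    hX.integrable_momentVar hμ hr hlam0 hν hint h ht
  constructor
  · have h1 : (1 : ℝ) + moment P lam0 r T S B 0 n t
        = ∫ ω, (1 + momentVar lam0 r T S B 0 n t ω) ∂P := by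
      rw [integral_add (integrable_const 1) (hI 0 n (by omega))]
      simp [moment]
    rw [h1]
    refine integral_mono_ae (hI 0 1 (by omega)) ((integrable_const 1).add (hI 0 n (by omega))) ?_
    filter_upwards [hX.ae_mark_pos hν] with ω hω
    have hΛ := hlam0.trans (intensity_ge (lam0 := lam0) (r := r) (hX.departures ω) hω t)
    simp only [momentVar, Nat.descFactorial_zero, Nat.cast_one, one_mul, pow_one]
    rcases le_total (intensity lam0 r S B t ω) 1 with h | h
    · have := pow_nonneg hΛ n
      linarith
    · have := le_self_pow₀ h (by omega : n ≠ 0)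
      linarith
  · have h1 : (n : ℝ) + moment P lam0 r T S B n 0 t
        = ∫ ω, (n + momentVar lam0 r T S B n 0 t ω) ∂P := by
      rw [integral_add (integrable_const _) (hI n 0 (by omega))]
      simp [moment]
    rw [h1]
    refine integral_mono (hI 1 0 (by omega)) ((integrable_const _).add (hI n 0 (by omega)))
      fun ω => ?_
    simp only [momentVar, Nat.descFactorial_one, pow_zero, mul_one]
    have h2 : queue T S t ω ≤ n + (queue T S t ω).descFactorial n := by
      set q := queue T S t ω
      have h3 := Nat.pow_sub_le_descFactorial q n
      rcases le_or_gt q n with h | h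
      · omega
      · have := Nat.le_self_pow (by omega : n ≠ 0) (q + 1 - n)
        omega
    exact_mod_cast h2

lemma lt_of_tendsto_Z (hX : IsMarkovianQueue P ℱ lam0 μ r ν T S B) (hμ : 0 < μ) (hr : 0 < r)
    (hlam0 : 0 < lam0) (hν : ∀ᵐ x ∂ν, 0 < x) {n : ℕ} (hn : 1 ≤ n)
    (hint : ∀ k ≤ n, Integrable (fun b : ℝ => b ^ k) ν) {z : Fin (n + 1) → ℝ}
    (hz : Tendsto (Z P lam0 r T S B n) atTop (𝓝 z)) : ∫ x, x ∂ν < r := by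
  by_contra hle
  have h0 := tendsto_pi_nhds.1 hz 0
  have hl := tendsto_pi_nhds.1 hz (Fin.last n)
  simp only [Z, Fin.val_zero, Nat.sub_zero, Fin.val_last, Nat.sub_self] at h0 hl
  have hlim : Tendsto (fun t => (1 + moment P lam0 r T S B 0 n t)
      + r * (n + moment P lam0 r T S B n 0 t)) atTop (𝓝 (1 + z (Fin.last n) + r * (n + z 0))) :=
    (hl.const_add 1).add ((h0.const_add (n : ℝ)).const_mul r)
  have hinf : Tendsto (fun t : ℝ => r * lam0 * t) atTop atTop :=
    tendsto_id.const_mul_atTop (by positivity)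
  refine not_tendsto_nhds_of_tendsto_atTop (tendsto_atTop_mono' atTop ?_ hinf) _ hlim
  filter_upwards [eventually_ge_atTop 0] with t ht
  have h1 := hX.le_moment_add_of_le hμ hr hlam0.le hν (fun k hk => hint k (by omega))
    (not_lt.1 hle) ht
  obtain ⟨h2, h3⟩ := hX.moment_one_le hμ hr hlam0.le hν hn hint ht
  have := mul_le_mul_of_nonneg_left h3 hr.le
  linarith

end IsMarkovianQueue

end Main

end DelayedHawkes

theorem theorem8 {Ω : Type*} [mΩ : MeasurableSpace Ω] (P : Measure Ω) [IsProbabilityMeasure P]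
    (ℱ : Filtration ℝ≥0 mΩ)
    (lam0 μ r : ℝ) (hlam0 : 0 < lam0) (hμ : 0 < μ) (hr : 0 < r)
    (ν : Measure ℝ) [IsProbabilityMeasure ν] (hν : ∀ᵐ x ∂ν, 0 < x)
    (T S : ℕ → Ω → ℝ≥0∞) (B : ℕ → Ω → ℝ)
    (hX : DelayedHawkes.IsMarkovianQueue P ℱ lam0 μ r ν T S B)
    (n : ℕ) (hn : 1 ≤ n) (hB : Integrable (fun x : ℝ => x ^ n) ν)
    (b₁ : ℝ) (hb₁ : b₁ = ∫ x, x ∂ν)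
    (A : Matrix (Fin (n + 1)) (Fin (n + 1)) ℝ) (hA : A = DelayedHawkes.matA μ r b₁ n)
    (lam : Fin (n + 1) → ℝ) (hlam : lam = DelayedHawkes.eigA μ r b₁ n)
    (Z : ℝ → Fin (n + 1) → ℝ) (hZ : Z = DelayedHawkes.Z P lam0 r T S B n)
    (C : ℝ → Fin (n + 1) → ℝ) (hC : C = DelayedHawkes.forcing P lam0 μ r ν T S B n) :
    -- the joint moments of order at most `n` are finite
    (∀ q g : ℕ, q + g ≤ n → ∀ t : ℝ, 0 ≤ t →
      Integrable (DelayedHawkes.momentVar lam0 r T S B q g t) P) ∧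
    -- the linear ODE and its initial condition
    (∀ t : ℝ, 0 ≤ t → HasDerivWithinAt Z (A.mulVec (Z t) + C t) (Set.Ici 0) t) ∧
    Z 0 = lam0 ^ n • Pi.single (Fin.last n) (1 : ℝ) ∧
    -- the variation-of-constants formula
    (∀ t : ℝ, 0 ≤ t →
      IntervalIntegrable (fun s => (NormedSpace.exp ((t - s) • A)).mulVec (C s)) volume 0 t ∧
      Z t = (NormedSpace.exp (t • A)).mulVec (Z 0) +
        ∫ s in (0 : ℝ)..t, (NormedSpace.exp ((t - s) • A)).mulVec (C s)) ∧
    -- `Z` is the only solution of the initial value problem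
    (∀ Y : ℝ → Fin (n + 1) → ℝ,
      (∀ t : ℝ, 0 ≤ t → HasDerivWithinAt Y (A.mulVec (Y t) + C t) (Set.Ici 0) t) →
      Y 0 = Z 0 → ∀ t : ℝ, 0 ≤ t → Y t = Z t) ∧
    -- the `lam k` are pairwise distinct and are exactly the eigenvalues of `A`
    Function.Injective lam ∧
    (∀ x : ℝ, Module.End.HasEigenvalue (Matrix.toLin' A) x ↔ ∃ k, x = lam k) ∧
    -- the matrix exponential by Lagrange–Sylvester interpolation
    (∀ t : ℝ, NormedSpace.exp (t • A) =
      ∑ k, Real.exp (lam k * t) •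
        (((List.finRange (n + 1)).filter (fun j => j ≠ k)).map
          (fun j => (lam k - lam j)⁻¹ • (A - lam j • (1 : Matrix (Fin (n + 1)) (Fin (n + 1)) ℝ)))).prod) ∧
    -- stability
    ((∃ z : Fin (n + 1) → ℝ, Tendsto Z atTop (𝓝 z)) ↔ b₁ / r < 1) := by

  subst hA hlam hZ hC hb₁
  have hint : ∀ k ≤ n, Integrable (fun b : ℝ => b ^ k) ν := fun k hk =>
    DelayedHawkes.integrable_pow_of_le hB hk
  -- Strict positivity of the mean makes the discriminant positive, hence the eigenvalues distinct.
  have hb : 0 < ∫ x, x ∂ν := by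
    have h1 : Integrable (fun x : ℝ => x) ν := by simpa using hint 1 hn
    rw [integral_pos_iff_support_of_nonneg_ae (by filter_upwards [hν] with x hx using hx.le) h1]
    have h2 : ∀ᵐ x ∂ν, x ∈ Function.support fun x : ℝ => x := by
      filter_upwards [hν] with x hx using hx.ne'
    rw [pos_iff_ne_zero]
    intro h0
    obtain ⟨x, hx, hx'⟩ := (h2.and (measure_eq_zero_iff_ae_notMem.1 h0)).exists
    exact hx' hx
  have hV := DelayedHawkes.isUnit_eigMat μ r _ hμ hb n
  have hAV := DelayedHawkes.matA_mul_eigMat μ r _ hμ hb n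
  have hcont := hX.continuousOn_forcing hμ hr hlam0.le hν hint
  have hode := fun (t : ℝ) (ht : 0 ≤ t) => hX.hasDerivWithinAt_Z hμ hr hlam0.le hν hint ht
  refine ⟨fun q g hqg t ht => hX.integrable_momentVar hμ hr hlam0.le hν hint hqg ht, hode,
    hX.Z_zero hμ hr hlam0.le hν hint,
    fun t ht => DelayedHawkes.variation_of_constants hV hAV hcont hode ht, fun Y hY h0 t ht => ?_,
    DelayedHawkes.eigA_injective μ r _ hμ hb n,
    DelayedHawkes.hasEigenvalue_iff_of_diagonalized hV hAV,
    DelayedHawkes.exp_smul_eq_interpolation hV hAV (DelayedHawkes.eigA_injective μ r _ hμ hb n),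
    ?_⟩
  -- Both solutions are given by the same formula in terms of a common initial value.
  · rw [(DelayedHawkes.variation_of_constants hV hAV hcont hY ht).2,
      (DelayedHawkes.variation_of_constants hV hAV hcont hode ht).2, h0]
  · rw [div_lt_one hr]
    exact ⟨fun ⟨z, hz⟩ => hX.lt_of_tendsto_Z hμ hr hlam0 hν hn hint hz,
      fun h => hX.tendsto_Z_of_lt hμ hr hlam0.le hν hb h hint⟩
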